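/- **Theorem (Absolute continuity of Brownian last passage percolation).** For a sequence $f=(f_1,f_2,\dots)$ of real-valued functions that are continuous on $[x,y]$, $x<y$, and integers $1\le m\le \ell$, a *path* from $(x,\ell)$ to $(y,m)$ is a non-increasing function $\pi:[x,y]\to\mathbb N=\{1,2,\dots\}$ that is càdlàg on $(x,y)$, with $\pi(x)=\ell$ and $\pi(y)=m$. Writing $t_i$ ($m\le i<\ell$) for the time at which $\pi$ jumps from line $i+1$ to line $i$ (the same time for each line boundary crossed in one jump), and $t_\ell=x$, $t_{m-1}=y$, the length of $\pi$ is $\sum_{i=m}^{\ell}\bigl(f_i(t_{i-1})-f_i(t_i)\bigr)$, and the last passage value $f[(x,\ell)\to(y,m)]$ is the supremum of the lengths of all paths from $(x,\ell)$ to $(y,m)$. Let $\mathcal B=(\mathcal B_1,\mathcal B_2,\dots)$ be a sequence of independent Brownian motions on $[0,\infty)$ started from the origin with diffusion parameter $2$ (that is, $\sqrt2$ times standard Brownian motions, with almost surely continuous paths), let $k\ge 1$ be an integer, let $g=(g_1,\dots,g_k)\in\mathbb R^k$ and let $0<r<y_0$. Put $$\mathcal H_{k,g}(y)=\max_{1\le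 \ell\le k}\bigl(g_\ell+\mathcal B[(0,\ell)\to(y,1)]\bigr),\qquad y\in[r,y_0].$$ Then $\mathcal H_{k,g}$ is almost surely continuous on $[r,y_0]$ and defines an (almost everywhere measurable) random element of $C([r,y_0];\mathbb R)$ with its Borel $\sigma$-algebra, and its law $\xi_{k,g,r}$ is absolutely continuous with respect to the law $\mu_r$ on $C([r,y_0];\mathbb R)$ of the restriction to $[r,y_0]$ of a Brownian motion started from the origin at time $0$ with diffusion parameter $2$: $$\xi_{k,g,r}\ll\mu_r .$$ -/

import Mathlib

open MeasureTheory ProbabilityTheory Filter Topology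
open scoped NNReal

namespace BrownianLPP

/-- `π` is a path from `(x, ℓ)` to `(y, m)`: a non-increasing function `[x, y] → {1, 2, …}`,
càdlàg on `(x, y)`, with `π x = ℓ` and `π y = m`. The values of `π` off `[x, y]` play no role. -/
structure IsPath (x : ℝ) (ℓ : ℕ+) (y : ℝ) (m : ℕ+) (π : ℝ → ℕ+) : Prop where
  antitoneOn : AntitoneOn π (Set.Icc x y)
  right_cont : ∀ t ∈ Set.Ioo x y, ContinuousWithinAt π (Set.Ici t) t
  left_lim : ∀ t ∈ Set.Ioo x y, ∃ j : ℕ+, Tendsto π (𝓝[<] t) (𝓝 j)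
  left_end : π x = ℓ
  right_end : π y = m

/-- The time at which a path on `[x, y]` arrives at line `i` (or at a line above it): this is the
time of the jump from line `i + 1` to line `i`, and it is `x` when `i` is the starting line. A path
that jumps over several lines at once has the same jump time for each of them. -/
noncomputable def enterTime (x y : ℝ) (π : ℝ → ℕ+) (i : ℕ+) : ℝ :=
  sInf {t | t ∈ Set.Icc x y ∧ π t ≤ i}

/-- The time at which a path on `[x, y]` leaves line `i`: this is the time of the jump from line
`i` to line `i - 1`, and it is `y` when `i` is the final line. -/
noncomputable def leaveTime (x y : ℝ) (π : ℝ → ℕ+) (i : ℕ+) : ℝ :=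
  sSup {t | t ∈ Set.Icc x y ∧ i ≤ π t}

/-- The length of a path `π` from `(x, ℓ)` to `(y, m)` over the ensemble `f`: the sum of the
increments of `f` along `π`. -/
noncomputable def pathLength (f : ℕ+ → ℝ → ℝ) (x : ℝ) (ℓ : ℕ+) (y : ℝ) (m : ℕ+)
    (π : ℝ → ℕ+) : ℝ :=
  ∑ i ∈ Finset.Icc m ℓ, (f i (leaveTime x y π i) - f i (enterTime x y π i))

/-- The last passage value `f[(x, ℓ) → (y, m)]`: the supremum of the lengths of the paths from
`(x, ℓ)` to `(y, m)`. -/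
noncomputable def lastPassage (f : ℕ+ → ℝ → ℝ) (x : ℝ) (ℓ : ℕ+) (y : ℝ) (m : ℕ+) : ℝ :=
  sSup {L | ∃ π : ℝ → ℕ+, IsPath x ℓ y m π ∧ L = pathLength f x ℓ y m π}

/-- `y ↦ max_{1 ≤ ℓ ≤ k} (g_ℓ + f[(0, ℓ) → (y, 1)])`, where the entry of `g : Fin k → ℝ` at the
index `j` is `g_{j + 1}`. -/
noncomputable def maxLastPassage (f : ℕ+ → ℝ → ℝ) {k : ℕ} (g : Fin k → ℝ) (y : ℝ) : ℝ :=
  ⨆ j : Fin k, (g j + lastPassage f 0 (Nat.succPNat j) y 1)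

/-- Brownian motion on `[0, ∞)` started from the origin with diffusion parameter `σ2`, that is,
`√σ2` times a standard Brownian motion: it has variance `σ2 * t` at time `t`. -/
def IsBrownianMotion {Ω : Type*} [MeasurableSpace Ω] (σ2 : ℝ≥0) (X : ℝ≥0 → Ω → ℝ)
    (P : Measure Ω) : Prop :=
  ∃ W : ℝ≥0 → Ω → ℝ, IsBrownianReal W P ∧ ∀ t ω, X t ω = Real.sqrt σ2 * W t ω

/-- An ensemble `B 1, B 2, …` of independent Brownian motions with diffusion parameter `σ2`. -/
structure IsBrownianEnsemble {Ω : Type*} [MeasurableSpace Ω] (σ2 : ℝ≥0)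
    (B : ℕ+ → ℝ≥0 → Ω → ℝ) (P : Measure Ω) : Prop where
  brownian : ∀ i, IsBrownianMotion σ2 (B i) P
  indep : iIndepFun (fun (i : ℕ+) (ω : Ω) (t : ℝ≥0) => B i t ω) P

/-- The space `C([a, b]; ℝ)` (with the uniform topology) carries its Borel sigma-algebra. -/
instance pathMeasurableSpace (a b : ℝ) : MeasurableSpace C(Set.Icc a b, ℝ) :=
  borel _

instance pathBorelSpace (a b : ℝ) : BorelSpace C(Set.Icc a b, ℝ) :=
  ⟨rfl⟩

open Classical in
/-- The restriction of `F` to `[a, b]` as an element of `C([a, b]; ℝ)`, for `F` continuous on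
`[a, b]` (and a default value otherwise). -/
noncomputable def restrictPath (a b : ℝ) (F : ℝ → ℝ) : C(Set.Icc a b, ℝ) :=
  if h : ContinuousOn F (Set.Icc a b) then ⟨(Set.Icc a b).domRestrict F, h.domRestrict⟩ else 0

/-- The random function `y ↦ max_{1 ≤ ℓ ≤ k} (g_ℓ + B[(0, ℓ) → (y, 1)])`, for `y ≥ 0`. -/
noncomputable def brownianH {Ω : Type*} (B : ℕ+ → ℝ≥0 → Ω → ℝ) {k : ℕ} (g : Fin k → ℝ) (ω : Ω) :
    ℝ → ℝ :=
  maxLastPassage (fun i t => B i t.toNNReal ω) g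

end BrownianLPP

/-!
The last passage value is built up line by line. If `x t` is the maximal last passage value from
the lines `2, …, k` to the line `2` at time `t`, then adding the line `b` on top, with entry cost
`g`, gives the path `t ↦ b t + max (g, max_{s ≤ t} (x s - b s))`, called the reflection of `b` off
`x` here. Iterated reflections agree with last passage values at positive times
(`maxLastPassage_eq_iterReflect`), and are continuous by construction. After division by `√2` all
lines are standard Brownian motions, so it suffices to show that reflecting an independent Brownian
motion off a random path preserves the property of being absolutely continuous with respect to
Wiener measure on every interval `[r, r + L]` with `r > 0` (`IsWiener.locallyAbsCont_reflect`).

Let `S` be the reflection of a Brownian motion `b` off `x`. After time `r` it is the reflection,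
started from `h = S r`, of the increments of `b` off the path `x` after time `r`. Given `x`, the
value `h` exceeds `x r` and its law has no singular part: writing `b` as a bridge on `[0, r]` plus
an independent Gaussian multiple of a linear function makes `h` a function of the Gaussian with
locally positive slope (`IsWiener.ae_reflect_eval`). Moreover, by the assumption on `x`, null sets
may be computed as if `x` was a Brownian motion started at time `r` from a point with Lebesgue law.

The problem is then to reflect a Brownian motion `b` from `h` off an independent Brownian motion
`w` from `x₀ < h`, where `h` and `x₀` have Lebesgue laws. With the independent Brownian motions
`U = (w + b) / √2` and `Z = (w - b) / √2`, the outcome is `h + (U + V) / √2`, where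
`V = -Z + 2 max (max Z + m, 0)` is Pitman's transform of `Z` with a starting level `m < 0`
proportional to `x₀ - h` (`reflect_eq_pitman`). By a version of Pitman's `2M - X` theorem, if `m` is distributed according
to Lebesgue measure on `(-∞, 0)`, then on the event that the final level lies in a bounded set the
law of `V` on `[0, L]` has a density with respect to Wiener measure (`IsWiener.ae_pitman_null`).
Hence `(U + V) / √2` is absolutely continuous with respect to `(U + Z) / √2`, which is a Brownian
motion.

The version of Pitman's theorem in question is an identity between σ-finite measures. It holds for
a single time by the reflection principle, in the form of the joint law of the maximum, its
distance to the endpoint and the endpoint (`IsWiener.pitman_step`). Since the transformed path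
together with its level is Markovian, it extends to finitely many times by induction
(`IsWiener.pitman_fdd`).
-/

namespace BrownianLPP

/-! ### Path space -/

/-- The space of continuous paths on `[0, ∞)`. -/
abbrev Path : Type := C(ℝ≥0, ℝ)

/-- The cylinder sigma-algebra on path space, generated by the evaluations. -/
instance cylinderMeasurableSpace : MeasurableSpace Path :=
  MeasurableSpace.comap (fun w t => w t) MeasurableSpace.pi

lemma measurable_coe_path : Measurable (fun (w : Path) (t : ℝ≥0) => w t) :=
  comap_measurable _

@[fun_prop]
lemma measurable_eval_path (t : ℝ≥0) : Measurable (fun w : Path => w t) :=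
  (measurable_pi_apply t).comp measurable_coe_path

@[fun_prop]
lemma measurable_path_eval {α : Type*} [MeasurableSpace α] {F : α → Path} (hF : Measurable F)
    (t : ℝ≥0) : Measurable (fun a => F a t) :=
  (measurable_eval_path t).comp hF

lemma measurable_path_of_eval {α : Type*} [MeasurableSpace α] {F : α → Path}
    (h : ∀ t, Measurable (fun a => F a t)) : Measurable F :=
  measurable_comap_iff.2 (measurable_pi_iff.2 h)

@[fun_prop]
lemma measurable_path_add {α : Type*} [MeasurableSpace α] {F G : α → Path}
    (hF : Measurable F) (hG : Measurable G) : Measurable (fun a => F a + G a) :=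
  measurable_path_of_eval fun t =>
    ((measurable_eval_path t).comp hF).add ((measurable_eval_path t).comp hG)

@[fun_prop]
lemma measurable_path_sub {α : Type*} [MeasurableSpace α] {F G : α → Path}
    (hF : Measurable F) (hG : Measurable G) : Measurable (fun a => F a - G a) :=
  measurable_path_of_eval fun t =>
    ((measurable_eval_path t).comp hF).sub ((measurable_eval_path t).comp hG)

@[fun_prop]
lemma measurable_path_neg {α : Type*} [MeasurableSpace α] {F : α → Path}
    (hF : Measurable F) : Measurable (fun a => -F a) :=
  measurable_path_of_eval fun t => ((measurable_eval_path t).comp hF).neg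

@[fun_prop]
lemma measurable_path_const_smul {α : Type*} [MeasurableSpace α] {F : α → Path} (c : ℝ)
    (hF : Measurable F) : Measurable (fun a => c • F a) :=
  measurable_path_of_eval fun t => ((measurable_eval_path t).comp hF).const_smul c

@[fun_prop]
lemma measurable_path_const {α : Type*} [MeasurableSpace α] {F : α → ℝ}
    (hF : Measurable F) : Measurable (fun a => ContinuousMap.const ℝ≥0 (F a)) :=
  measurable_path_of_eval fun _ => hF

/-- A countable set of evaluation times already generates the cylinder sigma-algebra. -/
instance countablyGenerated_path : MeasurableSpace.CountablyGenerated Path := by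
  have key : (cylinderMeasurableSpace : MeasurableSpace Path) =
      MeasurableSpace.comap
        (fun (w : Path) (n : ℕ) => w (TopologicalSpace.denseSeq ℝ≥0 n)) MeasurableSpace.pi := by
    apply le_antisymm
    · let m : MeasurableSpace Path := MeasurableSpace.comap
        (fun (w : Path) (n : ℕ) => w (TopologicalSpace.denseSeq ℝ≥0 n)) MeasurableSpace.pi
      refine measurable_iff_comap_le.1 (measurable_pi_iff.2 fun t => ?_)
      have hd : ∀ n, Measurable[m] fun w : Path => w (TopologicalSpace.denseSeq ℝ≥0 n) :=
        fun n => (measurable_pi_apply n).comp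
          (comap_measurable fun (w : Path) (n : ℕ) => w (TopologicalSpace.denseSeq ℝ≥0 n))
      obtain ⟨x, hx, hxt⟩ := mem_closure_iff_seq_limit.1
        ((TopologicalSpace.denseRange_denseSeq ℝ≥0) t)
      choose n hn using hx
      refine measurable_of_tendsto_metrizable (f := fun i (w : Path) => w (x i)) (fun i => ?_)
        (tendsto_pi_nhds.2 fun w => (w.continuous.tendsto t).comp hxt)
      rw [← hn i]
      exact hd (n i)
    · exact measurable_iff_comap_le.1 (measurable_pi_iff.2 fun n => measurable_eval_path _)
  rw [key]
  exact MeasurableSpace.CountablyGenerated.comap _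

/-- Finite measures on path space are determined by their finite-dimensional distributions. -/
lemma path_measure_ext {μ ν : Measure Path} [IsFiniteMeasure μ]
    (h : ∀ I : Finset ℝ≥0, μ.map (fun w => I.restrict fun t => w t) =
      ν.map (fun w => I.restrict fun t => w t)) : μ = ν := by
  have hproj : ∀ ρ : Measure Path, IsProjectiveLimit (ρ.map fun (w : Path) (t : ℝ≥0) => w t)
      (fun I : Finset ℝ≥0 => ρ.map (fun w => I.restrict fun t => w t)) := by
    intro ρ I
    rw [Measure.map_map (Finset.measurable_restrict I) measurable_coe_path]
    rfl
  have h1 := hproj μ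
  have h2 := hproj ν
  simp_rw [← h] at h2
  have h3 := h1.unique h2
  ext s hs
  obtain ⟨t, ht, rfl⟩ := hs
  rw [← Measure.map_apply measurable_coe_path ht, h3, Measure.map_apply measurable_coe_path ht]

/-- The path `w` frozen at time `L`. -/
def stopAt (L : ℝ≥0) (w : Path) : Path := w.comp ⟨fun t => min t L, by fun_prop⟩

/-- The path `w` seen from time `r` on. -/
def shiftBy (r : ℝ≥0) (w : Path) : Path := w.comp ⟨fun t => r + t, by fun_prop⟩

/-- The increments of `w` after time `r`. -/
def incrFrom (r : ℝ≥0) (w : Path) : Path := shiftBy r w - ContinuousMap.const _ (w r)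

@[simp] lemma stopAt_apply (L : ℝ≥0) (w : Path) (t : ℝ≥0) : stopAt L w t = w (min t L) := rfl

@[simp] lemma shiftBy_apply (r : ℝ≥0) (w : Path) (t : ℝ≥0) : shiftBy r w t = w (r + t) := rfl

@[simp] lemma incrFrom_apply (r : ℝ≥0) (w : Path) (t : ℝ≥0) :
    incrFrom r w t = w (r + t) - w r := rfl

@[fun_prop]
lemma measurable_stopAt (L : ℝ≥0) : Measurable (stopAt L) :=
  measurable_path_of_eval fun _ => measurable_eval_path _

@[fun_prop]
lemma measurable_shiftBy (r : ℝ≥0) : Measurable (shiftBy r) :=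
  measurable_path_of_eval fun _ => measurable_eval_path _

@[fun_prop]
lemma measurable_incrFrom (r : ℝ≥0) : Measurable (incrFrom r) :=
  measurable_path_of_eval fun _ => (measurable_eval_path _).sub (measurable_eval_path _)

/-- The running maximum of a path: its value at `t` is the maximum over `[0, t]`, which is
parametrised by the fixed compact interval `[0, 1]` for the sake of continuity. -/
noncomputable def runMax (w : Path) : Path where
  toFun t := sSup ((fun u : ℝ≥0 => w (u * t)) '' Set.Icc 0 1)
  continuous_toFun := by
    refine IsCompact.continuous_sSup (f := fun (t u : ℝ≥0) => w (u * t)) isCompact_Icc ?_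
    fun_prop

lemma exists_eq_runMax (w : Path) (t : ℝ≥0) : ∃ s ≤ t, w s = runMax w t := by
  have hc : IsCompact ((fun u : ℝ≥0 => w (u * t)) '' Set.Icc 0 1) :=
    isCompact_Icc.image (by fun_prop)
  obtain ⟨u, hu, hus⟩ := hc.sSup_mem ((Set.nonempty_Icc.2 zero_le_one).image _)
  exact ⟨u * t, mul_le_of_le_one_left zero_le hu.2, hus⟩

lemma le_runMax (w : Path) {s t : ℝ≥0} (h : s ≤ t) : w s ≤ runMax w t := by
  have hc : IsCompact ((fun u : ℝ≥0 => w (u * t)) '' Set.Icc 0 1) :=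
    isCompact_Icc.image (by fun_prop)
  refine le_csSup hc.bddAbove ⟨s / t, ⟨zero_le, div_le_one_of_le₀ h zero_le⟩, ?_⟩
  rcases eq_or_ne t 0 with rfl | ht
  · simp [le_antisymm h zero_le]
  · simp [div_mul_cancel₀ _ ht]

lemma runMax_le_iff (w : Path) (t : ℝ≥0) (a : ℝ) : runMax w t ≤ a ↔ ∀ s ≤ t, w s ≤ a := by
  constructor
  · exact fun h s hs => (le_runMax w hs).trans h
  · intro h
    obtain ⟨s, hs, hw⟩ := exists_eq_runMax w t
    exact hw ▸ h s hs

lemma lt_runMax_iff (w : Path) (t : ℝ≥0) (a : ℝ) : a < runMax w t ↔ ∃ s ≤ t, a < w s := by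
  have := (runMax_le_iff w t a).not
  push Not at this
  exact this

/-- Running maxima above a level are seen on the dyadic subdivisions of the time interval. -/
lemma lt_runMax_iff_dyadic (w : Path) (t : ℝ≥0) (a : ℝ) :
    a < runMax w t ↔ ∃ n : ℕ, ∃ j : ℕ, j ≤ 2 ^ n ∧ a < w (j * (t / 2 ^ n)) := by
  rw [lt_runMax_iff]
  constructor
  · rintro ⟨s, hs, has⟩
    rcases eq_or_ne t 0 with rfl | ht
    · exact ⟨0, 0, by simp, by simpa [le_antisymm hs zero_le] using has⟩
    have htend : Tendsto (fun n : ℕ => (⌊(s / t : ℝ) * 2 ^ n⌋₊ : ℝ≥0) * (t / 2 ^ n)) atTop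
        (𝓝 s) := by
      have h1 : Tendsto (fun n : ℕ => (2 : ℝ) ^ n) atTop atTop :=
        tendsto_pow_atTop_atTop_of_one_lt one_lt_two
      have h2 := ((tendsto_nat_floor_mul_div_atTop (R := ℝ) (a := s / t) (by positivity)).comp
        h1).mul_const (t : ℝ)
      rw [div_mul_cancel₀ _ (NNReal.coe_ne_zero.2 ht)] at h2
      refine NNReal.tendsto_coe.1 (h2.congr fun n => ?_)
      simp only [Function.comp]
      push_cast
      ring
    obtain ⟨n, hn⟩ := (((w.continuous.tendsto s).comp htend).eventually (lt_mem_nhds has)).exists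
    refine ⟨n, ⌊(s / t : ℝ) * 2 ^ n⌋₊, ?_, hn⟩
    refine Nat.floor_le_of_le ?_
    push_cast
    exact mul_le_of_le_one_left (by positivity)
      (div_le_one_of_le₀ (NNReal.coe_le_coe.2 hs) t.2)
  · rintro ⟨n, j, hj, h⟩
    refine ⟨_, ?_, h⟩
    have : (j : ℝ≥0) ≤ 2 ^ n := by exact_mod_cast hj
    calc (j : ℝ≥0) * (t / 2 ^ n) ≤ 2 ^ n * (t / 2 ^ n) := by gcongr
      _ = t := mul_div_cancel₀ _ (by positivity)

@[fun_prop]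
lemma measurable_runMax : Measurable runMax := by
  refine measurable_path_of_eval fun t => measurable_of_Ioi fun a => ?_
  have : (fun w : Path => runMax w t) ⁻¹' Set.Ioi a =
      ⋃ n : ℕ, ⋃ j : ℕ, ⋃ _ : j ≤ 2 ^ n, {w : Path | a < w (j * (t / 2 ^ n))} := by
    ext w
    simp [lt_runMax_iff_dyadic]
  rw [this]
  exact .iUnion fun n => .iUnion fun j => .iUnion fun _ =>
    measurableSet_lt measurable_const (measurable_eval_path _)

lemma zero_le_runMax {w : Path} (h0 : w 0 = 0) (t : ℝ≥0) : 0 ≤ runMax w t :=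
  h0 ▸ le_runMax w zero_le

/-- The maximum up to time `s + t` is the maximum up to time `s` or the one attained later. -/
lemma runMax_add (w : Path) (s t : ℝ≥0) :
    runMax w (s + t) = max (runMax w s) (w s + runMax (incrFrom s w) t) := by
  apply le_antisymm
  · rw [runMax_le_iff]
    intro u hu
    rcases le_total u s with h | h
    · exact (le_runMax w h).trans (le_max_left _ _)
    · obtain ⟨v, rfl⟩ := exists_add_of_le h
      have := le_runMax (incrFrom s w) (s := v) (t := t) (by simpa using hu)
      rw [incrFrom_apply] at this
      exact le_max_of_le_right (by linarith)
  · refine max_le ?_ ?_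
    · rw [runMax_le_iff]
      exact fun u hu => le_runMax w (hu.trans le_self_add)
    · obtain ⟨u, hu, h⟩ := exists_eq_runMax (incrFrom s w) t
      rw [← h, incrFrom_apply]
      have := le_runMax w (s := s + u) (t := s + t) (by gcongr)
      linarith

lemma runMax_add_const (w : Path) (c : ℝ) (t : ℝ≥0) :
    runMax (w + ContinuousMap.const _ c) t = runMax w t + c := by
  apply le_antisymm
  · rw [runMax_le_iff]
    intro s hs
    simpa using le_runMax w hs
  · obtain ⟨s, hs, h⟩ := exists_eq_runMax w t
    rw [← h]
    exact le_runMax (w + ContinuousMap.const _ c) hs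

lemma runMax_sub_const (w : Path) (c : ℝ) (t : ℝ≥0) :
    runMax (w - ContinuousMap.const _ c) t = runMax w t - c := by
  have h := runMax_add_const w (-c) t
  rw [← sub_eq_add_neg] at h
  rw [← h]
  congr 2

lemma runMax_smul {c : ℝ} (hc : 0 ≤ c) (w : Path) (t : ℝ≥0) :
    runMax (c • w) t = c * runMax w t := by
  apply le_antisymm
  · rw [runMax_le_iff]
    intro s hs
    simpa using mul_le_mul_of_nonneg_left (le_runMax w hs) hc
  · obtain ⟨s, hs, h⟩ := exists_eq_runMax w t
    rw [← h]
    exact le_runMax (c • w) hs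

lemma runMax_stopAt (w : Path) (L t : ℝ≥0) : runMax (stopAt L w) t = runMax w (min t L) := by
  apply le_antisymm
  · rw [runMax_le_iff]
    intro s hs
    exact le_runMax w (min_le_min_right _ hs)
  · obtain ⟨s, hs, h⟩ := exists_eq_runMax w (min t L)
    rw [← h, ← min_eq_left (hs.trans (min_le_right _ _)), ← stopAt_apply]
    exact le_runMax _ (hs.trans (min_le_left _ _))

/-! ### Wiener measure -/

/-- `μ` is the law on path space of a standard Brownian motion started from the origin. -/
def IsWiener (μ : Measure Path) : Prop := IsPreBrownianReal (fun t (w : Path) => w t) μ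

/-- Independence of random paths is independence of the corresponding processes. -/
lemma indepFun_path_iff {Ω : Type*} [MeasurableSpace Ω] {P : Measure Ω} {F G : Ω → Path} :
    IndepFun F G P ↔ IndepFun (fun ω t => F ω t) (fun ω t => G ω t) P := by
  rw [IndepFun_iff_Indep, IndepFun_iff_Indep, cylinderMeasurableSpace, MeasurableSpace.comap_comp,
    MeasurableSpace.comap_comp]
  rfl

namespace IsWiener

variable {μ ν : Measure Path}

lemma isProbabilityMeasure (hμ : IsWiener μ) : IsProbabilityMeasure μ :=
  IsGaussianProcess.isProbabilityMeasure (IsPreBrownianReal.isGaussianProcess hμ)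

lemma unique (hμ : IsWiener μ) (hν : IsWiener ν) : μ = ν := by
  have := hμ.isProbabilityMeasure
  refine path_measure_ext fun I => ?_
  rw [(IsPreBrownianReal.hasLaw hμ I).map_eq, (IsPreBrownianReal.hasLaw hν I).map_eq]

lemma of_process {Ω : Type*} [MeasurableSpace Ω] {P : Measure Ω} {X : Ω → Path}
    (hX : AEMeasurable X P) (h : IsPreBrownianReal (fun t ω => X ω t) P) : IsWiener (P.map X) where
  hasLaw I := by
    have hm : Measurable fun w : Path => I.restrict fun t => w t :=
      (Finset.measurable_restrict I).comp measurable_coe_path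
    refine ⟨hm.aemeasurable, ?_⟩
    rw [AEMeasurable.map_map_of_aemeasurable hm.aemeasurable hX]
    exact (h.hasLaw I).map_eq

lemma map_eq_of_process (hμ : IsWiener μ) {Ω : Type*} [MeasurableSpace Ω] {P : Measure Ω}
    {X : Ω → Path} (hX : AEMeasurable X P) (h : IsPreBrownianReal (fun t ω => X ω t) P) :
    P.map X = μ :=
  (of_process hX h).unique hμ

lemma ae_eval_zero (hμ : IsWiener μ) : ∀ᵐ w ∂μ, w 0 = 0 :=
  IsPreBrownianReal.eval_zero_ae_eq_zero hμ

lemma map_eval (hμ : IsWiener μ) (t : ℝ≥0) : μ.map (fun w => w t) = gaussianReal 0 t :=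
  (IsPreBrownianReal.hasLaw_eval hμ t).map_eq

lemma memLp_eval (hμ : IsWiener μ) (t : ℝ≥0) : MemLp (fun w : Path => w t) 2 μ :=
  ((IsPreBrownianReal.isGaussianProcess hμ).hasGaussianLaw_eval t).memLp_two

lemma map_incrFrom (hμ : IsWiener μ) (r : ℝ≥0) : μ.map (incrFrom r) = μ :=
  hμ.map_eq_of_process (measurable_incrFrom r).aemeasurable (IsPreBrownianReal.shift hμ r)

lemma map_neg (hμ : IsWiener μ) : μ.map (fun w => -w) = μ :=
  hμ.map_eq_of_process (by fun_prop) (IsPreBrownianReal.neg hμ)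

/-- The past up to time `r` is independent of the increments after time `r`. -/
lemma indepFun_stopAt_incrFrom (hμ : IsWiener μ) (r : ℝ≥0) :
    IndepFun (stopAt r) (incrFrom r) μ := by
  have h := (IsPreBrownianReal.indepFun_shift hμ r).symm
  have hψ : Measurable (fun (x : Set.Iic r → ℝ) (t : ℝ≥0) =>
      x ⟨min t r, Set.mem_Iic.2 (min_le_right t r)⟩) :=
    measurable_pi_iff.2 fun t =>
      measurable_pi_apply (⟨min t r, Set.mem_Iic.2 (min_le_right t r)⟩ : Set.Iic r)
  have h2 := h.comp hψ measurable_id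
  exact indepFun_path_iff.2 h2

/-- **Markov property**, in terms of laws. -/
lemma map_stopAt_incrFrom (hμ : IsWiener μ) (r : ℝ≥0) :
    μ.map (fun w => (stopAt r w, incrFrom r w)) = (μ.map (stopAt r)).prod μ := by
  have := hμ.isProbabilityMeasure
  rw [(indepFun_iff_map_prod_eq_prod_map_map (by fun_prop) (by fun_prop)).1
    (hμ.indepFun_stopAt_incrFrom r), hμ.map_incrFrom]

/-- **Markov property**, for functions of the past and of the increments after time `r`. -/
lemma lintegral_stopAt_incrFrom (hμ : IsWiener μ) (r : ℝ≥0) {F : Path → Path → ENNReal}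
    (hF : Measurable (Function.uncurry F)) :
    ∫⁻ w, F (stopAt r w) (incrFrom r w) ∂μ = ∫⁻ w, ∫⁻ b, F (stopAt r w) b ∂μ ∂μ := by
  have := hμ.isProbabilityMeasure
  have h1 : ∫⁻ w, F (stopAt r w) (incrFrom r w) ∂μ =
      ∫⁻ p, Function.uncurry F p ∂(μ.map (fun w => (stopAt r w, incrFrom r w))) := by
    rw [lintegral_map hF (by fun_prop)]
    rfl
  rw [h1, hμ.map_stopAt_incrFrom, lintegral_prod _ hF.aemeasurable,
    lintegral_map (by exact hF.lintegral_prod_right) (by fun_prop)]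
  rfl

/-- The increments after time `r` may be reflected without changing the law. -/
lemma lintegral_stopAt_neg_incrFrom (hμ : IsWiener μ) (r : ℝ≥0) {F : Path → Path → ENNReal}
    (hF : Measurable (Function.uncurry F)) :
    ∫⁻ w, F (stopAt r w) (-incrFrom r w) ∂μ = ∫⁻ w, F (stopAt r w) (incrFrom r w) ∂μ := by
  rw [hμ.lintegral_stopAt_incrFrom r hF, hμ.lintegral_stopAt_incrFrom r
    (F := fun v b => F v (-b)) (by fun_prop)]
  refine lintegral_congr fun w => ?_
  conv_rhs => rw [← hμ.map_neg]
  rw [lintegral_map (by fun_prop) (by fun_prop)]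

/-- Two independent Brownian motions are jointly Gaussian. -/
lemma isGaussianProcess_prod (hμ : IsWiener μ) :
    IsGaussianProcess (Sum.elim (fun t (p : Path × Path) => p.1 t) (fun t p => p.2 t))
      (μ.prod μ) where
  hasGaussianLaw I := by
    classical
    have := hμ.isProbabilityMeasure
    -- All times involved, for either of the two motions.
    let J : Finset ℝ≥0 := I.image (Sum.elim id id)
    have hm : Measurable fun w : Path => J.restrict fun t => w t :=
      (Finset.measurable_restrict J).comp measurable_coe_path
    have hJ : HasGaussianLaw (fun w : Path => J.restrict fun t => w t) μ :=
      (IsPreBrownianReal.isGaussianProcess hμ).hasGaussianLaw J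
    have h1 : HasGaussianLaw (fun p : Path × Path => J.restrict fun t => p.1 t) (μ.prod μ) := by
      constructor
      have : μ.map (fun w : Path => J.restrict fun t => w t) =
          (μ.prod μ).map (fun p : Path × Path => J.restrict fun t => p.1 t) := by
        conv_lhs => rw [← (measurePreserving_fst (μ := μ) (ν := μ)).map_eq]
        rw [Measure.map_map hm measurable_fst]
        rfl
      rw [← this]
      exact hJ.isGaussian_map
    have h2 : HasGaussianLaw (fun p : Path × Path => J.restrict fun t => p.2 t) (μ.prod μ) := by
      constructor
      have : μ.map (fun w : Path => J.restrict fun t => w t) =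
          (μ.prod μ).map (fun p : Path × Path => J.restrict fun t => p.2 t) := by
        conv_lhs => rw [← (measurePreserving_snd (μ := μ) (ν := μ)).map_eq]
        rw [Measure.map_map hm measurable_snd]
        rfl
      rw [← this]
      exact hJ.isGaussian_map
    have h3 := IndepFun.hasGaussianLaw h1 h2 (indepFun_prod hm hm)
    have hJmem : ∀ i : I, Sum.elim id id i.1 ∈ J := fun i => Finset.mem_image_of_mem _ i.2
    let T : ((J → ℝ) × (J → ℝ)) →L[ℝ] (I → ℝ) :=
      ContinuousLinearMap.pi fun i =>
        match hi : i.1 with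
        | Sum.inl t => (ContinuousLinearMap.proj
            (⟨t, by simpa [hi] using hJmem i⟩ : J)).comp (ContinuousLinearMap.fst ℝ _ _)
        | Sum.inr t => (ContinuousLinearMap.proj
            (⟨t, by simpa [hi] using hJmem i⟩ : J)).comp (ContinuousLinearMap.snd ℝ _ _)
    convert! h3.map T using 1
    ext p i
    obtain ⟨i, hi⟩ := i
    rcases i with t | t <;> rfl

/-- The orthogonal map `(x, y) ↦ ((x + y) / √2, (x - y) / √2)` preserves the law of a pair of
independent Brownian motions. -/
lemma map_rotation (hμ : IsWiener μ) :
    (μ.prod μ).map (fun p : Path × Path => ((√2)⁻¹ • (p.1 + p.2), (√2)⁻¹ • (p.1 - p.2))) =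
      μ.prod μ := by
  have := hμ.isProbabilityMeasure
  set U : ℝ≥0 → Path × Path → ℝ := fun t p => (√2)⁻¹ * (p.1 t + p.2 t) with hU
  set Z : ℝ≥0 → Path × Path → ℝ := fun t p => (√2)⁻¹ * (p.1 t - p.2 t) with hZ
  have hG : IsGaussianProcess (Sum.elim U Z) (μ.prod μ) := by
    refine hμ.isGaussianProcess_prod.of_isGaussianProcess ?_
    rintro (t | t)
    · refine ⟨{Sum.inl t, Sum.inr t}, (√2)⁻¹ • (ContinuousLinearMap.proj ⟨Sum.inl t, by simp⟩ +
        ContinuousLinearMap.proj ⟨Sum.inr t, by simp⟩), fun p => ?_⟩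
      simp [hU, mul_add]
    · refine ⟨{Sum.inl t, Sum.inr t}, (√2)⁻¹ • (ContinuousLinearMap.proj ⟨Sum.inl t, by simp⟩ -
        ContinuousLinearMap.proj ⟨Sum.inr t, by simp⟩), fun p => ?_⟩
      simp [hZ, mul_sub]
  have hUG : IsGaussianProcess U (μ.prod μ) := hG.comp_right Sum.inl
  have hZG : IsGaussianProcess Z (μ.prod μ) := hG.comp_right Sum.inr
  have m1 : ∀ t, MemLp (fun p : Path × Path => p.1 t) 2 (μ.prod μ) := fun t =>
    (hμ.memLp_eval t).comp_measurePreserving measurePreserving_fst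
  have m2 : ∀ t, MemLp (fun p : Path × Path => p.2 t) 2 (μ.prod μ) := fun t =>
    (hμ.memLp_eval t).comp_measurePreserving measurePreserving_snd
  have c11 : ∀ s t, cov[fun p : Path × Path => p.1 s, fun p : Path × Path => p.1 t; μ.prod μ] =
      min s t := by
    intro s t
    rw [← IsPreBrownianReal.covariance_fun_eval hμ s t]
    conv_rhs => rw [← (measurePreserving_fst (μ := μ) (ν := μ)).map_eq]
    rw [covariance_map_fun]
    all_goals first | fun_prop | exact (measurable_eval_path _).aestronglyMeasurable
  have c22 : ∀ s t, cov[fun p : Path × Path => p.2 s, fun p : Path × Path => p.2 t; μ.prod μ] =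
      min s t := by
    intro s t
    rw [← IsPreBrownianReal.covariance_fun_eval hμ s t]
    conv_rhs => rw [← (measurePreserving_snd (μ := μ) (ν := μ)).map_eq]
    rw [covariance_map_fun]
    all_goals first | fun_prop | exact (measurable_eval_path _).aestronglyMeasurable
  have c12 : ∀ s t, cov[fun p : Path × Path => p.1 s, fun p : Path × Path => p.2 t; μ.prod μ] =
      0 := fun s t =>
    (indepFun_prod (measurable_eval_path s) (measurable_eval_path t)).covariance_eq_zero
      (m1 s) (m2 t)
  have c21 : ∀ s t, cov[fun p : Path × Path => p.2 s, fun p : Path × Path => p.1 t; μ.prod μ] =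
      0 := fun s t => by rw [covariance_comm]; exact c12 t s
  have cadd : ∀ {X Y V : Path × Path → ℝ}, MemLp X 2 (μ.prod μ) → MemLp Y 2 (μ.prod μ) →
      MemLp V 2 (μ.prod μ) → cov[fun p => X p + Y p, V; μ.prod μ] =
        cov[X, V; μ.prod μ] + cov[Y, V; μ.prod μ] := fun hX hY hV => covariance_add_left hX hY hV
  have cadd' : ∀ {X Y V : Path × Path → ℝ}, MemLp X 2 (μ.prod μ) → MemLp Y 2 (μ.prod μ) →
      MemLp V 2 (μ.prod μ) → cov[V, fun p => X p + Y p; μ.prod μ] =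
        cov[V, X; μ.prod μ] + cov[V, Y; μ.prod μ] := fun hX hY hV => covariance_add_right hV hX hY
  have p1 : ∀ t, MemLp (fun p : Path × Path => p.1 t + p.2 t) 2 (μ.prod μ) :=
    fun t => (m1 t).add (m2 t)
  have p2 : ∀ t, MemLp (fun p : Path × Path => p.1 t - p.2 t) 2 (μ.prod μ) :=
    fun t => (m1 t).sub (m2 t)
  have h2 : (√2)⁻¹ * (√2)⁻¹ * 2 = (1 : ℝ) := by
    rw [← mul_inv, Real.mul_self_sqrt (by norm_num)]
    norm_num
  have hE1 : ∀ t, ∫ p : Path × Path, p.1 t ∂μ.prod μ = 0 := fun t => by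
    have := IsPreBrownianReal.integral_eval hμ t
    rw [← this]
    conv_rhs => rw [← (measurePreserving_fst (μ := μ) (ν := μ)).map_eq]
    rw [integral_map]
    all_goals first | fun_prop | exact (measurable_eval_path _).aestronglyMeasurable
  have hE2 : ∀ t, ∫ p : Path × Path, p.2 t ∂μ.prod μ = 0 := fun t => by
    have := IsPreBrownianReal.integral_eval hμ t
    rw [← this]
    conv_rhs => rw [← (measurePreserving_snd (μ := μ) (ν := μ)).map_eq]
    rw [integral_map]
    all_goals first | fun_prop | exact (measurable_eval_path _).aestronglyMeasurable
  have i1 : ∀ t, Integrable (fun p : Path × Path => p.1 t) (μ.prod μ) :=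
    fun t => (m1 t).integrable (by norm_num)
  have i2 : ∀ t, Integrable (fun p : Path × Path => p.2 t) (μ.prod μ) :=
    fun t => (m2 t).integrable (by norm_num)
  have hUB : IsPreBrownianReal U (μ.prod μ) := by
    refine hUG.isPreBrownianReal_of_covariance (fun t => ?_) (fun s t hst => ?_)
    · simp only [hU]
      rw [integral_const_mul, integral_add (i1 t) (i2 t), hE1, hE2]
      simp
    · simp only [hU]
      rw [covariance_const_mul_left, covariance_const_mul_right,
        cadd (m1 s) (m2 s) (p1 t), cadd' (m1 t) (m2 t) (m1 s),
        cadd' (m1 t) (m2 t) (m2 s), c11, c12, c21, c22, min_eq_left hst]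
      linear_combination (s : ℝ) * h2
  have hZB : IsPreBrownianReal Z (μ.prod μ) := by
    refine hZG.isPreBrownianReal_of_covariance (fun t => ?_) (fun s t hst => ?_)
    · simp only [hZ]
      rw [integral_const_mul, integral_sub (i1 t) (i2 t), hE1, hE2]
      simp
    · simp only [hZ]
      rw [covariance_const_mul_left, covariance_const_mul_right,
        covariance_fun_sub_fun_sub (m1 s) (m2 s) (m1 t) (m2 t), c11, c12, c21, c22,
        min_eq_left hst]
      linear_combination (s : ℝ) * h2
  have hind : IndepFun (fun p t => U t p) (fun p t => Z t p) (μ.prod μ) := by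
    refine hG.indepFun_of_covariance_eq_zero hUG.aemeasurable hZG.aemeasurable fun s t => ?_
    simp only [hU, hZ]
    rw [covariance_const_mul_left, covariance_const_mul_right,
      cadd (m1 s) (m2 s) (p2 t),
      covariance_fun_sub_right (m1 s) (m1 t) (m2 t),
      covariance_fun_sub_right (m2 s) (m1 t) (m2 t), c11, c12, c21, c22]
    ring
  have hind' : IndepFun (fun p : Path × Path => (√2)⁻¹ • (p.1 + p.2))
      (fun p : Path × Path => (√2)⁻¹ • (p.1 - p.2)) (μ.prod μ) := by
    exact indepFun_path_iff.2 hind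
  rw [(indepFun_iff_map_prod_eq_prod_map_map (by fun_prop) (by fun_prop)).1 hind',
    hμ.map_eq_of_process (by fun_prop) hUB, hμ.map_eq_of_process (by fun_prop) hZB]

/-- The value at time `r` is independent of the bridge on `[0, r]`. -/
lemma indepFun_eval_bridge (hμ : IsWiener μ) {r : ℝ≥0} (hr : r ≠ 0) :
    IndepFun (fun w : Path => w r)
      (fun w (t : ℝ≥0) => w (min t r) - (min t r / r : ℝ) * w r) μ := by
  have := hμ.isProbabilityMeasure
  have hW := IsPreBrownianReal.isGaussianProcess hμ
  set X : Unit → Path → ℝ := fun _ w => w r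
  set Y : ℝ≥0 → Path → ℝ := fun t w => w (min t r) - (min t r / r : ℝ) * w r with hY
  have hG : IsGaussianProcess (Sum.elim X Y) μ := by
    refine hW.of_isGaussianProcess ?_
    rintro (u | t)
    · exact ⟨{r}, ContinuousLinearMap.proj ⟨r, by simp⟩, fun w => rfl⟩
    · refine ⟨{min t r, r}, ContinuousLinearMap.proj ⟨min t r, by simp⟩ -
        (min t r / r : ℝ) • ContinuousLinearMap.proj ⟨r, by simp⟩, fun w => ?_⟩
      simp [hY]
  have h := hG.indepFun_of_covariance_eq_zero (X := X) (Y := Y) (fun _ => by fun_prop)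
    (fun t => by fun_prop) fun _ t => by
      simp only [X, hY]
      rw [covariance_fun_sub_right (hμ.memLp_eval r) (hμ.memLp_eval _)
        ((hμ.memLp_eval r).const_mul _), covariance_const_mul_right,
        IsPreBrownianReal.covariance_fun_eval hμ, IsPreBrownianReal.covariance_fun_eval hμ,
        min_self, min_eq_right (min_le_right t r), div_mul_cancel₀ _ (NNReal.coe_ne_zero.2 hr)]
      simp
  exact h.comp (φ := fun x : Unit → ℝ => x ()) (ψ := id) (by fun_prop) measurable_id

end IsWiener

/-! ### The reflection principle -/

/-- The event that `j` is the first index at which the path exceeds the level `a` on the grid of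
mesh `δ`. -/
def firstPassage (a : ℝ) (δ : ℝ≥0) (j : ℕ) : Set Path :=
  {w | (∀ i < j, w (i * δ) ≤ a) ∧ a < w (j * δ)}

lemma measurableSet_firstPassage (a : ℝ) (δ : ℝ≥0) (j : ℕ) :
    MeasurableSet (firstPassage a δ j) := by
  have : firstPassage a δ j = (⋂ i : ℕ, ⋂ _ : i < j, {w : Path | w (i * δ) ≤ a}) ∩
      {w : Path | a < w (j * δ)} := by
    ext w
    simp [firstPassage]
  rw [this]
  exact (MeasurableSet.iInter fun i => MeasurableSet.iInter fun _ =>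
    measurableSet_le (measurable_eval_path _) measurable_const).inter
    (measurableSet_lt measurable_const (measurable_eval_path _))

lemma stopAt_mem_firstPassage {a : ℝ} {δ : ℝ≥0} {j : ℕ} {w : Path} :
    stopAt (j * δ) w ∈ firstPassage a δ j ↔ w ∈ firstPassage a δ j := by
  have h : ∀ i ≤ j, min ((i : ℝ≥0) * δ) (j * δ) = i * δ := fun i hi =>
    min_eq_left (by gcongr)
  simp only [firstPassage, Set.mem_ofPred_eq, stopAt_apply, h j le_rfl]
  refine and_congr_left fun _ => forall₂_congr fun i hi => ?_
  rw [h i hi.le]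

lemma firstPassage_unique {a : ℝ} {δ : ℝ≥0} {i j : ℕ} {w : Path}
    (hi : w ∈ firstPassage a δ i) (hj : w ∈ firstPassage a δ j) : i = j := by
  rcases lt_trichotomy i j with h | h | h
  · exact absurd hi.2 (not_lt.2 (hj.1 i h))
  · exact h
  · exact absurd hj.2 (not_lt.2 (hi.1 j h))

lemma exists_firstPassage {a : ℝ} {δ : ℝ≥0} {w : Path} {K : ℕ}
    (h : ∃ j ≤ K, a < w (j * δ)) : ∃ j ≤ K, w ∈ firstPassage a δ j := by
  classical
  obtain ⟨j, hj, haj⟩ := h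
  have hex : ∃ j : ℕ, a < w (j * δ) := ⟨j, haj⟩
  exact ⟨Nat.find hex, (Nat.find_min' hex haj).trans hj,
    fun i hi => not_lt.1 (Nat.find_min hex hi), Nat.find_spec hex⟩

/-- The position at the first passage on the grid exceeds the level by at most one oscillation of
the path over a mesh, so it converges to the level. -/
lemma eventually_firstPassage_near {w : Path} {a : ℝ} (h0 : w 0 ≤ a) (t : ℝ≥0) {ε : ℝ}
    (hε : 0 < ε) : ∀ᶠ n : ℕ in atTop, ∀ j ≤ 2 ^ n, w ∈ firstPassage a (t / 2 ^ n) j →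
      |w (j * (t / 2 ^ n)) - a| < ε := by
  have huc := (isCompact_Icc (a := (0 : ℝ≥0)) (b := t)).uniformContinuousOn_of_continuous
    w.continuous.continuousOn
  obtain ⟨δ, hδ, H⟩ := Metric.uniformContinuousOn_iff.1 huc ε hε
  have hmesh : Tendsto (fun n : ℕ => (t : ℝ) / 2 ^ n) atTop (𝓝 0) :=
    tendsto_const_nhds.div_atTop (tendsto_pow_atTop_atTop_of_one_lt one_lt_two)
  filter_upwards [hmesh.eventually_lt_const hδ] with n hn j hj hw
  obtain ⟨i, rfl⟩ : ∃ i, j = i + 1 := by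
    refine Nat.exists_eq_succ_of_ne_zero ?_
    rintro rfl
    have := hw.2
    simp only [Nat.cast_zero, zero_mul] at this
    linarith
  have h1 := hw.1 i (Nat.lt_succ_self i)
  have h2 := hw.2
  have hle : ∀ k : ℕ, k ≤ i + 1 → (k : ℝ≥0) * (t / 2 ^ n) ∈ Set.Icc 0 t := by
    intro k hk
    refine ⟨zero_le, ?_⟩
    have : (k : ℝ≥0) ≤ 2 ^ n := by exact_mod_cast hk.trans hj
    calc (k : ℝ≥0) * (t / 2 ^ n) ≤ 2 ^ n * (t / 2 ^ n) := by gcongr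
      _ = t := mul_div_cancel₀ _ (by positivity)
  have h3 := H _ (hle (i + 1) le_rfl) _ (hle i (Nat.le_succ i)) (by
    rw [NNReal.dist_eq]
    push_cast
    rw [show ((i : ℝ) + 1) * (t / 2 ^ n) - i * (t / 2 ^ n) = t / 2 ^ n by ring,
      abs_of_nonneg (by positivity)]
    exact hn)
  rw [Real.dist_eq, abs_lt] at h3
  rw [abs_lt]
  constructor <;> linarith [h3.2]

/-- A level below the maximum is eventually exceeded on dyadic grids. -/
lemma exists_grid_of_lt_runMax {w : Path} {a : ℝ} {t : ℝ≥0} (h : a < runMax w t) :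
    ∀ᶠ n : ℕ in atTop, ∃ j ≤ 2 ^ n, w ∈ firstPassage a (t / 2 ^ n) j := by
  obtain ⟨n₀, j₀, hj₀, hw⟩ := (lt_runMax_iff_dyadic w t a).1 h
  filter_upwards [eventually_ge_atTop n₀] with n hn
  obtain ⟨d, rfl⟩ := Nat.exists_eq_add_of_le hn
  refine exists_firstPassage ⟨j₀ * 2 ^ d, ?_, ?_⟩
  · rw [pow_add]
    gcongr
  · convert hw using 2
    push_cast
    rw [pow_add]
    field_simp

namespace IsWiener

variable {μ : Measure Path}

/-- Reflecting the increments after the first passage on a grid preserves the law. -/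
lemma lintegral_firstPassage (hμ : IsWiener μ) {a : ℝ} {δ t : ℝ≥0} {j : ℕ} (hj : j * δ ≤ t)
    {f : ℝ → ENNReal} (hf : Measurable f) :
    ∫⁻ w, (firstPassage a δ j).indicator (fun w => f (2 * w (j * δ) - w t)) w ∂μ =
      ∫⁻ w, (firstPassage a δ j).indicator (fun w => f (w t)) w ∂μ := by
  have hT := measurableSet_firstPassage a δ j
  let F : Path → Path → ENNReal := fun v b =>
    (firstPassage a δ j).indicator (fun v => f (v (j * δ) + b (t - j * δ))) v
  have hF : Measurable (Function.uncurry F) := by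
    have : Function.uncurry F = (Prod.fst ⁻¹' (firstPassage a δ j)).indicator
        (fun p : Path × Path => f (p.1 (j * δ) + p.2 (t - j * δ))) := by
      ext ⟨v, b⟩
      simp only [Function.uncurry, F, Set.indicator]
      rfl
    rw [this]
    refine Measurable.indicator (hf.comp ?_) (measurable_fst hT)
    exact ((measurable_eval_path _).comp measurable_fst).add
      ((measurable_eval_path _).comp measurable_snd)
  have h := hμ.lintegral_stopAt_neg_incrFrom (j * δ) hF
  have e : (j * δ : ℝ≥0) + (t - j * δ) = t := add_tsub_cancel_of_le hj
  have e1 : ∀ w : Path, F (stopAt (j * δ) w) (-incrFrom (j * δ) w) =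
      (firstPassage a δ j).indicator (fun w => f (2 * w (j * δ) - w t)) w := by
    intro w
    by_cases hw : w ∈ firstPassage a δ j
    · simp only [F]
      rw [Set.indicator_of_mem (stopAt_mem_firstPassage.2 hw), Set.indicator_of_mem hw,
        stopAt_apply, min_self, ContinuousMap.neg_apply, incrFrom_apply, e]
      congr 1
      ring
    · simp only [F]
      rw [Set.indicator_of_notMem (stopAt_mem_firstPassage.not.2 hw),
        Set.indicator_of_notMem hw]
  have e2 : ∀ w : Path, F (stopAt (j * δ) w) (incrFrom (j * δ) w) =
      (firstPassage a δ j).indicator (fun w => f (w t)) w := by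
    intro w
    by_cases hw : w ∈ firstPassage a δ j
    · simp only [F]
      rw [Set.indicator_of_mem (stopAt_mem_firstPassage.2 hw), Set.indicator_of_mem hw,
        stopAt_apply, min_self, incrFrom_apply, e]
      congr 1
      ring
    · simp only [F]
      rw [Set.indicator_of_notMem (stopAt_mem_firstPassage.not.2 hw),
        Set.indicator_of_notMem hw]
  simpa only [e1, e2] using h

/-- **Reflection principle**: on the event that the maximum up to time `t` exceeds a level
`a ≥ 0`, the law of the value at time `t` is symmetric about `a`. -/
lemma map_reflection (hμ : IsWiener μ) {a : ℝ} (ha : 0 ≤ a) (t : ℝ≥0) :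
    (μ.restrict {w | a < runMax w t}).map (fun w => 2 * a - w t) =
      (μ.restrict {w | a < runMax w t}).map (fun w => w t) := by
  classical
  have := hμ.isProbabilityMeasure
  have hS : MeasurableSet {w : Path | a < runMax w t} :=
    measurableSet_lt measurable_const ((measurable_eval_path t).comp measurable_runMax)
  have hm : Measurable fun w : Path => 2 * a - w t := by fun_prop
  refine ext_of_forall_lintegral_eq_of_IsFiniteMeasure fun f => ?_
  have hf : Measurable fun x => (f x : ENNReal) := by fun_prop
  rw [lintegral_map hf hm, lintegral_map hf (measurable_eval_path t),
    ← lintegral_indicator hS, ← lintegral_indicator hS]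
  obtain ⟨C, hC⟩ : ∃ C : ℝ≥0, ∀ x, f x ≤ C :=
    ⟨_, BoundedContinuousFunction.NNReal.upper_bound f⟩
  let δ : ℕ → ℝ≥0 := fun n => t / 2 ^ n
  have hδ : ∀ n, ∀ j : ℕ, j ≤ 2 ^ n → (j : ℝ≥0) * δ n ≤ t := by
    intro n j hj
    have : (j : ℝ≥0) ≤ 2 ^ n := by exact_mod_cast hj
    calc (j : ℝ≥0) * (t / 2 ^ n) ≤ 2 ^ n * (t / 2 ^ n) := by gcongr
      _ = t := mul_div_cancel₀ _ (by positivity)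
  -- `R G n w` is `f (G w x)` at the position `x` of the first passage on the grid of mesh
  -- `t / 2 ^ n`, and `0` if the level is not passed on this grid. The reflected endpoint is `G = G₁`, the
  -- endpoint itself is `G = G₂`; as the mesh tends to `0`, the position of first passage tends to
  -- `a`.
  let R : (Path → ℝ → ℝ) → ℕ → Path → ENNReal := fun G n w =>
    ∑ j ∈ Finset.range (2 ^ n + 1),
      (firstPassage a (δ n) j).indicator (fun w => (f (G w (w (j * δ n))) : ENNReal)) w
  let G₁ : Path → ℝ → ℝ := fun w x => 2 * x - w t
  let G₂ : Path → ℝ → ℝ := fun w _ => w t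
  have hR0 : ∀ G n w, w ∉ {w : Path | a < runMax w t} → R G n w = 0 := by
    intro G n w hw
    refine Finset.sum_eq_zero fun j hj => Set.indicator_of_notMem (fun hwj => hw ?_) _
    exact hwj.2.trans_le (le_runMax w (hδ n j (Nat.lt_succ_iff.1 (Finset.mem_range.1 hj))))
  have hR1 : ∀ G n w j, j ≤ 2 ^ n → w ∈ firstPassage a (δ n) j →
      R G n w = f (G w (w (j * δ n))) := by
    intro G n w j hj hwj
    simp only [R]
    rw [Finset.sum_eq_single_of_mem j (Finset.mem_range.2 (Nat.lt_succ_iff.2 hj)),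
      Set.indicator_of_mem hwj]
    intro i _ hij
    exact Set.indicator_of_notMem (fun hwi => hij (firstPassage_unique hwi hwj)) _
  have hRle : ∀ G n w, R G n w ≤ C := by
    intro G n w
    by_cases h : ∃ j ≤ 2 ^ n, w ∈ firstPassage a (δ n) j
    · obtain ⟨j, hj, hwj⟩ := h
      rw [hR1 G n w j hj hwj]
      exact_mod_cast hC _
    · push Not at h
      have : R G n w = 0 := Finset.sum_eq_zero fun j hj =>
        Set.indicator_of_notMem (h j (Nat.lt_succ_iff.1 (Finset.mem_range.1 hj))) _
      rw [this]
      exact zero_le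
  have hRm : ∀ G : Path → ℝ → ℝ, (∀ s, Measurable fun w : Path => G w (w s)) → ∀ n,
      Measurable (R G n) := by
    intro G hG n
    refine Finset.measurable_sum _ fun j _ => Measurable.indicator ?_
      (measurableSet_firstPassage _ _ _)
    exact hf.comp (hG _)
  have hG₁ : ∀ s, Measurable fun w : Path => G₁ w (w s) := fun s => by
    simp only [G₁]
    fun_prop
  have hG₂ : ∀ s, Measurable fun w : Path => G₂ w (w s) := fun s => by
    simp only [G₂]
    fun_prop
  have hRlim : ∀ G : Path → ℝ → ℝ, (∀ w, Continuous (G w)) → ∀ᵐ w ∂μ,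
      Tendsto (fun n => R G n w) atTop
        (𝓝 ({w : Path | a < runMax w t}.indicator (fun w => (f (G w a) : ENNReal)) w)) := by
    intro G hG
    filter_upwards [hμ.ae_eval_zero] with w hw0
    by_cases hw : w ∈ {w : Path | a < runMax w t}
    · rw [Set.indicator_of_mem hw]
      have hex := exists_grid_of_lt_runMax hw
      let J : ℕ → ℕ := fun n =>
        if h : ∃ j ≤ 2 ^ n, w ∈ firstPassage a (t / 2 ^ n) j then h.choose else 0
      have hJ : ∀ᶠ n in atTop, J n ≤ 2 ^ n ∧ w ∈ firstPassage a (t / 2 ^ n) (J n) := by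
        filter_upwards [hex] with n hn
        simp only [J, dif_pos hn]
        exact hn.choose_spec
      have hlim : Tendsto (fun n => w (J n * δ n)) atTop (𝓝 a) := by
        rw [Metric.tendsto_atTop']
        intro ε hε
        obtain ⟨N, hN⟩ := eventually_atTop.1
          (hJ.and (eventually_firstPassage_near (a := a) (by rw [hw0]; exact ha) t hε))
        refine ⟨N, fun n hn => ?_⟩
        rw [Real.dist_eq]
        exact (hN n hn.le).2 _ (hN n hn.le).1.1 (hN n hn.le).1.2
      have hc : Continuous fun x => (f (G w x) : ENNReal) := by
        have := hG w
        fun_prop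
      refine ((hc.tendsto a).comp hlim).congr' ?_
      filter_upwards [hJ] with n hn
      exact (hR1 G n w _ hn.1 hn.2).symm
    · rw [Set.indicator_of_notMem hw]
      simp only [hR0 G _ w hw, tendsto_const_nhds]
  have hRint : ∀ n, ∫⁻ w, R G₁ n w ∂μ = ∫⁻ w, R G₂ n w ∂μ := by
    intro n
    have hm1 : ∀ G : Path → ℝ → ℝ, (∀ s, Measurable fun w : Path => G w (w s)) → ∀ j,
        Measurable ((firstPassage a (δ n) j).indicator
          (fun w => (f (G w (w (j * δ n))) : ENNReal))) := fun G hG j =>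
      (hf.comp (hG _)).indicator (measurableSet_firstPassage _ _ _)
    simp only [R]
    rw [lintegral_finsetSum _ fun j _ => hm1 G₁ hG₁ j,
      lintegral_finsetSum _ fun j _ => hm1 G₂ hG₂ j]
    refine Finset.sum_congr rfl fun j hj => ?_
    exact hμ.lintegral_firstPassage (hδ n j (Nat.lt_succ_iff.1 (Finset.mem_range.1 hj))) hf
  have hL : ∀ G : Path → ℝ → ℝ, (∀ s, Measurable fun w : Path => G w (w s)) →
      (∀ w, Continuous (G w)) → Tendsto (fun n => ∫⁻ w, R G n w ∂μ) atTop
        (𝓝 (∫⁻ w, {w : Path | a < runMax w t}.indicator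
          (fun w => (f (G w a) : ENNReal)) w ∂μ)) := by
    intro G hGm hGc
    refine tendsto_lintegral_of_dominated_convergence (fun _ => (C : ENNReal)) (hRm G hGm)
      (fun n => ae_of_all _ fun w => hRle G n w) ?_ (hRlim G hGc)
    simp
  have l1 := hL G₁ hG₁ (fun w => by simp only [G₁]; fun_prop)
  have l2 := hL G₂ hG₂ (fun w => by simp only [G₂]; fun_prop)
  simp_rw [hRint] at l1
  exact tendsto_nhds_unique l1 l2

lemma measurableSet_lt_runMax (a : ℝ) (t : ℝ≥0) : MeasurableSet {w : Path | a < runMax w t} :=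
  measurableSet_lt measurable_const ((measurable_eval_path t).comp measurable_runMax)

/-- The reflection principle for nonnegative functions of the value at time `t`. -/
lemma lintegral_reflection (hμ : IsWiener μ) {a : ℝ} (ha : 0 ≤ a) (t : ℝ≥0) {f : ℝ → ENNReal}
    (hf : Measurable f) :
    ∫⁻ w in {w | a < runMax w t}, f (2 * a - w t) ∂μ =
      ∫⁻ w in {w | a < runMax w t}, f (w t) ∂μ := by
  have h := congrArg (fun ρ => ∫⁻ x, f x ∂ρ) (hμ.map_reflection ha t)
  rwa [lintegral_map hf (by fun_prop), lintegral_map hf (by fun_prop)] at h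

/-- The joint law of the maximum and the endpoint. -/
lemma measure_lt_runMax_inter (hμ : IsWiener μ) {a x : ℝ} (ha : 0 ≤ a) (hx : x ≤ a) (t : ℝ≥0) :
    μ {w | a < runMax w t ∧ w t < x} = μ {w | 2 * a - x < w t} := by
  have h := congrArg (fun ρ => ρ (Set.Ioi (2 * a - x))) (hμ.map_reflection ha t)
  have e1 : MeasurableSet ((fun w : Path => 2 * a - w t) ⁻¹' Set.Ioi (2 * a - x)) :=
    measurableSet_preimage (by fun_prop) measurableSet_Ioi
  have e2 : MeasurableSet ((fun w : Path => w t) ⁻¹' Set.Ioi (2 * a - x)) :=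
    measurableSet_preimage (by fun_prop) measurableSet_Ioi
  rw [Measure.map_apply (by fun_prop) measurableSet_Ioi,
    Measure.map_apply (by fun_prop) measurableSet_Ioi, Measure.restrict_apply e1,
    Measure.restrict_apply e2] at h
  convert h using 2
  · ext w
    simp [and_comm]
  · ext w
    simp only [Set.mem_ofPred_eq, Set.mem_inter_iff, Set.mem_preimage, Set.mem_Ioi]
    refine ⟨fun hw => ⟨hw, ?_⟩, fun hw => hw.1⟩
    exact lt_of_lt_of_le (by linarith) (le_runMax w le_rfl)

end IsWiener

/-! ### The maximum and its distance to the endpoint -/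

namespace IsWiener

variable {μ : Measure Path}

lemma measure_eval_eq_zero (hμ : IsWiener μ) {t : ℝ≥0} (ht : t ≠ 0) (x : ℝ) :
    μ {w | w t = x} = 0 := by
  have h := congrArg (fun ρ => ρ {x}) (hμ.map_eval t)
  rw [Measure.map_apply (by fun_prop) (measurableSet_singleton x)] at h
  have := nullSingletonClass_gaussianReal (μ := 0) ht
  rw [measure_singleton] at h
  exact h

lemma real_lt_eval (hμ : IsWiener μ) (t : ℝ≥0) (x : ℝ) :
    μ.real {w | x < w t} = 1 - cdf (μ.map fun w => w t) x := by
  have := hμ.isProbabilityMeasure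
  have := Measure.isProbabilityMeasure_map (μ := μ) (measurable_eval_path t).aemeasurable
  rw [cdf_eq_real, map_measureReal_apply (by fun_prop) measurableSet_Iic,
    ← probReal_compl_eq_one_sub (measurableSet_preimage (by fun_prop) measurableSet_Iic)]
  congr 1
  ext w
  simp

/-- The grid version of `real_runMax_sub_eval`: the maximum is rounded down to the grid
`a + j ε`, and the contributions of the grid levels telescope. -/
lemma real_runMax_grid (hμ : IsWiener μ) {a b ε : ℝ} (ha : 0 ≤ a) (hb : 0 ≤ b) (hε : 0 ≤ ε)
    (t : ℝ≥0) (m : ℕ) :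
    μ.real {w | ∃ j : ℕ, j < m ∧ a + j * ε < runMax w t ∧ runMax w t ≤ a + (j + 1) * ε ∧
        w t < a + j * ε - b} =
      μ.real {w | a + b < w t} + μ.real {w | a + ε + b < w t} -
        μ.real {w | a + m * ε + b < w t} - μ.real {w | a + (m + 1) * ε + b < w t} := by
  have := hμ.isProbabilityMeasure
  have hrm := fun x : ℝ => measurableSet_lt_runMax x t
  have hev : ∀ x : ℝ, MeasurableSet {w : Path | w t < x} := fun x =>
    measurableSet_lt (measurable_eval_path t) measurable_const
  have hle : ∀ x : ℝ, MeasurableSet {w : Path | runMax w t ≤ x} := fun x =>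
    measurableSet_le ((measurable_eval_path t).comp measurable_runMax) measurable_const
  induction m with
  | zero => simp
  | succ m ih =>
    set D : Set Path := {w | a + m * ε < runMax w t ∧ runMax w t ≤ a + (m + 1) * ε ∧
        w t < a + m * ε - b} with hD
    set A : Set Path := {w | a + m * ε < runMax w t ∧ w t < a + m * ε - b} with hA
    set A' : Set Path := {w | a + (m + 1) * ε < runMax w t ∧ w t < a + m * ε - b} with hA'
    have hDm : MeasurableSet D := (hrm _).inter ((hle _).inter (hev _))
    have hAm' : MeasurableSet A' := (hrm _).inter (hev _)
    have hmε : 0 ≤ m * ε := by positivity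
    have eA : μ.real A = μ.real {w | a + m * ε + b < w t} := by
      rw [measureReal_def, measureReal_def, hμ.measure_lt_runMax_inter (by positivity)
        (by linarith)]
      ring_nf
    have eA' : μ.real A' = μ.real {w | a + (m + 2) * ε + b < w t} := by
      rw [measureReal_def, measureReal_def, hμ.measure_lt_runMax_inter (by positivity)
        (by linarith)]
      ring_nf
    have hDA : μ.real A = μ.real D + μ.real A' := by
      rw [← measureReal_union _ hAm']
      · congr 1
        ext w
        simp only [hA, hD, hA', Set.mem_ofPred_eq, Set.mem_union]
        constructor
        · rintro ⟨h1, h2⟩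
          rcases le_or_gt (runMax w t) (a + (m + 1) * ε) with h | h
          · exact Or.inl ⟨h1, h, h2⟩
          · exact Or.inr ⟨h, h2⟩
        · rintro (⟨h1, -, h2⟩ | ⟨h1, h2⟩)
          · exact ⟨h1, h2⟩
          · exact ⟨by linarith, h2⟩
      · rw [Set.disjoint_left]
        rintro w ⟨-, h1, -⟩ ⟨h2, -⟩
        linarith
    have hU : {w : Path | ∃ j < m + 1, a + j * ε < runMax w t ∧ runMax w t ≤ a + (j + 1) * ε ∧
        w t < a + j * ε - b} = {w : Path | ∃ j < m, a + j * ε < runMax w t ∧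
          runMax w t ≤ a + (j + 1) * ε ∧ w t < a + j * ε - b} ∪ D := by
      ext w
      simp only [Set.mem_ofPred_eq, Set.mem_union, hD]
      constructor
      · rintro ⟨j, hj, h⟩
        rcases Nat.lt_succ_iff_lt_or_eq.1 hj with h' | rfl
        · exact Or.inl ⟨j, h', h⟩
        · exact Or.inr h
      · rintro (⟨j, hj, h⟩ | h)
        · exact ⟨j, by omega, h⟩
        · exact ⟨m, by omega, h⟩
    rw [hU, measureReal_union _ hDm, ih]
    · rw [eA, eA'] at hDA
      push_cast
      rw [show (m : ℝ) + 1 + 1 = m + 2 by ring]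
      linarith
    · rw [Set.disjoint_left]
      rintro w ⟨j, hj, -, h1, -⟩ ⟨h2, -⟩
      have : ((j : ℝ) + 1) * ε ≤ m * ε := by
        have : (j : ℝ) + 1 ≤ m := by exact_mod_cast hj
        gcongr
      linarith

/-- The joint law of the maximum and of its distance to the endpoint: both parts are symmetric, and
the joint tail depends on `a + b` only. It is the limit of `real_runMax_grid` along dyadic
grids. -/
lemma real_runMax_sub_eval (hμ : IsWiener μ) {a b : ℝ} (ha : 0 ≤ a) (hb : 0 ≤ b) (t : ℝ≥0) :
    μ.real {w | a < runMax w t ∧ b < runMax w t - w t} = 2 * μ.real {w | a + b < w t} := by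
  have := hμ.isProbabilityMeasure
  have hev : ∀ x : ℝ, MeasurableSet {w : Path | w t < x} := fun x =>
    measurableSet_lt (measurable_eval_path t) measurable_const
  have hle : ∀ x : ℝ, MeasurableSet {w : Path | runMax w t ≤ x} := fun x =>
    measurableSet_le ((measurable_eval_path t).comp measurable_runMax) measurable_const
  -- With mesh `2⁻ⁿ` and `4ⁿ` grid levels, the highest level `a + 2ⁿ` tends to infinity.
  let ε : ℕ → ℝ := fun n => 1 / 2 ^ n
  have hε : ∀ n, 0 < ε n := fun n => by positivity
  have hεlim : Tendsto ε atTop (𝓝 0) := by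
    have := tendsto_pow_atTop_nhds_zero_of_lt_one (r := (1 / 2 : ℝ)) (by norm_num) (by norm_num)
    simpa [ε, div_pow] using this
  have h2 : Tendsto (fun n : ℕ => (2 : ℝ) ^ n) atTop atTop :=
    tendsto_pow_atTop_atTop_of_one_lt one_lt_two
  have h4 : ∀ n : ℕ, ((4 ^ n : ℕ) : ℝ) * ε n = 2 ^ n := fun n => by
    simp only [ε]
    push_cast
    rw [show (4 : ℝ) = 2 * 2 by norm_num, mul_pow]
    field_simp
  let U : ℕ → Set Path := fun n => {w | ∃ j : ℕ, j < 4 ^ n ∧ a + j * ε n < runMax w t ∧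
    runMax w t ≤ a + (j + 1) * ε n ∧ w t < a + j * ε n - b}
  have hUm : ∀ n, MeasurableSet (U n) := by
    intro n
    have : U n = ⋃ j : ℕ, ⋃ _ : j < 4 ^ n, ({w | a + j * ε n < runMax w t} ∩
        ({w | runMax w t ≤ a + (j + 1) * ε n} ∩ {w | w t < a + j * ε n - b})) := by
      ext w
      simp only [U, Set.mem_ofPred_eq, Set.mem_iUnion, Set.mem_inter_iff, exists_prop]
    rw [this]
    exact .iUnion fun j => .iUnion fun _ =>
      (measurableSet_lt_runMax _ t).inter ((hle _).inter (hev _))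
  set S : Set Path := {w | a < runMax w t ∧ b < runMax w t - w t} with hS
  have hlim1 : Tendsto (fun n => μ.real (U n)) atTop (𝓝 (μ.real S)) := by
    refine (ENNReal.tendsto_toReal (measure_ne_top _ _)).comp ?_
    refine tendsto_measure_of_tendsto_indicator atTop hUm
      (MeasurableSet.univ) (measure_ne_top _ _) (Eventually.of_forall fun _ => Set.subset_univ _) ?_
    intro w
    by_cases hw : w ∈ S
    · have hw' := hw
      obtain ⟨h1, h2'⟩ := hw'
      have e1 := hεlim.eventually_lt_const (sub_pos.2 h2')
      have e2 := h2.eventually_ge_atTop (runMax w t - a)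
      filter_upwards [e1, e2] with n hn1 hn2
      refine iff_of_true ?_ hw
      -- The index of the grid cell of the maximum is one less than the ceiling of `q`.
      set q : ℝ := (runMax w t - a) / ε n with hq
      have hqpos : 0 < q := div_pos (sub_pos.2 h1) (hε n)
      have hq2 : q * ε n = runMax w t - a := div_mul_cancel₀ _ (hε n).ne'
      have hc1 := Nat.le_ceil q
      have hc2 := Nat.ceil_lt_add_one hqpos.le
      obtain ⟨j, hj⟩ := Nat.exists_eq_succ_of_ne_zero (Nat.ceil_pos.2 hqpos).ne'
      rw [hj] at hc1 hc2
      push_cast at hc1 hc2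
      have k1 : (j : ℝ) * ε n < runMax w t - a := by
        rw [← hq2]
        exact mul_lt_mul_of_pos_right (by linarith) (hε n)
      have k2 : runMax w t - a ≤ (j + 1) * ε n := by
        rw [← hq2]
        exact mul_le_mul_of_nonneg_right hc1 (hε n).le
      refine ⟨j, ?_, by linarith, by linarith, by linarith⟩
      have : (j : ℝ) * ε n < (4 ^ n : ℕ) * ε n := by
        rw [h4]
        linarith
      exact_mod_cast lt_of_mul_lt_mul_right this (hε n).le
    · refine Eventually.of_forall fun n => iff_of_false ?_ hw
      rintro ⟨j, -, h1, -, h3⟩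
      refine hw ⟨?_, by linarith⟩
      have : 0 ≤ j * ε n := mul_nonneg (Nat.cast_nonneg _) (hε n).le
      linarith
  set F := cdf (μ.map fun w : Path => w t) with hF
  have hright : Tendsto (fun n => F (a + ε n + b)) atTop (𝓝 (F (a + b))) := by
    have hc := (F.right_continuous (a + b)).tendsto
    refine hc.comp (tendsto_nhdsWithin_iff.2 ⟨?_, Eventually.of_forall fun n => ?_⟩)
    · have := (tendsto_const_nhds (x := a)).add hεlim |>.add_const b
      simpa using this
    · have := (hε n).le
      simp only [Set.mem_Ici]
      linarith
  have htop1 : Tendsto (fun n : ℕ => F (a + 2 ^ n + b)) atTop (𝓝 1) :=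
    (tendsto_cdf_atTop _).comp
      (tendsto_atTop_add_const_right _ _ (tendsto_atTop_add_const_left _ _ h2))
  have htop2 : Tendsto (fun n : ℕ => F (a + (2 ^ n + ε n) + b)) atTop (𝓝 1) :=
    (tendsto_cdf_atTop _).comp (tendsto_atTop_add_const_right _ _
      (tendsto_atTop_add_const_left _ _ (tendsto_atTop_mono
        (fun n => le_add_of_nonneg_right (hε n).le) h2)))
  have hval : ∀ n, μ.real (U n) = (1 - F (a + b)) + (1 - F (a + ε n + b)) -
      (1 - F (a + 2 ^ n + b)) - (1 - F (a + (2 ^ n + ε n) + b)) := by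
    intro n
    rw [hμ.real_runMax_grid ha hb (hε n).le t (4 ^ n), add_mul, h4, one_mul,
      hμ.real_lt_eval, hμ.real_lt_eval, hμ.real_lt_eval, hμ.real_lt_eval]
  have hlim2 : Tendsto (fun n => μ.real (U n)) atTop
      (𝓝 ((1 - F (a + b)) + (1 - F (a + b)) - (1 - 1) - (1 - 1))) := by
    simp_rw [hval]
    exact (((tendsto_const_nhds.sub tendsto_const_nhds).add (tendsto_const_nhds.sub hright)).sub
      (tendsto_const_nhds.sub htop1)).sub (tendsto_const_nhds.sub htop2)
  rw [tendsto_nhds_unique hlim1 hlim2, hμ.real_lt_eval]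
  ring

/-- At a fixed positive time, a Brownian path is almost surely below its running maximum: the joint
tail at `(0, 0)` is `2 P(0 < w t) = 1`. -/
lemma ae_eval_lt_runMax (hμ : IsWiener μ) {t : ℝ≥0} (ht : t ≠ 0) :
    ∀ᵐ w ∂μ, w t < runMax w t := by
  have := hμ.isProbabilityMeasure
  have hev : ∀ x : ℝ, MeasurableSet {w : Path | w t < x} := fun x =>
    measurableSet_lt (measurable_eval_path t) measurable_const
  have hev' : ∀ x : ℝ, MeasurableSet {w : Path | x < w t} := fun x =>
    measurableSet_lt measurable_const (measurable_eval_path t)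
  have h := hμ.real_runMax_sub_eval le_rfl le_rfl t
  have hneg : μ.real {w | w t < 0} = μ.real {w | 0 < w t} := by
    have := congrArg (fun ρ => ρ.real {w : Path | 0 < w t}) hμ.map_neg
    rw [map_measureReal_apply (by fun_prop) (hev' 0)] at this
    rw [← this]
    congr 1
    ext w
    simp
  have htot : μ.real {w | w t < 0} + μ.real {w | 0 < w t} = 1 := by
    rw [← measureReal_union _ (hev' 0)]
    · have h0 : μ.real ({w : Path | w t < 0} ∪ {w | 0 < w t})ᶜ = 0 := by
        have := hμ.measure_eval_eq_zero ht 0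
        rw [measureReal_def, show ({w : Path | w t < 0} ∪ {w | 0 < w t})ᶜ = {w | w t = 0} by
          ext w; simp [le_antisymm_iff, and_comm], this]
        rfl
      rw [probReal_compl_eq_one_sub ((hev 0).union (hev' 0))] at h0
      linarith
    · rw [Set.disjoint_left]
      rintro w h1 h2
      simp only [Set.mem_ofPred_eq] at h1 h2
      linarith
  rw [add_zero] at h
  have h1 : μ.real {w | 0 < runMax w t ∧ 0 < runMax w t - w t} = 1 := by linarith
  have hm : MeasurableSet {w : Path | 0 < runMax w t ∧ 0 < runMax w t - w t} :=
    (measurableSet_lt_runMax 0 t).inter (measurableSet_lt measurable_const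
      ((measurable_path_eval measurable_runMax t).sub (measurable_eval_path t)))
  have h2 : ∀ᵐ w ∂μ, 0 < runMax w t ∧ 0 < runMax w t - w t := by
    refine (mem_ae_iff_prob_eq_one hm).2 ?_
    rwa [measureReal_def, ENNReal.toReal_eq_one_iff] at h1
  filter_upwards [h2] with w hw using sub_pos.1 hw.2

/-- The joint law of the maximum and of its distance to the endpoint, for nonnegative
functions. -/
lemma lintegral_runMax_sub_eval (hμ : IsWiener μ) {a : ℝ} (ha : 0 ≤ a) {t : ℝ≥0} (ht : t ≠ 0)
    {f : ℝ → ENNReal} (hf : Measurable f) :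
    ∫⁻ w in {w | a < runMax w t}, f (runMax w t - w t) ∂μ =
      2 * ∫⁻ w in {w | a < w t}, f (w t - a) ∂μ := by
  have := hμ.isProbabilityMeasure
  have hm : Measurable fun w : Path => runMax w t - w t := by fun_prop
  have hm2 : Measurable fun w : Path => w t - a := by fun_prop
  have hmeas : (μ.restrict {w | a < runMax w t}).map (fun w => runMax w t - w t) =
      (2 : ℝ≥0) • (μ.restrict {w | a < w t}).map (fun w => w t - a) := by
    have hpos : ∀ b, 0 ≤ b → (μ.restrict {w | a < runMax w t}).map (fun w => runMax w t - w t)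
      (Set.Ioi b) = ((2 : ℝ≥0) • (μ.restrict {w | a < w t}).map (fun w => w t - a))
        (Set.Ioi b) := by
      intro b hb
      have h := hμ.real_runMax_sub_eval ha hb t
      rw [Measure.smul_apply, Measure.map_apply hm measurableSet_Ioi,
        Measure.map_apply hm2 measurableSet_Ioi,
        Measure.restrict_apply (hm measurableSet_Ioi),
        Measure.restrict_apply (hm2 measurableSet_Ioi)]
      have e1 : (fun w : Path => runMax w t - w t) ⁻¹' Set.Ioi b ∩ {w | a < runMax w t} =
          {w | a < runMax w t ∧ b < runMax w t - w t} := by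
        ext w
        simp [and_comm]
      have e2 : (fun w : Path => w t - a) ⁻¹' Set.Ioi b ∩ {w | a < w t} =
          {w | a + b < w t} := by
        ext w
        simp only [Set.mem_inter_iff, Set.mem_preimage, Set.mem_Ioi, Set.mem_ofPred_eq]
        constructor
        · rintro ⟨h1, h2⟩
          linarith
        · intro h1
          constructor <;> linarith
      rw [e1, e2, ENNReal.smul_def, smul_eq_mul,
        ← ENNReal.toReal_eq_toReal_iff' (measure_ne_top _ _)
        (ENNReal.mul_ne_top ENNReal.coe_ne_top (measure_ne_top _ _))]
      simpa [measureReal_def] using h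
    have z1 : (μ.restrict {w | a < runMax w t}).map (fun w => runMax w t - w t)
        (Set.Iic 0) = 0 := by
      rw [Measure.map_apply hm measurableSet_Iic]
      refine Measure.absolutelyContinuous_of_le Measure.restrict_le_self ?_
      refine measure_mono_null ?_ (hμ.ae_eval_lt_runMax ht)
      intro w hw
      simp only [Set.mem_preimage, Set.mem_Iic] at hw
      simp only [Set.mem_compl_iff, Set.mem_ofPred_eq, not_lt]
      linarith
    have z2 : ((2 : ℝ≥0) • (μ.restrict {w | a < w t}).map (fun w => w t - a))
        (Set.Iic 0) = 0 := by
      rw [Measure.smul_apply, Measure.map_apply hm2 measurableSet_Iic,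
        Measure.restrict_apply (hm2 measurableSet_Iic)]
      rw [show (fun w : Path => w t - a) ⁻¹' Set.Iic 0 ∩ {w | a < w t} = ∅ from ?_]
      · simp
      · ext w
        simp only [Set.mem_inter_iff, Set.mem_preimage, Set.mem_Iic, Set.mem_ofPred_eq,
          Set.mem_empty_iff_false, iff_false]
        rintro ⟨h1, h2⟩
        linarith
    refine Measure.ext_of_Iic _ _ fun b => ?_
    rcases le_or_gt 0 b with hb | hb
    · have hu : ∀ ρ : Measure ℝ, [IsFiniteMeasure ρ] → ρ (Set.Iic 0) = 0 →
          ρ (Set.Iic b) = ρ (Set.Ioi 0) - ρ (Set.Ioi b) := by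
        intro ρ _ hρ
        rw [← Set.compl_Ioi, measure_compl measurableSet_Ioi (measure_ne_top _ _),
          ← Set.Iic_union_Ioi (a := (0 : ℝ)), measure_union
            (Set.Iic_disjoint_Ioi le_rfl) measurableSet_Ioi, hρ, zero_add]
      rw [hu _ z1, hu _ z2, hpos 0 le_rfl, hpos b hb]
    · rw [measure_mono_null (Set.Iic_subset_Iic.2 hb.le) z1,
        measure_mono_null (Set.Iic_subset_Iic.2 hb.le) z2]
  rw [← lintegral_map hf hm, hmeas, lintegral_smul_measure, lintegral_map hf hm2]
  rfl

end IsWiener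

/-! ### The one-step identity behind Pitman's theorem -/

/-- The change of variables `u = A + 2 m` on the part of the line where the running maximum
replaces the starting level. -/
lemma lintegral_pitman_step {G : ℝ → ℝ → ENNReal} {A : ℝ} (hA : 0 ≤ A) (x : ℝ) :
    ∫⁻ m in Set.Iio 0, G (-x + 2 * max (A + m) 0) (m + max (A + m) 0) =
      (∫⁻ m in Set.Iic (-A), G (-x) m) + 2⁻¹ * ∫⁻ u in Set.Ioo (-A) A, G (-x + A + u) u := by
  rw [setLIntegral_congr Iio_ae_eq_Iic, ← Set.Iic_union_Ioc_eq_Iic (neg_nonpos.2 hA),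
    lintegral_union measurableSet_Ioc (Set.Iic_disjoint_Ioc le_rfl)]
  congr 1
  · refine setLIntegral_congr_fun measurableSet_Iic fun m hm => ?_
    rw [Set.mem_Iic] at hm
    simp [max_eq_right (show A + m ≤ 0 by linarith)]
  · rw [← setLIntegral_congr Ioo_ae_eq_Ioc]
    have himg : (fun m => A + 2 * m) '' Set.Ioo (-A) 0 = Set.Ioo (-A) A := by
      have h1 : (fun m : ℝ => A + 2 * m) = (fun m => A + m) ∘ (fun m => 2 * m) := rfl
      rw [h1, Set.image_comp, Set.image_mul_left_Ioo two_pos, Set.image_const_add_Ioo]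
      ring_nf
    have h := lintegral_image_eq_lintegral_abs_deriv_mul (s := Set.Ioo (-A) 0)
      (f := fun m : ℝ => A + 2 * m) (f' := fun _ => 2) measurableSet_Ioo
      (fun m _ => by
        have := ((hasDerivAt_id m).const_mul 2).const_add A
        simpa using this.hasDerivWithinAt)
      (fun m _ m' _ hmm => by simpa using hmm) (fun u => G (-x + A + u) u)
    rw [himg] at h
    rw [h, lintegral_const_mul' _ _ (by simp), ← mul_assoc]
    have h2 : (2⁻¹ : ENNReal) * ENNReal.ofReal |2| = 1 := by
      rw [abs_two, ENNReal.ofReal_ofNat]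
      exact ENNReal.inv_mul_cancel (by simp) (by simp)
    rw [h2, one_mul]
    refine setLIntegral_congr_fun measurableSet_Ioo fun m hm => ?_
    rw [Set.mem_Ioo] at hm
    simp only [max_eq_left (show 0 ≤ A + m by linarith)]
    congr 1 <;> ring

namespace IsWiener

variable {μ : Measure Path}

lemma lintegral_neg_eval (hμ : IsWiener μ) {t : ℝ≥0} {f : ℝ → ENNReal} (hf : Measurable f) :
    ∫⁻ w, f (-w t) ∂μ = ∫⁻ w, f (w t) ∂μ := by
  conv_rhs => rw [← hμ.map_neg]
  rw [lintegral_map (by fun_prop) (by fun_prop)]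
  rfl

/-- The one-step identity at a fixed final level `m ≠ 0`. For `m < 0` this is the reflection
principle at the level `-m`, after the second term has been expressed through the endpoint alone;
for `m > 0` the first term vanishes. -/
lemma pitman_step_level (hμ : IsWiener μ) {t : ℝ≥0} (ht : t ≠ 0) {m : ℝ} (hm : m ≠ 0)
    {f : ℝ → ENNReal} (hf : Measurable f) :
    (∫⁻ w in {w | m ≤ -runMax w t}, f (-w t) ∂μ) +
        2⁻¹ * ∫⁻ w in {w | |m| < runMax w t}, f (-w t + runMax w t + m) ∂μ =
      ∫⁻ w in {w | m < w t}, f (w t) ∂μ := by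
  have := hμ.isProbabilityMeasure
  have hhalf : 2⁻¹ * ∫⁻ w in {w | |m| < runMax w t}, f (-w t + runMax w t + m) ∂μ =
      ∫⁻ w in {w | |m| < w t}, f (w t - |m| + m) ∂μ := by
    have h := hμ.lintegral_runMax_sub_eval (abs_nonneg m) ht (f := fun x => f (x + m))
      (by fun_prop)
    rw [show (fun w : Path => f (-w t + runMax w t + m)) =
      fun w => f (runMax w t - w t + m) by ext w; congr 1; ring, h, ← mul_assoc,
      ENNReal.inv_mul_cancel (by simp) (by simp), one_mul]
  rw [hhalf]
  have hgt : ∀ x : ℝ, MeasurableSet {w : Path | x < w t} := fun x =>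
    measurableSet_lt measurable_const (measurable_eval_path t)
  have hlt : ∀ x : ℝ, MeasurableSet {w : Path | w t < x} := fun x =>
    measurableSet_lt (measurable_eval_path t) measurable_const
  have hrm : ∀ x : ℝ, MeasurableSet {w : Path | runMax w t ≤ x} := fun x =>
    measurableSet_le (measurable_path_eval measurable_runMax t) measurable_const
  rcases lt_or_gt_of_ne hm with hneg | hpos
  · set a := -m with ha
    have ha0 : 0 < a := by linarith
    have e0 : |m| = a := abs_of_neg hneg
    have hma : m = -a := by linarith
    rw [e0, hma]
    have e1 : {w : Path | -a ≤ -runMax w t} = {w | runMax w t ≤ a} := by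
      ext w; simp
    have e2 : ∫⁻ w in {w : Path | -a < w t}, f (w t) ∂μ = ∫⁻ w in {w | w t < a}, f (-w t) ∂μ := by
      rw [← lintegral_indicator (hgt _), ← lintegral_indicator (hlt _)]
      have h := hμ.lintegral_neg_eval (t := t) (f := (Set.Ioi (-a)).indicator f)
        (hf.indicator measurableSet_Ioi)
      rw [show (fun w : Path => {w : Path | -a < w t}.indicator (fun w => f (w t)) w) =
        fun w => (Set.Ioi (-a)).indicator f (w t) from rfl, ← h]
      refine lintegral_congr fun w => ?_
      simp only [Set.indicator, Set.mem_Ioi, Set.mem_ofPred_eq, neg_lt_neg_iff]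
    have e3 : ∫⁻ w in {w : Path | runMax w t ≤ a}, f (-w t) ∂μ =
        ∫⁻ w in {w : Path | runMax w t ≤ a} ∩ {w | w t < a}, f (-w t) ∂μ := by
      refine setLIntegral_congr ?_
      have hne : ∀ᵐ w ∂μ, w t ≠ a := ae_iff.2 (by
        simpa using hμ.measure_eval_eq_zero ht a)
      filter_upwards [hne] with w hw
      refine propext ⟨fun h => ⟨h, ?_⟩, fun h => h.1⟩
      exact lt_of_le_of_ne ((le_runMax w le_rfl).trans h) hw
    have e4 : ∫⁻ w in {w : Path | a < w t}, f (w t - a + -a) ∂μ =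
        ∫⁻ w in {w : Path | runMax w t ≤ a}ᶜ ∩ {w | w t < a}, f (-w t) ∂μ := by
      have h := hμ.lintegral_reflection ha0.le t
        (f := (Set.Iio a).indicator fun x => f (-x))
        ((hf.comp measurable_neg).indicator measurableSet_Iio)
      have hc : {w : Path | runMax w t ≤ a}ᶜ = {w | a < runMax w t} := by
        ext w; simp
      rw [hc, Set.inter_comm, ← Measure.restrict_restrict (hlt a), ← lintegral_indicator (hlt a)]
      rw [show (fun w : Path => {w : Path | w t < a}.indicator (fun w => f (-w t)) w) =
        fun w => (Set.Iio a).indicator (fun x => f (-x)) (w t) from rfl, ← h]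
      have hsub : {w : Path | a < w t} = {w | a < w t} ∩ {w | a < runMax w t} :=
        (Set.inter_eq_left.2 fun (w : Path) (hw : a < w t) =>
          show w ∈ {w : Path | a < runMax w t} from
            lt_of_lt_of_le hw (le_runMax w le_rfl)).symm
      rw [hsub, ← Measure.restrict_restrict (hgt a), ← lintegral_indicator (hgt a)]
      refine lintegral_congr fun w => ?_
      have : a < w t ↔ 2 * a - w t < a := by constructor <;> intro h <;> linarith
      simp only [Set.indicator, Set.mem_Iio, Set.mem_ofPred_eq, this]
      congr 2
      ring
    rw [e1, e2, e3, e4, ← lintegral_inter_add_sdiff (μ := μ) (fun w : Path => f (-w t))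
      {w : Path | w t < a} (hrm a), Set.inter_comm, Set.inter_comm _ᶜ]
    rfl
  · have e1 : {w : Path | m ≤ -runMax w t} =ᵐ[μ] (∅ : Set Path) := by
      filter_upwards [hμ.ae_eval_zero] with w hw
      refine propext ⟨fun h => ?_, fun h => h.elim⟩
      have := zero_le_runMax hw t
      have h' : m ≤ -runMax w t := h
      linarith
    rw [setLIntegral_congr e1, abs_of_pos hpos]
    simp

/-- **The one-step identity**: if the level `m` is distributed according to Lebesgue measure on
`(-∞, 0)`, the transformed endpoint and the raised level are distributed like the endpoint of a
Brownian motion together with a level uniform below it. -/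
lemma pitman_step (hμ : IsWiener μ) (t : ℝ≥0) {G : ℝ → ℝ → ENNReal}
    (hG : Measurable (Function.uncurry G)) :
    ∫⁻ m in Set.Iio 0, ∫⁻ w, G (-w t + 2 * max (runMax w t + m) 0)
        (m + max (runMax w t + m) 0) ∂μ =
      ∫⁻ w, (∫⁻ m in Set.Iio (w t), G (w t) m) ∂μ := by
  have := hμ.isProbabilityMeasure
  have hmw : Measurable fun p : ℝ × Path => runMax p.2 t :=
    (measurable_path_eval measurable_runMax t).comp measurable_snd
  have hme : Measurable fun p : ℝ × Path => p.2 t := (measurable_eval_path t).comp measurable_snd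
  rcases eq_or_ne t 0 with rfl | ht
  · have h1 : ∀ m ∈ Set.Iio (0 : ℝ), ∫⁻ w : Path, G (-w 0 + 2 * max (runMax w 0 + m) 0)
        (m + max (runMax w 0 + m) 0) ∂μ = G 0 m := by
      intro m hm
      rw [lintegral_congr_ae (g := fun _ => G 0 m)]
      · simp
      · filter_upwards [hμ.ae_eval_zero] with w hw
        have hr : runMax w 0 = 0 := by
          obtain ⟨s, hs, h⟩ := exists_eq_runMax w 0
          rw [← h, le_antisymm hs zero_le, hw]
        rw [hw, hr, max_eq_right (by simpa using (Set.mem_Iio.1 hm).le)]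
        simp
    have h2 : ∫⁻ w, (∫⁻ m in Set.Iio (w 0), G (w 0) m) ∂μ =
        ∫⁻ _ : Path, (∫⁻ m in Set.Iio 0, G 0 m) ∂μ := by
      refine lintegral_congr_ae ?_
      filter_upwards [hμ.ae_eval_zero] with w hw
      rw [hw]
    rw [setLIntegral_congr_fun measurableSet_Iio h1, h2]
    simp
  · have hmG : Measurable (Function.uncurry fun (m : ℝ) (w : Path) =>
        G (-w t + 2 * max (runMax w t + m) 0) (m + max (runMax w t + m) 0)) := by
      refine hG.comp (Measurable.prodMk ?_ ?_)
      · exact hme.neg.add (((hmw.add measurable_fst).max measurable_const).const_mul 2)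
      · exact measurable_fst.add ((hmw.add measurable_fst).max measurable_const)
    rw [lintegral_lintegral_swap hmG.aemeasurable]
    -- Both sides are integrals over the final level, and agree for almost every value of it.
    have hstep : ∀ᵐ w ∂μ, ∫⁻ m in Set.Iio 0, G (-w t + 2 * max (runMax w t + m) 0)
        (m + max (runMax w t + m) 0) =
        ∫⁻ m, ({w : Path | m ≤ -runMax w t}.indicator (fun w => G (-w t) m) w +
          2⁻¹ * {w : Path | |m| < runMax w t}.indicator
            (fun w => G (-w t + runMax w t + m) m) w) := by
      filter_upwards [hμ.ae_eval_zero] with w hw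
      rw [lintegral_pitman_step (zero_le_runMax hw t), lintegral_add_left,
        lintegral_const_mul', ← lintegral_indicator measurableSet_Iic,
        ← lintegral_indicator measurableSet_Ioo]
      · congr 2
        refine lintegral_congr fun m => ?_
        simp only [Set.indicator, Set.mem_Ioo, Set.mem_ofPred_eq, abs_lt]
      · simp
      · have : Measurable ((Set.Iic (-runMax w t)).indicator fun m => G (-w t) m) :=
          (hG.comp (measurable_const.prodMk measurable_id)).indicator measurableSet_Iic
        exact this
    rw [lintegral_congr_ae hstep]
    have hS1 : MeasurableSet {p : ℝ × Path | p.1 ≤ -runMax p.2 t} :=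
      measurableSet_le measurable_fst hmw.neg
    have hS2 : MeasurableSet {p : ℝ × Path | |p.1| < runMax p.2 t} :=
      measurableSet_lt measurable_fst.abs hmw
    have hS3 : MeasurableSet {p : ℝ × Path | p.1 < p.2 t} :=
      measurableSet_lt measurable_fst hme
    have hF1 : Measurable (Function.uncurry fun (m : ℝ) (w : Path) =>
        {w : Path | m ≤ -runMax w t}.indicator (fun w => G (-w t) m) w) :=
      (hG.comp (hme.neg.prodMk measurable_fst)).indicator hS1
    have hF2 : Measurable (Function.uncurry fun (m : ℝ) (w : Path) =>
        {w : Path | |m| < runMax w t}.indicator (fun w => G (-w t + runMax w t + m) m) w) :=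
      (hG.comp (((hme.neg.add hmw).add measurable_fst).prodMk measurable_fst)).indicator hS2
    have hF3 : Measurable (Function.uncurry fun (m : ℝ) (w : Path) =>
        {w : Path | m < w t}.indicator (fun w => G (w t) m) w) :=
      (hG.comp (hme.prodMk measurable_fst)).indicator hS3
    have hR : ∀ w : Path, ∫⁻ m in Set.Iio (w t), G (w t) m =
        ∫⁻ m, {w : Path | m < w t}.indicator (fun w => G (w t) m) w := by
      intro w
      rw [← lintegral_indicator measurableSet_Iio]
      rfl
    simp_rw [hR]
    rw [← lintegral_lintegral_swap (hF1.add (hF2.const_mul 2⁻¹)).aemeasurable,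
      ← lintegral_lintegral_swap hF3.aemeasurable]
    have hne : ∀ᵐ m : ℝ, m ≠ 0 := by simp [ae_iff]
    refine lintegral_congr_ae ?_
    filter_upwards [hne] with m hm
    have hGm : Measurable fun x => G x m := hG.comp (measurable_id.prodMk measurable_const)
    have hF1m : Measurable fun w : Path =>
        {w : Path | m ≤ -runMax w t}.indicator (fun w => G (-w t) m) w :=
      hF1.comp (measurable_const.prodMk measurable_id)
    rw [lintegral_add_left hF1m,
      lintegral_const_mul' _ _ (by simp), lintegral_indicator, lintegral_indicator,
      lintegral_indicator, hμ.pitman_step_level ht hm hGm]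
    · exact measurableSet_lt measurable_const (measurable_eval_path t)
    · exact measurableSet_lt measurable_const (measurable_path_eval measurable_runMax t)
    · exact measurableSet_le measurable_const (measurable_path_eval measurable_runMax t).neg

end IsWiener

/-! ### Pitman's transform with a Lebesgue distributed starting level -/

/-- The transform `-w + 2 (max w + m)⁺` of Pitman, with starting level `m ≤ 0`: up to
the time at which the running maximum of `w` reaches `-m` it is `-w`, and from then on it is
`2 max w - w` up to a constant. -/
noncomputable def pitman (m : ℝ) (w : Path) : Path where
  toFun t := -w t + 2 * max (runMax w t + m) 0

/-- The level of Pitman's transform at time `t`: it starts from `m` and increases with the running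
maximum once that has reached `-m`. -/
noncomputable def pitmanLevel (m : ℝ) (w : Path) (t : ℝ≥0) : ℝ := m + max (runMax w t + m) 0

lemma pitman_apply (m : ℝ) (w : Path) (t : ℝ≥0) :
    pitman m w t = -w t + 2 * max (runMax w t + m) 0 := rfl

lemma max_runMax_add (m : ℝ) (w : Path) (s t : ℝ≥0) :
    max (runMax w (s + t) + m) 0 = max (runMax w s + m) 0 +
      max (runMax (incrFrom s w) t + (pitmanLevel m w s - pitman m w s)) 0 := by
  rw [runMax_add, pitmanLevel, pitman_apply, ← max_add_add_right]
  have : ∀ x y : ℝ, max x y + max (w s + runMax (incrFrom s w) t + m - max x y) 0 =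
      max (max x (w s + runMax (incrFrom s w) t + m)) y := by
    intro x y
    rw [← max_add_add_left, max_right_comm, max_comm]
    congr 1 <;> ring
  rw [← this]
  congr 2
  ring

/-- The pair of the transformed path and of the level is Markovian: after time `s` it is driven by
the increments of `w`, and the level relative to the path plays the role of the starting level. -/
lemma pitman_add (m : ℝ) (w : Path) (s t : ℝ≥0) :
    pitman m w (s + t) = pitman m w s + (-incrFrom s w t +
      2 * max (runMax (incrFrom s w) t + (pitmanLevel m w s - pitman m w s)) 0) := by
  rw [pitman_apply, max_runMax_add, pitman_apply m w s, incrFrom_apply]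
  ring

lemma pitmanLevel_add (m : ℝ) (w : Path) (s t : ℝ≥0) :
    pitmanLevel m w (s + t) = pitmanLevel m w s +
      max (runMax (incrFrom s w) t + (pitmanLevel m w s - pitman m w s)) 0 := by
  rw [pitmanLevel, max_runMax_add, pitmanLevel]
  ring

lemma pitman_stopAt (m : ℝ) (w : Path) (L : ℝ≥0) :
    pitman m (stopAt L w) = stopAt L (pitman m w) := by
  ext t
  rw [stopAt_apply, pitman_apply, pitman_apply, runMax_stopAt, stopAt_apply]

lemma pitmanLevel_stopAt (m : ℝ) (w : Path) (L t : ℝ≥0) :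
    pitmanLevel m (stopAt L w) t = pitmanLevel m w (min t L) := by
  rw [pitmanLevel, pitmanLevel, runMax_stopAt]

lemma measurable_pitman : Measurable (fun p : ℝ × Path => pitman p.1 p.2) := by
  refine measurable_path_of_eval fun t => ?_
  simp only [pitman_apply]
  exact ((measurable_path_eval measurable_snd t).neg).add
    ((((measurable_path_eval (measurable_runMax.comp measurable_snd) t).add
      measurable_fst).max measurable_const).const_mul 2)

lemma measurable_pitmanLevel (t : ℝ≥0) :
    Measurable (fun p : ℝ × Path => pitmanLevel p.1 p.2 t) :=
  measurable_fst.add ((((measurable_path_eval (measurable_runMax.comp measurable_snd) t).add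
      measurable_fst).max measurable_const))

lemma setLIntegral_Iio_eq_translate (x : ℝ) (f : ℝ → ENNReal) :
    ∫⁻ m in Set.Iio x, f m = ∫⁻ m in Set.Iio 0, f (x + m) := by
  rw [← lintegral_indicator measurableSet_Iio, ← lintegral_indicator measurableSet_Iio,
    ← lintegral_add_left_eq_self _ x]
  refine lintegral_congr fun m => ?_
  simp only [Set.indicator, Set.mem_Iio, add_lt_iff_neg_left]

/-- The sequence which agrees with `v` up to the index `p` and takes the value `x` afterwards. -/
def extendSeq (p : ℕ) (v : ℕ → ℝ) (x : ℝ) (i : ℕ) : ℝ := if i ≤ p then v i else x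

lemma measurable_extendSeq {α : Type*} [MeasurableSpace α] (p : ℕ) {v : α → ℕ → ℝ} {x : α → ℝ}
    (hv : Measurable v) (hx : Measurable x) :
    Measurable fun a => extendSeq p (v a) (x a) := by
  refine measurable_pi_iff.2 fun i => ?_
  simp only [extendSeq]
  split_ifs
  · exact (measurable_pi_apply i).comp hv
  · exact hx

lemma extendSeq_min (p : ℕ) (F : ℕ → ℝ) :
    extendSeq p (fun i => F (min i p)) (F (p + 1)) = fun i => F (min i (p + 1)) := by
  ext i
  simp only [extendSeq]
  split_ifs with h
  · rw [min_eq_left h, min_eq_left (h.trans (Nat.le_succ p))]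
  · rw [min_eq_right (by omega)]

lemma measurable_setLIntegral_Iio {α : Type*} [MeasurableSpace α] {x : α → ℝ}
    (hx : Measurable x) {F : α → ℝ → ENNReal} (hF : Measurable (Function.uncurry F)) :
    Measurable fun a => ∫⁻ m in Set.Iio (x a), F a m := by
  have h : Measurable (Function.uncurry fun (a : α) (m : ℝ) =>
      (Set.Iio (x a)).indicator (F a) m) :=
    hF.indicator (measurableSet_lt measurable_snd (hx.comp measurable_fst))
  simp_rw [← lintegral_indicator measurableSet_Iio]
  exact h.lintegral_prod_right

namespace IsWiener

variable {μ : Measure Path}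

/-- **Pitman's theorem in law, for finite-dimensional distributions**: under Lebesgue measure for
the starting level, the transformed path along a grid is a Brownian motion, together with a final
level distributed according to Lebesgue measure below the endpoint. -/
lemma pitman_fdd (hμ : IsWiener μ) {t : ℕ → ℝ≥0} (ht : Monotone t) (p : ℕ) :
    ∀ {G : (ℕ → ℝ) → ℝ → ENNReal}, Measurable (Function.uncurry G) →
    ∫⁻ m in Set.Iio 0, ∫⁻ w, G (fun i => pitman m w (t (min i p))) (pitmanLevel m w (t p)) ∂μ =
      ∫⁻ w, (∫⁻ m in Set.Iio (w (t p)), G (fun i => w (t (min i p))) m) ∂μ := by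
  have := hμ.isProbabilityMeasure
  induction p with
  | zero =>
    intro G hG
    simp only [min_zero]
    have h0 : Measurable (Function.uncurry fun x m : ℝ => G (fun _ => x) m) :=
      hG.comp ((measurable_pi_iff.2 fun _ => measurable_fst).prodMk measurable_snd)
    exact hμ.pitman_step (t 0) h0
  | succ p ih =>
    intro G hG
    obtain ⟨d, hd⟩ := exists_add_of_le (ht (Nat.le_succ p))
    rw [Nat.succ_eq_add_one] at hd
    -- The state at the next grid time as a function of the current one and of the increment.
    let Y : ℝ → ℝ → Path → ℝ := fun x m b => x + (-b d + 2 * max (runMax b d + (m - x)) 0)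
    let M : ℝ → ℝ → Path → ℝ := fun x m b => m + max (runMax b d + (m - x)) 0
    have hrd : Measurable fun b : Path => runMax b d := measurable_path_eval measurable_runMax d
    let K : ((ℕ → ℝ) × ℝ) × Path → ENNReal := fun q =>
      G (extendSeq p q.1.1 (Y (q.1.1 p) q.1.2 q.2)) (M (q.1.1 p) q.1.2 q.2)
    have hK : Measurable K := by
      have hx : Measurable fun q : ((ℕ → ℝ) × ℝ) × Path => q.1.1 p :=
        (measurable_pi_apply p).comp (measurable_fst.comp measurable_fst)
      have hm : Measurable fun q : ((ℕ → ℝ) × ℝ) × Path => q.1.2 :=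
        measurable_snd.comp measurable_fst
      have hr : Measurable fun q : ((ℕ → ℝ) × ℝ) × Path => runMax q.2 d :=
        hrd.comp measurable_snd
      have hb : Measurable fun q : ((ℕ → ℝ) × ℝ) × Path => q.2 d :=
        measurable_path_eval measurable_snd d
      have hmax := (hr.add (hm.sub hx)).max (measurable_const (a := (0 : ℝ)))
      exact hG.comp ((measurable_extendSeq p (measurable_fst.comp measurable_fst)
        (hx.add (hb.neg.add (hmax.const_mul 2)))).prodMk (hm.add hmax))
    let G' : (ℕ → ℝ) → ℝ → ENNReal := fun v m => ∫⁻ b, K ((v, m), b) ∂μ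
    have hG' : Measurable (Function.uncurry G') := hK.lintegral_prod_right'
    -- Conditioning on the past up to the current grid time.
    have hleft : ∀ m : ℝ, ∫⁻ w, G (fun i => pitman m w (t (min i (p + 1))))
        (pitmanLevel m w (t (p + 1))) ∂μ =
        ∫⁻ w, G' (fun i => pitman m w (t (min i p))) (pitmanLevel m w (t p)) ∂μ := by
      intro m
      let F : Path → Path → ENNReal := fun v b =>
        K ((fun i => pitman m v (t (min i p)), pitmanLevel m v (t p)), b)
      have hF : Measurable (Function.uncurry F) := by
        refine hK.comp (Measurable.prodMk (Measurable.prodMk ?_ ?_) measurable_snd)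
        · exact measurable_pi_iff.2 fun i => measurable_path_eval
            (measurable_pitman.comp (measurable_const.prodMk measurable_fst)) _
        · exact (measurable_pitmanLevel _).comp (measurable_const.prodMk measurable_fst)
      have hmin : ∀ i, min (t (min i p)) (t p) = t (min i p) := fun i =>
        min_eq_left (ht (min_le_right _ _))
      have hst : ∀ w : Path, (fun i => pitman m (stopAt (t p) w) (t (min i p))) =
          fun i => pitman m w (t (min i p)) := fun w => by
        ext i
        rw [pitman_stopAt, stopAt_apply, hmin]
      have h := hμ.lintegral_stopAt_incrFrom (t p) hF
      simp only [F, hst, pitmanLevel_stopAt, min_self] at h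
      rw [show (∫⁻ w, G' (fun i => pitman m w (t (min i p))) (pitmanLevel m w (t p)) ∂μ) =
        ∫⁻ w, ∫⁻ b, K ((fun i => pitman m w (t (min i p)), pitmanLevel m w (t p)), b) ∂μ ∂μ
        from rfl, ← h]
      refine lintegral_congr fun w => ?_
      simp only [K, Y, M, min_self]
      rw [← pitman_add, ← pitmanLevel_add, ← hd,
        extendSeq_min p (fun i => pitman m w (t i))]
    simp_rw [hleft]
    rw [ih hG']
    -- The one-step identity, started from the current endpoint.
    have hstep : ∀ v : ℕ → ℝ, ∫⁻ m in Set.Iio (v p), G' v m =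
        ∫⁻ b, (∫⁻ m in Set.Iio (v p + b d), G (extendSeq p v (v p + b d)) m) ∂μ := by
      intro v
      rw [setLIntegral_Iio_eq_translate]
      have hv : Measurable (Function.uncurry fun y m : ℝ =>
          G (extendSeq p v (v p + y)) (v p + m)) :=
        hG.comp ((measurable_extendSeq p measurable_const
          (measurable_const.add measurable_fst)).prodMk (measurable_const.add measurable_snd))
      have h := hμ.pitman_step d hv
      calc ∫⁻ m in Set.Iio 0, G' v (v p + m)
          = ∫⁻ m in Set.Iio 0, ∫⁻ w, G (extendSeq p v (v p + (-w d + 2 * max (runMax w d + m) 0)))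
              (v p + (m + max (runMax w d + m) 0)) ∂μ := by
            refine lintegral_congr fun m => lintegral_congr fun b => ?_
            simp only [K, Y, M, add_sub_cancel_left, add_assoc]
        _ = _ := h
        _ = _ := by
            refine lintegral_congr fun b => ?_
            rw [setLIntegral_Iio_eq_translate (b d), setLIntegral_Iio_eq_translate (v p + b d)]
            simp only [add_assoc]
    let Φ : Path → Path → ENNReal := fun v b =>
      ∫⁻ m in Set.Iio (v (t p) + b d),
        G (extendSeq p (fun i => v (t (min i p))) (v (t p) + b d)) m
    have hΦ : Measurable (Function.uncurry Φ) := by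
      have hx : Measurable fun q : Path × Path => q.1 (t p) + q.2 d :=
        (measurable_path_eval measurable_fst _).add (measurable_path_eval measurable_snd _)
      refine measurable_setLIntegral_Iio hx (F := fun (q : Path × Path) m =>
        G (extendSeq p (fun i => q.1 (t (min i p))) (q.1 (t p) + q.2 d)) m) ?_
      refine hG.comp ((measurable_extendSeq p ?_ (hx.comp measurable_fst)).prodMk measurable_snd)
      exact measurable_pi_iff.2 fun i =>
        measurable_path_eval (measurable_fst.comp measurable_fst) _
    have h := hμ.lintegral_stopAt_incrFrom (t p) hΦ
    have hmin : ∀ i, min (t (min i p)) (t p) = t (min i p) := fun i =>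
      min_eq_left (ht (min_le_right _ _))
    simp only [Φ, stopAt_apply, min_self, hmin, incrFrom_apply, ← hd, add_sub_cancel] at h
    have hstep' := fun w : Path => hstep fun i => w (t (min i p))
    simp only [min_self] at hstep'
    simp_rw [hstep', ← h]
    refine lintegral_congr fun w => ?_
    rw [extendSeq_min p (fun i => w (t i))]

/-- A finite set of times is listed by a monotone sequence, with a prescribed last time which
dominates the set. -/
lemma exists_monotone_listing (I : Finset ℝ≥0) (L : ℝ≥0) :
    ∃ (t : ℕ → ℝ≥0) (p : ℕ), Monotone t ∧ t p = L ∧ ∀ s ∈ I, ∃ i, t (min i p) = min s L := by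
  classical
  set J : Finset ℝ≥0 := insert L (I.image fun s => min s L) with hJ
  have hJL : L ∈ J := Finset.mem_insert_self _ _
  have hle : ∀ s ∈ J, s ≤ L := by
    intro s hs
    rcases Finset.mem_insert.1 hs with rfl | hs
    · exact le_rfl
    · obtain ⟨u, -, rfl⟩ := Finset.mem_image.1 hs
      exact min_le_right _ _
  obtain ⟨p, hp⟩ := Nat.exists_eq_succ_of_ne_zero (Finset.card_ne_zero_of_mem hJL)
  let e := J.orderEmbOfFin hp
  let t : ℕ → ℝ≥0 := fun i => e ⟨min i p, Nat.lt_succ_iff.2 (min_le_right i p)⟩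
  have ht : Monotone t := fun i j hij => e.monotone (min_le_min_right p hij)
  have hmem : ∀ s ∈ J, ∃ i ≤ p, t i = s := by
    intro s hs
    have : s ∈ Set.range e := by
      rw [Finset.range_orderEmbOfFin]
      exact hs
    obtain ⟨i, rfl⟩ := this
    refine ⟨i, Nat.lt_succ_iff.1 i.2, ?_⟩
    simp only [t, min_eq_left (Nat.lt_succ_iff.1 i.2)]
  refine ⟨t, p, ht, ?_, fun s hs => ?_⟩
  · obtain ⟨i, hi, hiL⟩ := hmem L hJL
    refine le_antisymm (hle _ (J.orderEmbOfFin_mem hp _)) ?_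
    rw [← hiL]
    exact ht hi
  · obtain ⟨i, hi, his⟩ := hmem (min s L)
      (Finset.mem_insert_of_mem (Finset.mem_image_of_mem _ hs))
    exact ⟨i, by rw [min_eq_left hi, his]⟩

/-- **Absolute continuity of Pitman's transform**: a set of paths on `[0, L]` which is negligible
for Brownian motion is negligible for its Pitman transform with almost every starting level. -/
lemma ae_pitman_null (hμ : IsWiener μ) (L : ℝ≥0) {N : Set Path} (hN : MeasurableSet N)
    (hN0 : μ {w | stopAt L w ∈ N} = 0) :
    ∀ᵐ m ∂(volume.restrict (Set.Iio (0 : ℝ))), μ {w | stopAt L (pitman m w) ∈ N} = 0 := by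
  have := hμ.isProbabilityMeasure
  set ρ : Measure (ℝ × Path) := (volume.restrict (Set.Iio (0 : ℝ))).prod μ with hρ
  have hpit : Measurable fun q : ℝ × Path => stopAt L (pitman q.1 q.2) :=
    (measurable_stopAt L).comp measurable_pitman
  let S : ℕ → Set (ℝ × Path) := fun K => {q | pitmanLevel q.1 q.2 L ∈ Set.Icc (-(K : ℝ)) K}
  have hS : ∀ K, MeasurableSet (S K) := fun K => measurable_pitmanLevel L measurableSet_Icc
  let c : ℕ → Path → ENNReal := fun K w =>
    ∫⁻ m in Set.Iio (w L), (Set.Icc (-(K : ℝ)) K).indicator 1 m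
  -- The law of the transformed path, with the final level confined to a bounded interval. This
  -- keeps the measures finite, so that they are determined by their finite-dimensional
  -- distributions.
  have key : ∀ K, (ρ.restrict (S K)).map (fun q => stopAt L (pitman q.1 q.2)) =
      (μ.withDensity (c K)).map (stopAt L) := by
    intro K
    have hfin : IsFiniteMeasure (μ.withDensity (c K)) := by
      refine isFiniteMeasure_withDensity ?_
      refine ne_top_of_le_ne_top (b := ∫⁻ _ : Path, volume (Set.Icc (-(K : ℝ)) K) ∂μ) ?_ ?_
      · simp [ENNReal.ofReal_ne_top]
      · refine lintegral_mono fun w => ?_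
        refine (setLIntegral_le_lintegral _ _).trans ?_
        rw [lintegral_indicator_one measurableSet_Icc]
    have hfin' : IsFiniteMeasure ((μ.withDensity (c K)).map (stopAt L)) :=
      Measure.isFiniteMeasure_map _ _
    refine (path_measure_ext fun I => ?_).symm
    obtain ⟨t, p, ht, htp, hI⟩ := exists_monotone_listing I L
    choose! idx hidx using hI
    have hres : Measurable fun w : Path => I.restrict fun s => w s :=
      (Finset.measurable_restrict I).comp measurable_coe_path
    ext A hA
    have hval : Measurable fun (v : ℕ → ℝ) (s : I) => v (idx s) :=
      measurable_pi_iff.2 fun s => measurable_pi_apply _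
    let G : (ℕ → ℝ) → ℝ → ENNReal := fun v m =>
      ((fun (v : ℕ → ℝ) (s : I) => v (idx s)) ⁻¹' A).indicator 1 v *
        (Set.Icc (-(K : ℝ)) K).indicator 1 m
    have hG : Measurable (Function.uncurry G) :=
      ((measurable_one.indicator (hval hA)).comp measurable_fst).mul
        ((measurable_one.indicator measurableSet_Icc).comp measurable_snd)
    have h := hμ.pitman_fdd ht p hG
    rw [htp] at h
    have hw : ∀ w : Path, (fun s : I => w (t (min (idx s) p))) =
        I.restrict fun s => stopAt L w s := fun w => by
      ext s
      rw [hidx s s.2]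
      rfl
    have hw' : ∀ w : Path, ((fun (v : ℕ → ℝ) (s : I) => v (idx s)) ⁻¹' A).indicator
        (1 : (ℕ → ℝ) → ENNReal) (fun i => w (t (min i p))) =
        A.indicator (1 : (I → ℝ) → ENNReal) (I.restrict fun s => stopAt L w s) := fun w => by
      rw [← hw w]
      rfl
    have hp1 : MeasurableSet ((fun w => I.restrict fun s => stopAt L w s) ⁻¹' A) :=
      (hres.comp (measurable_stopAt L)) hA
    have hp2 : MeasurableSet
        ((fun q : ℝ × Path => I.restrict fun s => stopAt L (pitman q.1 q.2) s) ⁻¹' A) :=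
      (hres.comp hpit) hA
    have hL : ρ ((fun q : ℝ × Path => I.restrict fun s => stopAt L (pitman q.1 q.2) s) ⁻¹' A ∩
        S K) = ∫⁻ m in Set.Iio 0, ∫⁻ w, G (fun i => pitman m w (t (min i p)))
          (pitmanLevel m w L) ∂μ := by
      rw [← lintegral_indicator_one (hp2.inter (hS K)), lintegral_prod _
        (measurable_one.indicator (hp2.inter (hS K))).aemeasurable]
      refine lintegral_congr fun m => lintegral_congr fun w => ?_
      rw [Set.inter_indicator_one]
      simp only [G, Pi.mul_apply]
      rw [hw']
      rfl
    have hR : (μ.withDensity (c K)) ((fun w => I.restrict fun s => stopAt L w s) ⁻¹' A) =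
        ∫⁻ w, (∫⁻ m in Set.Iio (w L), G (fun i => w (t (min i p))) m) ∂μ := by
      rw [withDensity_apply _ hp1, ← lintegral_indicator hp1]
      refine lintegral_congr fun w => ?_
      simp only [G]
      rw [lintegral_const_mul _ (measurable_one.indicator measurableSet_Icc)]
      rw [hw' w]
      by_cases hwA : (I.restrict fun s => stopAt L w s) ∈ A
      · rw [Set.indicator_of_mem (show w ∈ _ from hwA), Set.indicator_of_mem hwA, Pi.one_apply,
          one_mul]
      · rw [Set.indicator_of_notMem (show w ∉ _ from hwA), Set.indicator_of_notMem hwA, zero_mul]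
    rw [Measure.map_apply hres hA, Measure.map_apply hres hA,
      Measure.map_apply (measurable_stopAt L) (hres hA), Measure.map_apply hpit (hres hA),
      Measure.restrict_apply (hpit (hres hA))]
    exact hR.trans (h.symm.trans hL.symm)
  have hnull : ∀ K, ρ ({q | stopAt L (pitman q.1 q.2) ∈ N} ∩ S K) = 0 := by
    intro K
    have h := congrArg (fun ν => ν N) (key K)
    rw [Measure.map_apply hpit hN, Measure.map_apply (measurable_stopAt L) hN,
      Measure.restrict_apply (hpit hN)] at h
    exact h.trans ((withDensity_absolutelyContinuous μ (c K)) hN0)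
  have hall : ρ {q | stopAt L (pitman q.1 q.2) ∈ N} = 0 := by
    refine measure_mono_null ?_ (measure_iUnion_null hnull)
    intro q hq
    obtain ⟨K, hK⟩ := exists_nat_ge |pitmanLevel q.1 q.2 L|
    exact Set.mem_iUnion.2 ⟨K, hq, abs_le.1 hK⟩
  exact (Measure.measure_prod_null (hpit hN)).1 hall

end IsWiener

/-! ### Reflection of a path off another path -/

/-- The path `b`, started from `g`, reflected upwards off the path `x`; this is one step of
last passage percolation, which adds a line `b` with entry cost `g` on top of an ensemble whose last
passage values are given by `x`. -/
noncomputable def reflect (g : ℝ) (x b : Path) : Path where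
  toFun t := b t + max g (runMax (x - b) t)

lemma reflect_apply (g : ℝ) (x b : Path) (t : ℝ≥0) :
    reflect g x b t = b t + max g (runMax (x - b) t) := rfl

@[fun_prop]
lemma measurable_reflect {α : Type*} [MeasurableSpace α] {g : α → ℝ} {X B : α → Path}
    (hg : Measurable g) (hX : Measurable X) (hB : Measurable B) :
    Measurable fun a => reflect (g a) (X a) (B a) := by
  refine measurable_path_of_eval fun t => ?_
  simp only [reflect_apply]
  have := measurable_runMax.comp (measurable_path_sub hX hB)
  fun_prop

lemma reflect_stopAt_right (g : ℝ) (x b : Path) (r : ℝ≥0) :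
    reflect g x (stopAt r b) r = reflect g x b r := by
  have h : runMax (x - stopAt r b) r = runMax (x - b) r := by
    have h1 := runMax_stopAt (x - stopAt r b) r r
    have h2 := runMax_stopAt (x - b) r r
    rw [min_self] at h1 h2
    have h3 : stopAt r (x - stopAt r b) = stopAt r (x - b) := by
      ext t
      simp
    rw [← h1, ← h2, h3]
  rw [reflect_apply, reflect_apply, h]
  simp

lemma stopAt_reflect (g : ℝ) (x b : Path) (L : ℝ≥0) :
    stopAt L (reflect g x b) = reflect g (stopAt L x) (stopAt L b) := by
  ext t
  rw [stopAt_apply, reflect_apply, reflect_apply, ← runMax_stopAt]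
  rfl

lemma stopAt_stopAt (L : ℝ≥0) (w : Path) : stopAt L (stopAt L w) = stopAt L w := by
  ext t
  simp

/-- The flow property of reflection. -/
lemma shiftBy_reflect (g : ℝ) (x b : Path) (r : ℝ≥0) :
    shiftBy r (reflect g x b) = reflect (reflect g x b r) (shiftBy r x) (incrFrom r b) := by
  ext s
  have h : incrFrom r (x - b) = (shiftBy r x - incrFrom r b) - ContinuousMap.const _ (x r) := by
    ext t
    simp only [incrFrom_apply, ContinuousMap.sub_apply, shiftBy_apply, ContinuousMap.const_apply]
    ring
  rw [shiftBy_apply, reflect_apply, reflect_apply, reflect_apply, runMax_add, h, runMax_sub_const,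
    incrFrom_apply, ContinuousMap.sub_apply, ← max_assoc]
  generalize max g (runMax (x - b) r) = a
  generalize runMax (shiftBy r x - incrFrom r b) s = c
  rw [show x r - b r + (c - x r) = c - b r by ring, ← max_add_add_left, ← max_add_add_left]
  congr 1 <;> ring

/-- After a rotation of the pair `(w, b)`, the reflection of `b` off `w` is the sum of the first
path and of Pitman's transform of the second one. -/
lemma reflect_eq_pitman (h x₀ : ℝ) (w b : Path) :
    reflect h (ContinuousMap.const _ x₀ + w) b = ContinuousMap.const _ h + (√2)⁻¹ •
      ((√2)⁻¹ • (w + b) + pitman ((√2)⁻¹ * (x₀ - h)) ((√2)⁻¹ • (w - b))) := by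
  ext t
  have h1 : ContinuousMap.const ℝ≥0 x₀ + w - b = (w - b) + ContinuousMap.const _ x₀ := by
    ext s
    simp only [ContinuousMap.sub_apply, ContinuousMap.add_apply, ContinuousMap.const_apply]
    ring
  have h2 : (√2)⁻¹ * (√2)⁻¹ * 2 = (1 : ℝ) := by
    rw [← mul_inv, Real.mul_self_sqrt (by norm_num)]
    norm_num
  have h3 : (0 : ℝ) ≤ (√2)⁻¹ := by positivity
  rw [reflect_apply, h1, runMax_add_const]
  simp only [ContinuousMap.add_apply, ContinuousMap.const_apply, ContinuousMap.smul_apply,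
    ContinuousMap.sub_apply, smul_eq_mul, pitman_apply]
  rw [runMax_smul h3, ← mul_add]
  generalize runMax (w - b) t = a
  have h4 : max ((√2)⁻¹ * (a + (x₀ - h))) 0 = (√2)⁻¹ * max (a + (x₀ - h)) 0 := by
    rw [mul_max_of_nonneg _ _ h3, mul_zero]
  have h5 : max h (a + x₀) = h + max (a + (x₀ - h)) 0 := by
    rw [← max_add_add_left, max_comm]
    congr 1 <;> ring
  rw [h4, h5]
  linear_combination (-(b t) - max (a + (x₀ - h)) 0) * h2

/-! ### Null sets -/

/-- A function on the line with increments bounded below by those of a linear function of positive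
slope pulls null sets back to null sets. -/
lemma ae_comp_of_expanding {φ : ℝ → ℝ} {c : ℝ} (hc : 0 < c)
    (h : ∀ x y, x ≤ y → c * (y - x) ≤ φ y - φ x) {p : ℝ → Prop} (hp : ∀ᵐ y, p y) :
    ∀ᵐ x, p (φ x) := by
  have key : ∀ x y, x ≤ y → dist x y ≤ c⁻¹ * dist (φ x) (φ y) := by
    intro x y hxy
    have h1 := h x y hxy
    rw [dist_comm, Real.dist_eq, abs_of_nonneg (sub_nonneg.2 hxy), dist_comm, Real.dist_eq,
      inv_mul_eq_div, le_div_iff₀ hc, mul_comm]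
    exact h1.trans (le_abs_self _)
  have hanti : AntilipschitzWith ⟨c⁻¹, by positivity⟩ φ := by
    refine AntilipschitzWith.of_le_mul_dist fun x y => ?_
    rcases le_total x y with hxy | hxy
    · exact key x y hxy
    · rw [dist_comm x, dist_comm (φ x)]
      exact key y x hxy
  have h1 := hanti.hausdorffMeasure_preimage_le zero_le_one {y | ¬ p y}
  rw [hausdorffMeasure_real] at h1
  have h2 : volume {y | ¬ p y} = 0 := hp
  rw [h2, mul_zero] at h1
  exact le_antisymm h1 zero_le

lemma measurableSet_ae {α β : Type*} [MeasurableSpace α] [MeasurableSpace β] {ν : Measure β}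
    [SFinite ν] {p : α → β → Prop} (hp : MeasurableSet {q : α × β | p q.1 q.2}) :
    MeasurableSet {a | ∀ᵐ b ∂ν, p a b} :=
  measurable_measure_prodMk_left (ν := ν) hp.compl (measurableSet_singleton 0)

/-! ### Reflection preserves local absolute continuity with respect to Wiener measure -/

/-- The measure `ν` on path space is absolutely continuous with respect to `μ` on every compact
time interval away from the origin. -/
def LocallyAbsCont (ν μ : Measure Path) : Prop :=
  ∀ (r L : ℝ≥0), r ≠ 0 → ∀ p : Path → Prop, MeasurableSet {w | p w} →
    (∀ᵐ w ∂μ, p (stopAt L (shiftBy r w))) → ∀ᵐ w ∂ν, p (stopAt L (shiftBy r w))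

namespace IsWiener

variable {μ : Measure Path}

/-- Brownian motion after a positive time has the null sets of a Brownian motion whose starting
point is distributed according to Lebesgue measure. -/
lemma ae_shiftBy_iff (hμ : IsWiener μ) {r : ℝ≥0} (hr : r ≠ 0) {p : Path → Prop}
    (hp : MeasurableSet {w | p w}) :
    (∀ᵐ w ∂μ, p (shiftBy r w)) ↔ ∀ᵐ x₀ : ℝ, ∀ᵐ w ∂μ, p (ContinuousMap.const _ x₀ + w) := by
  have := hμ.isProbabilityMeasure
  have hm : Measurable fun q : Path × Path => ContinuousMap.const ℝ≥0 (q.1 r) + q.2 := by fun_prop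
  have hm1 : MeasurableSet {q : Path × Path | p (ContinuousMap.const ℝ≥0 (q.1 r) + q.2)} := hm hp
  have h1 : (∀ᵐ w ∂μ, p (shiftBy r w)) ↔
      ∀ᵐ v ∂(μ.map (stopAt r)), ∀ᵐ w ∂μ, p (ContinuousMap.const _ (v r) + w) := by
    rw [← Measure.ae_prod_iff_ae_ae (p := fun q : Path × Path =>
        p (ContinuousMap.const ℝ≥0 (q.1 r) + q.2)) hm1, ← hμ.map_stopAt_incrFrom r,
      ae_map_iff (by fun_prop) hm1]
    refine eventually_congr (Eventually.of_forall fun w => ?_)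
    have : shiftBy r w = ContinuousMap.const ℝ≥0 (stopAt r w r) + incrFrom r w := by
      ext t
      simp
    rw [this]
  have hm' : Measurable fun q : ℝ × Path => ContinuousMap.const ℝ≥0 q.1 + q.2 := by fun_prop
  have hq : MeasurableSet {x₀ : ℝ | ∀ᵐ w ∂μ, p (ContinuousMap.const _ x₀ + w)} :=
    measurableSet_ae (p := fun (x₀ : ℝ) w => p (ContinuousMap.const _ x₀ + w)) (hm' hp)
  have hmr : Measurable fun v : Path => v r := by fun_prop
  have hq' : MeasurableSet {v : Path | ∀ᵐ w ∂μ, p (ContinuousMap.const _ (v r) + w)} := hmr hq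
  rw [h1, ae_map_iff (by fun_prop) hq']
  simp only [stopAt_apply, min_self]
  have h2 := ae_map_iff (μ := μ) hmr.aemeasurable hq
  rw [hμ.map_eval r] at h2
  refine Iff.trans h2.symm ?_
  exact ⟨fun h => (gaussianReal_absolutelyContinuous' 0 hr).ae_le h,
    fun h => (gaussianReal_absolutelyContinuous 0 hr).ae_le h⟩

/-- Fix a level `h` such that Brownian motion started from `h` almost surely satisfies `p` up to
time `L`. Then so does, for almost every lower level `x₀`, the reflection of an independent
Brownian motion from `h` off a Brownian motion from `x₀`. -/
lemma ae_reflect_const (hμ : IsWiener μ) (L : ℝ≥0) {p : Path → Prop}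
    (hp : MeasurableSet {w | p w}) {h : ℝ}
    (hh : ∀ᵐ w ∂μ, p (stopAt L (ContinuousMap.const _ h + w))) :
    ∀ᵐ x₀ : ℝ, ∀ᵐ w ∂μ, ∀ᵐ b ∂μ,
      x₀ < h → p (stopAt L (reflect h (ContinuousMap.const _ x₀ + w) b)) := by
  have := hμ.isProbabilityMeasure
  have hV : Measurable fun q : Path × Path =>
      stopAt L (ContinuousMap.const ℝ≥0 h + (√2)⁻¹ • (q.1 + q.2)) := by fun_prop
  have hVs : ∀ u v : Path, stopAt L (ContinuousMap.const ℝ≥0 h + (√2)⁻¹ • (u + stopAt L v)) =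
      stopAt L (ContinuousMap.const ℝ≥0 h + (√2)⁻¹ • (u + v)) := fun u v => by
    ext t
    simp
  have hrot : ∀ᵐ u ∂μ, ∀ᵐ v ∂μ,
      p (stopAt L (ContinuousMap.const ℝ≥0 h + (√2)⁻¹ • (u + v))) := by
    have hfst : ∀ᵐ q ∂(μ.prod μ), p (stopAt L (ContinuousMap.const _ h + q.1)) :=
      measurePreserving_fst.quasiMeasurePreserving.ae hh
    rw [← hμ.map_rotation] at hfst
    exact Measure.ae_ae_of_ae_prod (ae_of_ae_map (by fun_prop) hfst)
  let T : ℝ → Path → Path → Prop := fun x₀ u v => x₀ < h →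
    p (stopAt L (ContinuousMap.const ℝ≥0 h +
      (√2)⁻¹ • (u + pitman ((√2)⁻¹ * (x₀ - h)) v)))
  have hpit : ∀ᵐ u ∂μ, ∀ᵐ x₀ : ℝ, ∀ᵐ v ∂μ, T x₀ u v := by
    filter_upwards [hrot] with u hu
    have hVu : Measurable fun v : Path =>
        stopAt L (ContinuousMap.const ℝ≥0 h + (√2)⁻¹ • (u + v)) := by fun_prop
    have hN : MeasurableSet {v | ¬ p (stopAt L (ContinuousMap.const ℝ≥0 h + (√2)⁻¹ • (u + v)))} :=
      (hVu hp).compl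
    have hN0 : μ {v | stopAt L v ∈
        {v | ¬ p (stopAt L (ContinuousMap.const ℝ≥0 h + (√2)⁻¹ • (u + v)))}} = 0 := by
      simp only [Set.mem_ofPred_eq, hVs]
      exact hu
    have h1 := (ae_restrict_iff' measurableSet_Iio).1 (hμ.ae_pitman_null L hN hN0)
    have hc : (0 : ℝ) < (√2)⁻¹ := by positivity
    have h2 := ae_comp_of_expanding (φ := fun x₀ => (√2)⁻¹ * (x₀ - h)) hc
      (fun x y _ => le_of_eq (by ring)) h1
    filter_upwards [h2] with x₀ hx₀
    by_cases hlt : x₀ < h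
    · have h3 := hx₀ (Set.mem_Iio.2 (mul_neg_of_pos_of_neg hc (by linarith)))
      simp only [hVs] at h3
      have h4 : ∀ᵐ v ∂μ, p (stopAt L (ContinuousMap.const ℝ≥0 h +
        (√2)⁻¹ • (u + pitman ((√2)⁻¹ * (x₀ - h)) v))) := h3
      filter_upwards [h4] with v hv _ using hv
    · exact Eventually.of_forall fun v hlt' => absurd hlt' hlt
  have hT : MeasurableSet {q : (ℝ × Path) × Path | T q.1.1 q.1.2 q.2} := by
    have h1 : Measurable fun q : (ℝ × Path) × Path => pitman ((√2)⁻¹ * (q.1.1 - h)) q.2 := by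
      have h0 : Measurable fun q : (ℝ × Path) × Path => ((√2)⁻¹ * (q.1.1 - h), q.2) := by fun_prop
      exact measurable_pitman.comp h0
    have h2 : Measurable fun q : (ℝ × Path) × Path => stopAt L (ContinuousMap.const ℝ≥0 h +
        (√2)⁻¹ • (q.1.2 + pitman ((√2)⁻¹ * (q.1.1 - h)) q.2)) := by fun_prop
    have h3 : MeasurableSet {q : (ℝ × Path) × Path | q.1.1 < h} :=
      measurableSet_lt (by fun_prop) (by fun_prop)
    exact h3.imp (h2 hp)
  have hswap : ∀ᵐ x₀ : ℝ, ∀ᵐ u ∂μ, ∀ᵐ v ∂μ, T x₀ u v :=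
    (Measure.ae_ae_comm (p := fun (x₀ : ℝ) u => ∀ᵐ v ∂μ, T x₀ u v)
      (measurableSet_ae (p := fun (q : ℝ × Path) v => T q.1 q.2 v) hT)).2 hpit
  filter_upwards [hswap] with x₀ hx₀
  have hprod : ∀ᵐ q ∂(μ.prod μ), T x₀ q.1 q.2 := by
    refine (Measure.ae_prod_iff_ae_ae ?_).2 hx₀
    have h1 : Measurable fun q : Path × Path => ((x₀, q.1), q.2) := by fun_prop
    exact h1 hT
  rw [← hμ.map_rotation] at hprod
  have h4 := Measure.ae_ae_of_ae_prod (ae_of_ae_map (by fun_prop) hprod)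
  filter_upwards [h4] with w hw
  filter_upwards [hw] with b hb hlt
  rw [reflect_eq_pitman]
  exact hb hlt

/-- Let `p` hold almost surely for Brownian motion on `[r, r + L]`. Then, for almost every Brownian
path `w` and almost every level `h > w r`, it holds almost surely for the reflection of an
independent Brownian motion from `h` off the path `w` after time `r`. -/
lemma ae_reflect (hμ : IsWiener μ) {r : ℝ≥0} (hr : r ≠ 0) (L : ℝ≥0) {p : Path → Prop}
    (hp : MeasurableSet {w | p w}) (h : ∀ᵐ w ∂μ, p (stopAt L (shiftBy r w))) :
    ∀ᵐ w ∂μ, ∀ᵐ h : ℝ, ∀ᵐ b ∂μ,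
      shiftBy r w 0 < h → p (stopAt L (reflect h (shiftBy r w) b)) := by
  have := hμ.isProbabilityMeasure
  let T : ℝ → Path → Path → Prop := fun h w b => w 0 < h → p (stopAt L (reflect h w b))
  have hT : MeasurableSet {q : (ℝ × Path) × Path | T q.1.1 q.1.2 q.2} := by
    have h1 : Measurable fun q : (ℝ × Path) × Path => stopAt L (reflect q.1.1 q.1.2 q.2) := by
      fun_prop
    have h2 : MeasurableSet {q : (ℝ × Path) × Path | q.1.2 0 < q.1.1} :=
      measurableSet_lt (by fun_prop) (by fun_prop)
    exact h2.imp (h1 hp)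
  have hTm : MeasurableSet {q : ℝ × Path | ∀ᵐ b ∂μ, T q.1 q.2 b} :=
    measurableSet_ae (p := fun (q : ℝ × Path) b => T q.1 q.2 b) hT
  have main : ∀ᵐ h : ℝ, ∀ᵐ x₀ : ℝ, ∀ᵐ w ∂μ, ∀ᵐ b ∂μ, T h (ContinuousMap.const _ x₀ + w) b := by
    have hL := (hμ.ae_shiftBy_iff hr (p := fun w => p (stopAt L w)) (measurable_stopAt L hp)).1 h
    filter_upwards [hL] with h hh
    filter_upwards [hμ.ae_reflect_const L hp hh] with x₀ hx₀
    filter_upwards [hx₀, hμ.ae_eval_zero] with w hw hw0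
    filter_upwards [hw] with b hb hlt
    exact hb (by simpa [hw0] using hlt)
  have main2 : ∀ᵐ x₀ : ℝ, ∀ᵐ h : ℝ, ∀ᵐ w ∂μ, ∀ᵐ b ∂μ, T h (ContinuousMap.const _ x₀ + w) b := by
    refine (Measure.ae_ae_comm (p := fun (h x₀ : ℝ) => ∀ᵐ w ∂μ, ∀ᵐ b ∂μ,
      T h (ContinuousMap.const _ x₀ + w) b) ?_).1 main
    refine measurableSet_ae (p := fun (q : ℝ × ℝ) w => ∀ᵐ b ∂μ,
      T q.1 (ContinuousMap.const _ q.2 + w) b) ?_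
    have h1 : Measurable fun q : (ℝ × ℝ) × Path =>
      (q.1.1, ContinuousMap.const ℝ≥0 q.1.2 + q.2) := by fun_prop
    exact h1 hTm
  have main3 : ∀ᵐ x₀ : ℝ, ∀ᵐ w ∂μ, ∀ᵐ h : ℝ, ∀ᵐ b ∂μ, T h (ContinuousMap.const _ x₀ + w) b := by
    filter_upwards [main2] with x₀ hx₀
    refine (Measure.ae_ae_comm (p := fun (h : ℝ) w => ∀ᵐ b ∂μ,
      T h (ContinuousMap.const _ x₀ + w) b) ?_).1 hx₀
    have h1 : Measurable fun q : ℝ × Path => (q.1, ContinuousMap.const ℝ≥0 x₀ + q.2) := by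
      fun_prop
    exact h1 hTm
  refine (hμ.ae_shiftBy_iff hr (p := fun w => ∀ᵐ h : ℝ, ∀ᵐ b ∂μ, T h w b) ?_).2 main3
  exact measurableSet_ae (p := fun (w : Path) (h : ℝ) => ∀ᵐ b ∂μ, T h w b)
    (measurable_swap hTm)

/-- Starting levels other than `0` do not affect local absolute continuity. -/
lemma locallyAbsCont_const_add (hμ : IsWiener μ) (g : ℝ) :
    LocallyAbsCont (μ.map fun w => ContinuousMap.const _ g + w) μ := by
  intro r L hr p hp h
  have hp' : MeasurableSet {w | p (stopAt L w)} := measurable_stopAt L hp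
  have hm : Measurable fun w : Path => stopAt L (shiftBy r w) := by fun_prop
  have hmp : MeasurableSet {w : Path | p (stopAt L (shiftBy r w))} := hm hp
  rw [ae_map_iff (by fun_prop) hmp]
  have hm' : Measurable fun w : Path => ContinuousMap.const ℝ≥0 g + w := by fun_prop
  rw [hμ.ae_shiftBy_iff hr (p := fun w => p (stopAt L w)) hp'] at h
  have h2 := (measurePreserving_add_left volume g).quasiMeasurePreserving.ae h
  refine (hμ.ae_shiftBy_iff hr (p := fun w => p (stopAt L (ContinuousMap.const ℝ≥0 g + w)))
    (hm' hp')).2 ?_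
  filter_upwards [h2] with x hx
  filter_upwards [hx] with w hw
  have e : ContinuousMap.const ℝ≥0 g + (ContinuousMap.const ℝ≥0 x + w) =
      ContinuousMap.const ℝ≥0 (g + x) + w := by
    ext t
    simp [add_assoc]
  rwa [e]

end IsWiener

/-! ### The value of a reflected path at a fixed time -/

/-- The path which increases linearly from `0` to `1` on `[0, r]` and is constant afterwards. -/
noncomputable def ramp (r : ℝ≥0) : Path where
  toFun t := (min t r : ℝ) / r
  continuous_toFun := by fun_prop

lemma ramp_apply (r t : ℝ≥0) : ramp r t = (min t r : ℝ) / r := rfl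

/-- The bridge on `[0, r]` of a path: the path minus its linear part, frozen at time `r`. -/
noncomputable def bridge (r : ℝ≥0) (w : Path) : Path := stopAt r w - w r • ramp r

lemma bridge_apply (r : ℝ≥0) (w : Path) (t : ℝ≥0) :
    bridge r w t = w (min t r) - (min t r / r : ℝ) * w r := by
  simp [bridge, ramp_apply, mul_comm]

lemma bridge_add (r : ℝ≥0) (w : Path) : bridge r w + w r • ramp r = stopAt r w :=
  sub_add_cancel _ _

lemma measurable_bridge (r : ℝ≥0) : Measurable (bridge r) := by
  refine measurable_path_of_eval fun t => ?_
  simp only [bridge_apply]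
  fun_prop

@[fun_prop]
lemma measurable_path_smul {α : Type*} [MeasurableSpace α] {f : α → ℝ} (hf : Measurable f)
    (w : Path) : Measurable fun a => f a • w :=
  measurable_path_of_eval fun t => by
    simp only [ContinuousMap.smul_apply]
    fun_prop

/-- Along the line `x ↦ b + x • ramp r`, the value of the reflected path at time `r` is a maximum of
affine functions of `x`, and the one coming from time `s` has slope `1 - s / r`. So this value
avoids null sets for almost every `x`, unless it comes from the time `r` itself. -/
lemma ae_reflect_ramp (g : ℝ) (f b : Path) {r : ℝ≥0} (hr : r ≠ 0) {p : ℝ → Prop}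
    (hp : ∀ᵐ y, p y) :
    ∀ᵐ x : ℝ, reflect g f (b + x • ramp r) r ≠ f r → p (reflect g f (b + x • ramp r) r) := by
  have hr' : (0 : ℝ) < r := NNReal.coe_pos.2 (pos_iff_ne_zero.2 hr)
  have hramp : ramp r r = 1 := by rw [ramp_apply, min_self, div_self hr'.ne']
  have hle : ∀ {s}, s ≤ r → ramp r s = s / r := fun {s} hs => by
    rw [ramp_apply, min_eq_left (NNReal.coe_le_coe.2 hs)]
  -- The same maximum, over times up to `q` only.
  let φ : ℝ≥0 → ℝ → ℝ := fun q x =>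
    (b r + x) + max g (runMax (f - (b + x • ramp r)) q)
  have hval : ∀ x s : _, (f - (b + x • ramp r)) s = f s - (b s + x * ramp r s) := fun x s => rfl
  have hφ : ∀ q, q < r → ∀ᵐ x, p (φ q x) := by
    intro q hq
    have hq' : (q : ℝ) < r := hq
    have hc : 0 < 1 - (q : ℝ) / r := by
      rw [sub_pos, div_lt_one hr']
      exact hq'
    refine ae_comp_of_expanding hc (fun x y hxy => ?_) hp
    have hq0 : 0 ≤ (q : ℝ) / r := by positivity
    rcases le_total (runMax (f - (b + x • ramp r)) q) g with h | h
    · simp only [φ, max_eq_left h]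
      have := le_max_left g (runMax (f - (b + y • ramp r)) q)
      nlinarith
    · obtain ⟨s, hs, hsm⟩ := exists_eq_runMax (f - (b + x • ramp r)) q
      have h1 := (le_runMax (f - (b + y • ramp r)) hs).trans
        (le_max_right g (runMax (f - (b + y • ramp r)) q))
      have h2 : (s : ℝ) / r ≤ q / r := by gcongr
      simp only [φ, max_eq_right h]
      rw [hval, hle (hs.trans hq.le)] at h1
      rw [← hsm, hval, hle (hs.trans hq.le)]
      nlinarith
  have hall : ∀ᵐ x, ∀ n : ℕ, p (φ (r * (n / (n + 1))) x) := by
    refine ae_all_iff.2 fun n => hφ _ ?_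
    refine mul_lt_of_lt_one_right (pos_iff_ne_zero.2 hr) ?_
    rw [div_lt_one (by positivity)]
    exact lt_add_one _
  filter_upwards [hall] with x hx hne
  have hpr : (b + x • ramp r) r = b r + x := by
    simp [hramp]
  -- The maximum is attained by the starting level or before time `r`.
  obtain ⟨n, hn⟩ : ∃ n : ℕ, reflect g f (b + x • ramp r) r = φ (r * (n / (n + 1))) x := by
    have hmono : ∀ q ≤ r, φ q x ≤ reflect g f (b + x • ramp r) r := by
      intro q hq
      rw [reflect_apply, hpr]
      simp only [φ]
      gcongr
      rw [runMax_le_iff]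
      exact fun s hs => le_runMax _ (hs.trans hq)
    have hqr : ∀ n : ℕ, r * (n / (n + 1)) ≤ r := fun n =>
      mul_le_of_le_one_right zero_le (div_le_one_of_le₀ (by simp) zero_le)
    obtain ⟨s, hs, hsm⟩ := exists_eq_runMax (f - (b + x • ramp r)) r
    rcases le_total (runMax (f - (b + x • ramp r)) r) g with h | h
    · refine ⟨0, le_antisymm ?_ (hmono _ (hqr 0))⟩
      rw [reflect_apply, hpr, max_eq_left h]
      simp only [φ]
      gcongr
      exact le_max_left _ _
    · have hsr : s < r := by
        refine lt_of_le_of_ne hs ?_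
        rintro rfl
        refine hne ?_
        rw [reflect_apply, max_eq_right h, ← hsm, ContinuousMap.sub_apply]
        ring
      have htend : Tendsto (fun n : ℕ => (r : ℝ) * (n / (n + 1))) atTop (𝓝 (r * 1)) :=
        (tendsto_natCast_div_add_atTop (1 : ℝ)).const_mul _
      rw [mul_one] at htend
      obtain ⟨n, hn⟩ := (htend.eventually (lt_mem_nhds (NNReal.coe_lt_coe.2 hsr))).exists
      have hn' : s ≤ r * (n / (n + 1)) := by
        rw [← NNReal.coe_le_coe]
        push_cast
        exact hn.le
      refine ⟨n, le_antisymm ?_ (hmono _ (hqr n))⟩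
      rw [reflect_apply, hpr, max_eq_right h, ← hsm]
      simp only [φ]
      gcongr
      exact (le_runMax _ hn').trans (le_max_right _ _)
  rw [hn]
  exact hx n

namespace IsWiener

variable {μ ν : Measure Path}

/-- The value at a positive time of Brownian motion reflected off a fixed path `f` has a law which
is absolutely continuous apart from a possible atom at `f r`. -/
lemma ae_reflect_eval (hμ : IsWiener μ) (g : ℝ) (f : Path) {r : ℝ≥0} (hr : r ≠ 0) {p : ℝ → Prop}
    (hpm : MeasurableSet {y | p y}) (hp : ∀ᵐ y, p y) :
    ∀ᵐ b ∂μ, reflect g f b r ≠ f r → p (reflect g f b r) := by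
  have := hμ.isProbabilityMeasure
  have hind : IndepFun (bridge r) (fun w : Path => w r) μ := by
    have h := (hμ.indepFun_eval_bridge hr).symm
    rw [IndepFun_iff_Indep] at h ⊢
    have h2 : MeasurableSpace.comap (bridge r) cylinderMeasurableSpace =
        MeasurableSpace.comap (fun (w : Path) (t : ℝ≥0) =>
          w (min t r) - (min t r / r : ℝ) * w r) MeasurableSpace.pi := by
      rw [cylinderMeasurableSpace, MeasurableSpace.comap_comp]
      congr 1
      ext w t
      exact bridge_apply r w t
    rw [h2]
    exact h
  have hmap := (indepFun_iff_map_prod_eq_prod_map_map (measurable_bridge r).aemeasurable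
    (measurable_eval_path r).aemeasurable).1 hind
  have hm : Measurable fun q : Path × ℝ => reflect g f (q.1 + q.2 • ramp r) r := by fun_prop
  have hmp : MeasurableSet {q : Path × ℝ | reflect g f (q.1 + q.2 • ramp r) r ≠ f r →
      p (reflect g f (q.1 + q.2 • ramp r) r)} :=
    (hm (measurableSet_singleton (f r))).compl.imp (hm hpm)
  have h1 : ∀ᵐ q ∂((μ.map (bridge r)).prod (μ.map fun w => w r)),
      reflect g f (q.1 + q.2 • ramp r) r ≠ f r → p (reflect g f (q.1 + q.2 • ramp r) r) := by
    refine (Measure.ae_prod_iff_ae_ae hmp).2 (Eventually.of_forall fun b => ?_)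
    rw [hμ.map_eval r]
    exact (gaussianReal_absolutelyContinuous 0 hr).ae_le (ae_reflect_ramp g f b hr hp)
  rw [← hmap] at h1
  have h2 := ae_of_ae_map ((measurable_bridge r).prodMk (by fun_prop)).aemeasurable h1
  filter_upwards [h2] with b hb
  simpa only [bridge_add, reflect_stopAt_right] using hb

/-- A path which is locally absolutely continuous is strictly below the reflection of an
independent Brownian motion off it at any given positive time. For a Brownian path this is the
statement that the difference of the two motions is not at its maximum at the final time. -/
lemma ae_lt_reflect (hμ : IsWiener μ) (hν : LocallyAbsCont ν μ) (g : ℝ) {r : ℝ≥0} (hr : r ≠ 0) :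
    ∀ᵐ x ∂ν, ∀ᵐ b ∂μ, x r < reflect g x b r := by
  have := hμ.isProbabilityMeasure
  -- Local absolute continuity gives control on `[s, 2 s]` only, which is enough.
  obtain ⟨s, hs⟩ : ∃ s : ℝ≥0, s + s = r := ⟨r / 2, add_halves r⟩
  have hs0 : s ≠ 0 := by
    rintro rfl
    exact hr (by simpa using hs.symm)
  let p : Path → Prop := fun y => ∀ᵐ b ∂μ, y s - b (s + s) < runMax (y - shiftBy s b) s
  have hpm : MeasurableSet {y | p y} := by
    refine measurableSet_ae (p := fun (y b : Path) =>
      y s - b (s + s) < runMax (y - shiftBy s b) s) ?_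
    exact measurableSet_lt (by fun_prop) (measurable_path_eval (measurable_runMax.comp
      (f := fun q : Path × Path => q.1 - shiftBy s q.2) (by fun_prop)) s)
  have hp : ∀ᵐ w ∂μ, p (stopAt s (shiftBy s w)) := by
    have h1 : ∀ᵐ z ∂μ, incrFrom s z s < runMax (incrFrom s z) s := by
      have h := hμ.ae_eval_lt_runMax hs0
      rw [← hμ.map_incrFrom s] at h
      exact ae_of_ae_map (by fun_prop) h
    have h2 : ∀ᵐ q ∂(μ.prod μ), incrFrom s q.2 s < runMax (incrFrom s q.2) s :=
      measurePreserving_snd.quasiMeasurePreserving.ae h1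
    rw [← hμ.map_rotation] at h2
    have h3 := Measure.ae_ae_of_ae_prod (ae_of_ae_map (by fun_prop) h2)
    filter_upwards [h3] with w hw
    filter_upwards [hw] with b hb
    have hc : (0 : ℝ) < (√2)⁻¹ := by positivity
    have e1 : incrFrom s ((√2)⁻¹ • (w - b)) = (√2)⁻¹ •
        ((shiftBy s w - shiftBy s b) - ContinuousMap.const _ (w s - b s)) := by
      ext t
      simp only [incrFrom_apply, ContinuousMap.smul_apply, ContinuousMap.sub_apply,
        ContinuousMap.const_apply, shiftBy_apply, smul_eq_mul]
      ring
    rw [e1, runMax_smul hc.le, ContinuousMap.smul_apply, smul_eq_mul,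
      mul_lt_mul_iff_right₀ hc, runMax_sub_const] at hb
    simp only [ContinuousMap.sub_apply, ContinuousMap.const_apply, shiftBy_apply] at hb
    obtain ⟨u, hu, h⟩ := (lt_runMax_iff _ _ _).1 ((sub_lt_sub_iff_right _).1 hb)
    refine (lt_runMax_iff _ _ _).2 ⟨u, hu, ?_⟩
    simpa [min_eq_left hu] using h
  filter_upwards [hν s s hs0 p hpm hp] with x hx
  filter_upwards [hx] with b hb
  obtain ⟨u, hu, h⟩ := (lt_runMax_iff _ _ _).1 hb
  have hle := le_runMax (x - b) (s := s + u) (t := r) (by rw [← hs]; gcongr)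
  have hle' := le_max_right g (runMax (x - b) r)
  simp only [stopAt_apply, shiftBy_apply, ContinuousMap.sub_apply, min_self,
    min_eq_left hu] at h hle
  rw [hs] at h
  rw [reflect_apply]
  linarith

/-- **Reflection preserves local absolute continuity.** By the flow property, the reflected path
after time `r` starts from its value `h` at time `r`, and is the reflection of a fresh Brownian
motion off the path `x` after time `r`. Given `x`, the law of `h` is absolutely continuous on
`(x r, ∞)`, so that `ae_reflect` applies. -/
lemma locallyAbsCont_reflect (hμ : IsWiener μ) [SFinite ν] (hν : LocallyAbsCont ν μ) (g : ℝ) :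
    LocallyAbsCont ((ν.prod μ).map fun q => reflect g q.1 q.2) μ := by
  have := hμ.isProbabilityMeasure
  intro r L hr p hp h
  have hm : Measurable fun w : Path => stopAt L (shiftBy r w) := by fun_prop
  have hmp : MeasurableSet {w : Path | p (stopAt L (shiftBy r w))} := hm hp
  have hR : Measurable fun q : Path × Path => reflect g q.1 q.2 := by fun_prop
  have hRp : MeasurableSet {q : Path × Path | p (stopAt L (shiftBy r (reflect g q.1 q.2)))} :=
    hR hmp
  rw [ae_map_iff hR.aemeasurable hmp, Measure.ae_prod_iff_ae_ae hRp]
  let T : Path → ℝ → Path → Prop := fun y h b =>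
    y 0 < h → p (stopAt L (reflect h y b))
  have hT : MeasurableSet {q : (Path × ℝ) × Path | T q.1.1 q.1.2 q.2} := by
    have h1 : Measurable fun q : (Path × ℝ) × Path => stopAt L (reflect q.1.2 q.1.1 q.2) := by
      fun_prop
    have h2 : MeasurableSet {q : (Path × ℝ) × Path | q.1.1 0 < q.1.2} :=
      measurableSet_lt (by fun_prop) (by fun_prop)
    exact h2.imp (h1 hp)
  have hT1 : MeasurableSet {q : Path × ℝ | ∀ᵐ b ∂μ, T q.1 q.2 b} :=
    measurableSet_ae (p := fun (q : Path × ℝ) b => T q.1 q.2 b) hT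
  have hT2 : MeasurableSet {y : Path | ∀ᵐ h : ℝ, ∀ᵐ b ∂μ, T y h b} :=
    measurableSet_ae (p := fun (y : Path) (h : ℝ) => ∀ᵐ b ∂μ, T y h b) hT1
  have hTL : ∀ y h b, T (stopAt L y) h b ↔ T y h b := by
    intro y h b
    simp only [T, stopAt_reflect, stopAt_stopAt, stopAt_apply]
    rw [min_eq_left (zero_le)]
  have hE := hν r L hr (fun y => ∀ᵐ h : ℝ, ∀ᵐ b ∂μ, T y h b) hT2 (by
    simp only [hTL]
    exact hμ.ae_reflect hr L hp h)
  simp only [hTL] at hE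
  filter_upwards [hE, hμ.ae_lt_reflect hν g hr] with x hx hlt
  have hTx : MeasurableSet {h : ℝ | ∀ᵐ b ∂μ, T (shiftBy r x) h b} :=
    measurable_prodMk_left hT1
  have h1 := hμ.ae_reflect_eval g x hr hTx hx
  have h2 : ∀ᵐ b ∂μ, ∀ᵐ b' ∂μ, p (stopAt L (reflect (reflect g x (stopAt r b) r)
      (shiftBy r x) b')) := by
    filter_upwards [h1, hlt] with b hb hb'
    filter_upwards [hb hb'.ne'] with b' h'
    rw [reflect_stopAt_right]
    exact h' (by simpa using hb')
  let F : Path × Path → Path := fun q => stopAt L (reflect (reflect g x q.1 r) (shiftBy r x) q.2)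
  have hF : Measurable F := by fun_prop
  have hFp : MeasurableSet {q : Path × Path | p (F q)} := hF hp
  have hF1 : MeasurableSet {v : Path | ∀ᵐ b' ∂μ, p (F (v, b'))} :=
    measurableSet_ae (p := fun (v b' : Path) => p (F (v, b'))) hFp
  have h3 : ∀ᵐ v ∂(μ.map (stopAt r)), ∀ᵐ b' ∂μ, p (F (v, b')) :=
    (ae_map_iff (by fun_prop) hF1).2 h2
  have h4 := (Measure.ae_prod_iff_ae_ae hFp).2 h3
  rw [← hμ.map_stopAt_incrFrom r] at h4
  filter_upwards [ae_of_ae_map (by fun_prop) h4] with b hb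
  rw [shiftBy_reflect]
  simpa only [F, reflect_stopAt_right] using hb

end IsWiener

/-! ### Last passage values as iterated reflections -/

/-- The lines `f 0, …, f n` with entry costs `g 0, …, g n`, combined from the last line up to the
first by reflection. -/
noncomputable def iterReflect : ℕ → (ℕ → ℝ) → (ℕ → Path) → Path
  | 0, g, f => ContinuousMap.const _ (g 0) + f 0
  | n + 1, g, f => reflect (g 0) (iterReflect n (fun i => g (i + 1)) fun i => f (i + 1)) (f 0)

/-- `τ` lists, from line `0` on, the times at which a path from line `ℓ` at time `0` to line `0` at
time `y` leaves the lines; here lines are numbered from `0`, and `τ (ℓ + 1)` is the starting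
time. -/
structure IsJumpSeq (y : ℝ≥0) (ℓ : ℕ) (τ : ℕ → ℝ≥0) : Prop where
  antitone : Antitone τ
  first : τ 0 = y
  last : τ (ℓ + 1) = 0

/-- The length of the path with the given jump times. -/
def jumpLength (f : ℕ → Path) (ℓ : ℕ) (τ : ℕ → ℝ≥0) : ℝ :=
  ∑ i ∈ Finset.range (ℓ + 1), (f i (τ i) - f i (τ (i + 1)))

lemma jumpLength_succ (f : ℕ → Path) (ℓ : ℕ) (τ : ℕ → ℝ≥0) :
    jumpLength f (ℓ + 1) τ =
      jumpLength (fun i => f (i + 1)) ℓ (fun i => τ (i + 1)) + (f 0 (τ 0) - f 0 (τ 1)) :=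
  Finset.sum_range_succ' _ _

/-- Iterated reflections dominate the lengths of all paths. -/
lemma add_jumpLength_le_iterReflect {n ℓ : ℕ} (hℓ : ℓ ≤ n) {g : ℕ → ℝ} {f : ℕ → Path}
    (hf : ∀ i, f i 0 = 0) {y : ℝ≥0} {τ : ℕ → ℝ≥0} (hτ : IsJumpSeq y ℓ τ) :
    g ℓ + jumpLength f ℓ τ ≤ iterReflect n g f y := by
  induction n generalizing ℓ g f y τ with
  | zero =>
    obtain rfl : ℓ = 0 := by omega
    have hl := hτ.last
    rw [zero_add] at hl
    simp [jumpLength, iterReflect, hτ.first, hl, hf]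
  | succ n ih =>
    rw [iterReflect, reflect_apply]
    rcases ℓ with _ | ℓ
    · have hl := hτ.last
      rw [zero_add] at hl
      simp only [jumpLength, zero_add, Finset.sum_range_one, hτ.first, hl, hf, sub_zero]
      linarith [le_max_left (g 0)
        (runMax (iterReflect n (fun i => g (i + 1)) (fun i => f (i + 1)) - f 0) y)]
    · have h := ih (Nat.le_of_succ_le_succ hℓ) (g := fun i => g (i + 1))
        (f := fun i => f (i + 1)) (fun i => hf _) (y := τ 1) (τ := fun i => τ (i + 1))
        ⟨fun i j hij => hτ.antitone (Nat.succ_le_succ hij), rfl, hτ.last⟩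
      have h1 : τ 1 ≤ y := hτ.first ▸ hτ.antitone zero_le_one
      have h2 := (le_runMax (iterReflect n (fun i => g (i + 1)) (fun i => f (i + 1)) - f 0) h1).trans
        (le_max_right (g 0) _)
      rw [ContinuousMap.sub_apply] at h2
      rw [jumpLength_succ, hτ.first]
      linarith

/-- Iterated reflections are attained as lengths of paths. -/
lemma exists_jumpSeq_eq_iterReflect (n : ℕ) (g : ℕ → ℝ) {f : ℕ → Path} (hf : ∀ i, f i 0 = 0)
    (y : ℝ≥0) :
    ∃ ℓ ≤ n, ∃ τ, IsJumpSeq y ℓ τ ∧ g ℓ + jumpLength f ℓ τ = iterReflect n g f y := by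
  have hdirect : ∀ {f : ℕ → Path}, (∀ i, f i 0 = 0) → ∀ (y : ℝ≥0), ∃ τ, IsJumpSeq y 0 τ ∧
      jumpLength f 0 τ = f 0 y := by
    intro f hf y
    refine ⟨fun i => if i = 0 then y else 0, ⟨fun i j hij => ?_, by simp, by simp⟩, ?_⟩
    · rcases eq_or_ne j 0 with rfl | hj
      · simp [Nat.le_zero.1 hij]
      · simp [hj]
    · simp [jumpLength, hf]
  induction n generalizing g f y with
  | zero =>
    obtain ⟨τ, hτ, h⟩ := hdirect hf y
    exact ⟨0, le_rfl, τ, hτ, by rw [h]; rfl⟩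
  | succ n ih =>
    rw [iterReflect, reflect_apply]
    set H := iterReflect n (fun i => g (i + 1)) (fun i => f (i + 1)) with hH
    rcases le_total (runMax (H - f 0) y) (g 0) with h | h
    · obtain ⟨τ, hτ, h'⟩ := hdirect hf y
      exact ⟨0, Nat.zero_le _, τ, hτ, by rw [h', max_eq_left h, add_comm]⟩
    · obtain ⟨s, hs, hsm⟩ := exists_eq_runMax (H - f 0) y
      obtain ⟨ℓ, hℓ, τ, hτ, h'⟩ := ih (fun i => g (i + 1)) (f := fun i => f (i + 1))
        (fun i => hf _) s
      refine ⟨ℓ + 1, Nat.succ_le_succ hℓ, fun i => Nat.casesOn i y τ, ⟨?_, rfl, hτ.last⟩, ?_⟩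
      · refine antitone_nat_of_succ_le fun i => ?_
        rcases i with _ | i
        · exact hτ.first.le.trans hs
        · exact hτ.antitone (Nat.le_succ i)
      · rw [jumpLength_succ, max_eq_right h, ← hsm, ContinuousMap.sub_apply, ← h']
        show (g (ℓ + 1) + (jumpLength (fun i => f (i + 1)) ℓ τ + (f 0 y - f 0 (τ 0)))) =
          f 0 y + (g (ℓ + 1) + jumpLength (fun i => f (i + 1)) ℓ τ - f 0 s)
        rw [hτ.first]
        ring

/-! ### Paths and their jump times -/

section Paths

variable {ℓ : ℕ} {y : ℝ≥0} {π : ℝ → ℕ+}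

/-- The time at which a path arrives at line `i` is the time at which it leaves line `i + 1`. -/
lemma enterTime_eq_leaveTime (hπ : IsPath 0 (Nat.succPNat ℓ) y 1 π) {i : ℕ} (hi : i < ℓ) :
    enterTime 0 y π (Nat.succPNat i) = leaveTime 0 y π (Nat.succPNat (i + 1)) := by
  have hlt : ∀ t, Nat.succPNat (i + 1) ≤ π t ↔ ¬ π t ≤ Nat.succPNat i := by
    intro t
    rw [not_le, ← PNat.add_one_le_iff]
    rfl
  set A := {t | t ∈ Set.Icc (0 : ℝ) y ∧ π t ≤ Nat.succPNat i} with hA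
  set C := {t | t ∈ Set.Icc (0 : ℝ) y ∧ Nat.succPNat (i + 1) ≤ π t} with hC
  have hyA : (y : ℝ) ∈ A := ⟨⟨y.2, le_rfl⟩, by rw [hπ.right_end]; exact one_le⟩
  have h0C : (0 : ℝ) ∈ C :=
    ⟨⟨le_rfl, y.2⟩, by rw [hπ.left_end]; exact Nat.succPNat_mono hi⟩
  have hbA : BddBelow A := ⟨0, fun s hs => hs.1.1⟩
  have hbC : BddAbove C := ⟨y, fun s hs => hs.1.2⟩
  rw [enterTime, leaveTime]
  apply le_antisymm
  · by_contra! hc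
    obtain ⟨t, h1, h2⟩ := exists_between hc
    have h0 : 0 ≤ t := (le_csSup hbC h0C).trans h1.le
    have hy : t ≤ y := h2.le.trans (csInf_le hbA hyA)
    by_cases h : π t ≤ Nat.succPNat i
    · exact absurd (csInf_le hbA ⟨⟨h0, hy⟩, h⟩) (not_le.2 h2)
    · exact absurd (le_csSup hbC ⟨⟨h0, hy⟩, (hlt t).2 h⟩) (not_le.2 h1)
  · refine csSup_le ⟨0, h0C⟩ fun s hs => le_csInf ⟨_, hyA⟩ fun t ht => ?_
    by_contra! hc
    exact (hlt s).1 hs.2 ((hπ.antitoneOn ht.1 hs.1 hc.le).trans ht.2)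

lemma leaveTime_mem_Icc (hπ : IsPath 0 (Nat.succPNat ℓ) y 1 π) {i : ℕ} (hi : i ≤ ℓ) :
    leaveTime 0 y π (Nat.succPNat i) ∈ Set.Icc (0 : ℝ) y := by
  have h0 : (0 : ℝ) ∈ {t | t ∈ Set.Icc (0 : ℝ) y ∧ Nat.succPNat i ≤ π t} :=
    ⟨⟨le_rfl, y.2⟩, by rw [hπ.left_end]; exact Nat.succPNat_mono hi⟩
  exact ⟨le_csSup ⟨y, fun s hs => hs.1.2⟩ h0, csSup_le ⟨0, h0⟩ fun s hs => hs.1.2⟩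

lemma leaveTime_le (hπ : IsPath 0 (Nat.succPNat ℓ) y 1 π) {i j : ℕ} (hij : i ≤ j) (hj : j ≤ ℓ) :
    leaveTime 0 y π (Nat.succPNat j) ≤ leaveTime 0 y π (Nat.succPNat i) := by
  have h0 : (0 : ℝ) ∈ {t | t ∈ Set.Icc (0 : ℝ) y ∧ Nat.succPNat j ≤ π t} :=
    ⟨⟨le_rfl, y.2⟩, by rw [hπ.left_end]; exact Nat.succPNat_mono hj⟩
  exact csSup_le_csSup ⟨y, fun s hs => hs.1.2⟩ ⟨0, h0⟩
    fun s hs => ⟨hs.1, (Nat.succPNat_mono hij).trans hs.2⟩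

lemma pathLength_eq_sum (F : ℕ+ → ℝ → ℝ) (y : ℝ) (π : ℝ → ℕ+) :
    pathLength F 0 (Nat.succPNat ℓ) y 1 π = ∑ i ∈ Finset.range (ℓ + 1),
      (F (Nat.succPNat i) (leaveTime 0 y π (Nat.succPNat i)) -
        F (Nat.succPNat i) (enterTime 0 y π (Nat.succPNat i))) := by
  rw [pathLength]
  refine (Finset.sum_nbij' Nat.succPNat PNat.natPred ?_ ?_ ?_ ?_ ?_).symm
  · intro i hi
    exact Finset.mem_Icc.2 ⟨one_le, Nat.succPNat_mono (by simpa using hi)⟩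
  · intro i hi
    have := (Finset.mem_Icc.1 hi).2
    rw [← PNat.succPNat_natPred i, Nat.succPNat_le_succPNat] at this
    simpa using Nat.lt_succ_of_le this
  · intro i _
    exact Nat.natPred_succPNat i
  · intro i _
    exact PNat.succPNat_natPred i
  · intro i _
    rfl

/-- Every path has a sequence of jump times. -/
lemma exists_jumpSeq_of_isPath (f : ℕ → Path) (hπ : IsPath 0 (Nat.succPNat ℓ) y 1 π) :
    ∃ τ, IsJumpSeq y ℓ τ ∧
      pathLength (fun i t => f i.natPred t.toNNReal) 0 (Nat.succPNat ℓ) y 1 π =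
        jumpLength f ℓ τ := by
  refine ⟨fun i => if i ≤ ℓ then (leaveTime 0 y π (Nat.succPNat i)).toNNReal else 0,
    ⟨fun i j hij => ?_, ?_, by simp⟩, ?_⟩
  · by_cases hj : j ≤ ℓ
    · simp only [hj, hij.trans hj, if_true]
      exact Real.toNNReal_le_toNNReal (leaveTime_le hπ hij hj)
    · simp [hj]
  · have h : leaveTime 0 y π (Nat.succPNat 0) = y :=
      le_antisymm (leaveTime_mem_Icc hπ (Nat.zero_le _)).2
        (le_csSup ⟨y, fun s hs => hs.1.2⟩ ⟨⟨y.2, le_rfl⟩, one_le⟩)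
    simp [h]
  · rw [pathLength_eq_sum, jumpLength]
    refine Finset.sum_congr rfl fun i hi => ?_
    have hi' : i ≤ ℓ := Nat.lt_succ_iff.1 (Finset.mem_range.1 hi)
    rw [Nat.natPred_succPNat, if_pos hi']
    rcases hi'.eq_or_lt with rfl | hlt
    · have h : enterTime 0 y π (Nat.succPNat i) = 0 :=
        le_antisymm (csInf_le ⟨0, fun s hs => hs.1.1⟩ ⟨⟨le_rfl, y.2⟩, hπ.left_end.le⟩)
          (Real.sInf_nonneg fun s hs => hs.1.1)
      simp [h]
    · rw [if_pos (Nat.succ_le_of_lt hlt), enterTime_eq_leaveTime hπ hlt]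

/-- The path with given jump times: its line at time `t` is the last one left after time `t`, except
that it starts from line `ℓ + 1` at time `0` even if this line is left at once. -/
noncomputable def pathOf (ℓ : ℕ) (τ : ℕ → ℝ≥0) (t : ℝ) : ℕ+ := by
  classical
  exact Nat.succPNat (Nat.findGreatest (fun i => t ≤ 0 ∨ t < τ i) ℓ)

lemma succPNat_le_pathOf_iff {τ : ℕ → ℝ≥0} (hτ : IsJumpSeq y ℓ τ) {i : ℕ} (hi : i ≤ ℓ) (t : ℝ) :
    Nat.succPNat i ≤ pathOf ℓ τ t ↔ i = 0 ∨ t ≤ 0 ∨ t < τ i := by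
  classical
  rw [pathOf, Nat.succPNat_le_succPNat]
  constructor
  · intro h
    refine or_iff_not_imp_left.2 fun h0 => ?_
    have h1 := Nat.findGreatest_of_ne_zero (P := fun i => t ≤ 0 ∨ t < τ i) rfl
      (by omega : Nat.findGreatest (fun i => t ≤ 0 ∨ t < τ i) ℓ ≠ 0)
    exact h1.imp_right fun h2 => h2.trans_le (NNReal.coe_le_coe.2 (hτ.antitone h))
  · rintro (rfl | h)
    · exact Nat.zero_le _
    · exact Nat.le_findGreatest hi h

lemma pathOf_le {τ : ℕ → ℝ≥0} {s t : ℝ}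
    (h : ∀ i ≤ ℓ, (s ≤ 0 ∨ s < τ i) → (t ≤ 0 ∨ t < τ i)) : pathOf ℓ τ s ≤ pathOf ℓ τ t := by
  classical
  rw [pathOf, pathOf, Nat.succPNat_le_succPNat]
  rcases eq_or_ne (Nat.findGreatest (fun i => s ≤ 0 ∨ s < τ i) ℓ) 0 with h0 | h0
  · rw [h0]
    exact Nat.zero_le _
  · exact Nat.le_findGreatest (Nat.findGreatest_le ℓ)
      (h _ (Nat.findGreatest_le ℓ) (Nat.findGreatest_of_ne_zero
        (P := fun i => s ≤ 0 ∨ s < τ i) rfl h0))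

lemma pathOf_congr {τ : ℕ → ℝ≥0} {s t : ℝ} (hs : 0 < s) (ht : 0 < t)
    (h : ∀ i ≤ ℓ, s < τ i ↔ t < τ i) : pathOf ℓ τ s = pathOf ℓ τ t :=
  le_antisymm (pathOf_le fun i hi => Or.imp (fun h' => absurd h' (not_le.2 hs)) (h i hi).1)
    (pathOf_le fun i hi => Or.imp (fun h' => absurd h' (not_le.2 ht)) (h i hi).2)

lemma isPath_pathOf (hy : 0 < y) {τ : ℕ → ℝ≥0} (hτ : IsJumpSeq y ℓ τ) :
    IsPath 0 (Nat.succPNat ℓ) y 1 (pathOf ℓ τ) := by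
  have hy' : (0 : ℝ) < y := hy
  refine ⟨fun s _ t _ hst => pathOf_le fun i _ =>
      Or.imp hst.trans hst.trans_lt, fun t ht => ?_, fun t ht => ?_, ?_, ?_⟩
  · have h1 : ∀ᶠ s : ℝ in 𝓝[≥] t, ∀ i ∈ Finset.range (ℓ + 1), s < τ i ↔ t < τ i := by
      refine (Finset.eventually_all _).2 fun i _ => ?_
      rcases lt_or_ge t (τ i) with h | h
      · filter_upwards [mem_nhdsWithin_of_mem_nhds (Iio_mem_nhds h)] with s hs
        exact iff_of_true hs h
      · filter_upwards [self_mem_nhdsWithin] with s hs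
        exact iff_of_false (not_lt.2 (h.trans hs)) (not_lt.2 h)
    refine tendsto_nhds_of_eventually_eq ?_
    filter_upwards [h1, self_mem_nhdsWithin] with s hs hts
    exact pathOf_congr (ht.1.trans_le hts) ht.1 fun i hi =>
      hs i (Finset.mem_range.2 (Nat.lt_succ_of_le hi))
  · have h1 : ∀ᶠ s : ℝ in 𝓝[<] t, 0 < s ∧ ∀ i ∈ Finset.range (ℓ + 1), s < τ i ↔ t ≤ τ i := by
      have h0 : ∀ᶠ s : ℝ in 𝓝[<] t, 0 < s := mem_nhdsWithin_of_mem_nhds (Ioi_mem_nhds ht.1)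
      refine h0.and ((Finset.eventually_all _).2 fun i _ => ?_)
      rcases le_or_gt t (τ i) with h | h
      · filter_upwards [self_mem_nhdsWithin] with s hs
        exact iff_of_true (lt_of_lt_of_le hs h) h
      · filter_upwards [mem_nhdsWithin_of_mem_nhds (Ioi_mem_nhds h)] with s hs
        exact iff_of_false (not_lt.2 (le_of_lt hs)) (not_le.2 h)
    obtain ⟨s₀, hs₀, h₀⟩ := h1.exists
    refine ⟨pathOf ℓ τ s₀, tendsto_nhds_of_eventually_eq ?_⟩
    filter_upwards [h1] with s hs
    refine pathOf_congr hs.1 hs₀ fun i hi => ?_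
    have hi' := Finset.mem_range.2 (Nat.lt_succ_of_le hi)
    rw [hs.2 i hi', h₀ i hi']
  · refine le_antisymm ?_ ((succPNat_le_pathOf_iff hτ le_rfl 0).2 (Or.inr (Or.inl le_rfl)))
    exact Nat.succPNat_mono (Nat.findGreatest_le ℓ)
  · refine le_antisymm ?_ (one_le)
    by_contra! h
    have h2 : Nat.succPNat 1 ≤ pathOf ℓ τ y := by
      have := PNat.add_one_le_iff.2 h
      exact this
    have hℓ : 1 ≤ ℓ := Nat.succPNat_le_succPNat.1
      (h2.trans (Nat.succPNat_mono (Nat.findGreatest_le ℓ)))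
    rcases (succPNat_le_pathOf_iff hτ hℓ y).1 h2 with h | h | h
    · exact one_ne_zero h
    · exact absurd h (not_le.2 hy')
    · exact absurd (hτ.antitone (Nat.zero_le 1)) (not_le.2 (hτ.first.symm ▸ NNReal.coe_lt_coe.1 h))

lemma leaveTime_pathOf (hy : 0 < y) {τ : ℕ → ℝ≥0} (hτ : IsJumpSeq y ℓ τ) {i : ℕ} (hi : i ≤ ℓ) :
    leaveTime 0 y (pathOf ℓ τ) (Nat.succPNat i) = τ i := by
  have hy' : (0 : ℝ) < y := hy
  have hτy : (τ i : ℝ) ≤ y := NNReal.coe_le_coe.2 (hτ.first ▸ hτ.antitone (Nat.zero_le i))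
  rw [leaveTime]
  refine csSup_eq_of_forall_le_of_forall_lt_exists_gt
    ⟨0, ⟨le_rfl, y.2⟩, (succPNat_le_pathOf_iff hτ hi 0).2 (Or.inr (Or.inl le_rfl))⟩ ?_ ?_
  · rintro t ⟨ht, h⟩
    rcases (succPNat_le_pathOf_iff hτ hi t).1 h with rfl | h | h
    · rw [hτ.first]; exact ht.2
    · exact h.trans (τ i).2
    · exact h.le
  · intro w hw
    rcases lt_or_ge w 0 with h | h
    · exact ⟨0, ⟨⟨le_rfl, y.2⟩, (succPNat_le_pathOf_iff hτ hi 0).2 (Or.inr (Or.inl le_rfl))⟩, h⟩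
    · obtain ⟨t, h1, h2⟩ := exists_between hw
      exact ⟨t, ⟨⟨h.trans h1.le, h2.le.trans hτy⟩,
        (succPNat_le_pathOf_iff hτ hi t).2 (Or.inr (Or.inr h2))⟩, h1⟩

lemma pathLength_pathOf (f : ℕ → Path) (hy : 0 < y) {τ : ℕ → ℝ≥0} (hτ : IsJumpSeq y ℓ τ) :
    pathLength (fun i t => f i.natPred t.toNNReal) 0 (Nat.succPNat ℓ) y 1 (pathOf ℓ τ) =
      jumpLength f ℓ τ := by
  have hπ := isPath_pathOf hy hτ
  rw [pathLength_eq_sum, jumpLength]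
  refine Finset.sum_congr rfl fun i hi => ?_
  have hi' : i ≤ ℓ := Nat.lt_succ_iff.1 (Finset.mem_range.1 hi)
  rw [Nat.natPred_succPNat, leaveTime_pathOf hy hτ hi']
  rcases hi'.eq_or_lt with rfl | hlt
  · have h : enterTime 0 y (pathOf i τ) (Nat.succPNat i) = 0 :=
      le_antisymm (csInf_le ⟨0, fun s hs => hs.1.1⟩ ⟨⟨le_rfl, y.2⟩, hπ.left_end.le⟩)
        (Real.sInf_nonneg fun s hs => hs.1.1)
    simp [h, hτ.last]
  · rw [enterTime_eq_leaveTime hπ hlt, leaveTime_pathOf hy hτ hlt]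
    simp

end Paths

/-- Last passage values to line `1` at a positive time are values of iterated reflections. -/
lemma maxLastPassage_eq_iterReflect (n : ℕ) (g : ℕ → ℝ) {f : ℕ → Path} (hf : ∀ i, f i 0 = 0)
    {y : ℝ≥0} (hy : 0 < y) :
    maxLastPassage (fun i t => f i.natPred t.toNNReal) (fun j : Fin (n + 1) => g j) y =
      iterReflect n g f y := by
  set F : ℕ+ → ℝ → ℝ := fun i t => f i.natPred t.toNNReal
  have hle : ∀ ℓ ≤ n, ∀ x ∈ {x | ∃ π : ℝ → ℕ+, IsPath 0 (Nat.succPNat ℓ) y 1 π ∧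
      x = pathLength F 0 (Nat.succPNat ℓ) y 1 π}, x ≤ iterReflect n g f y - g ℓ := by
    rintro ℓ hℓ x ⟨π, hπ, rfl⟩
    obtain ⟨τ, hτ, h⟩ := exists_jumpSeq_of_isPath f hπ
    rw [h]
    linarith [add_jumpLength_le_iterReflect hℓ (g := g) hf hτ]
  have hne : ∀ ℓ : ℕ, {x | ∃ π : ℝ → ℕ+, IsPath 0 (Nat.succPNat ℓ) y 1 π ∧
      x = pathLength F 0 (Nat.succPNat ℓ) y 1 π}.Nonempty := by
    intro ℓ
    have hτ : IsJumpSeq y ℓ fun i => if i = 0 then y else 0 := by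
      refine ⟨fun i j hij => ?_, by simp, by simp⟩
      rcases eq_or_ne j 0 with rfl | hj
      · simp [Nat.le_zero.1 hij]
      · simp [hj]
    exact ⟨_, _, isPath_pathOf hy hτ, rfl⟩
  have hub : ∀ j : Fin (n + 1),
      g j + lastPassage F 0 (Nat.succPNat j) y 1 ≤ iterReflect n g f y := by
    intro j
    have := csSup_le (hne j) (hle j (Nat.lt_succ_iff.1 j.2))
    rw [lastPassage]
    linarith
  apply le_antisymm
  · exact ciSup_le hub
  · obtain ⟨ℓ, hℓ, τ, hτ, h⟩ := exists_jumpSeq_eq_iterReflect n g hf y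
    have h1 : jumpLength f ℓ τ ≤ lastPassage F 0 (Nat.succPNat ℓ) y 1 :=
      le_csSup ⟨_, hle ℓ hℓ⟩ ⟨_, isPath_pathOf hy hτ, (pathLength_pathOf f hy hτ).symm⟩
    have h2 := le_ciSup (f := fun j : Fin (n + 1) => g j + lastPassage F 0 (Nat.succPNat j) y 1)
      ⟨_, Set.forall_mem_range.2 hub⟩ ⟨ℓ, Nat.lt_succ_of_le hℓ⟩
    rw [← h]
    exact (add_le_add_right h1 (g ℓ)).trans h2

/-! ### The law of iterated reflections of independent Brownian motions -/

lemma iterReflect_congr (n : ℕ) (g : ℕ → ℝ) {f f' : ℕ → Path} (h : ∀ i ≤ n, f i = f' i) :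
    iterReflect n g f = iterReflect n g f' := by
  induction n generalizing g f f' with
  | zero => rw [iterReflect, iterReflect, h 0 le_rfl]
  | succ n ih =>
    rw [iterReflect, iterReflect, h 0 (Nat.zero_le _),
      ih _ (f := fun i => f (i + 1)) fun i hi => h (i + 1) (Nat.succ_le_succ hi)]

lemma measurable_iterReflect {α : Type*} [MeasurableSpace α] (n : ℕ) (g : ℕ → ℝ)
    {f : α → ℕ → Path} (hf : ∀ i, Measurable fun a => f a i) :
    Measurable fun a => iterReflect n g (f a) := by
  induction n generalizing g f with
  | zero => exact measurable_path_add measurable_const (hf 0)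
  | succ n ih => exact measurable_reflect measurable_const (ih _ fun i => hf (i + 1)) (hf 0)

lemma reflect_smul {c : ℝ} (hc : 0 ≤ c) (g : ℝ) (x b : Path) :
    reflect (c * g) (c • x) (c • b) = c • reflect g x b := by
  ext t
  simp only [reflect_apply, ContinuousMap.smul_apply, smul_eq_mul]
  rw [← smul_sub, runMax_smul hc, ← mul_max_of_nonneg _ _ hc, mul_add]

lemma iterReflect_smul {c : ℝ} (hc : 0 ≤ c) (n : ℕ) (g : ℕ → ℝ) (f : ℕ → Path) :
    iterReflect n (fun i => c * g i) (fun i => c • f i) = c • iterReflect n g f := by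
  induction n generalizing g f with
  | zero =>
    ext t
    simp [iterReflect]
  | succ n ih =>
    rw [iterReflect, ih (fun i => g (i + 1)) (fun i => f (i + 1)), reflect_smul hc, iterReflect]

/-- Iterated reflections of independent Brownian motions are, away from time `0`, locally absolutely
continuous with respect to Brownian motion. -/
lemma IsWiener.locallyAbsCont_iterReflect {μ : Measure Path} (hμ : IsWiener μ) {Ω : Type*}
    [MeasurableSpace Ω] {P : Measure Ω} (n : ℕ) (g : ℕ → ℝ) {X : ℕ → Ω → Path}
    (hX : ∀ i, Measurable (X i)) (hXμ : ∀ i, P.map (X i) = μ) (hind : iIndepFun X P) :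
    LocallyAbsCont (P.map fun ω => iterReflect n g fun i => X i ω) μ := by
  classical
  have := hμ.isProbabilityMeasure
  have := hind.isProbabilityMeasure
  induction n generalizing g X with
  | zero =>
    have h := hμ.locallyAbsCont_const_add (g 0)
    rw [← hXμ 0, Measure.map_map (by fun_prop) (hX 0), hXμ 0] at h
    exact h
  | succ n ih =>
    have hH : Measurable fun ω => iterReflect n (fun i => g (i + 1)) fun i => X (i + 1) ω :=
      measurable_iterReflect n _ fun i => hX (i + 1)
    have h := ih (fun i => g (i + 1)) (X := fun i => X (i + 1)) (fun i => hX _) (fun i => hXμ _)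
      (hind.precomp (add_left_injective 1))
    have hI : IndepFun (fun ω => iterReflect n (fun i => g (i + 1)) fun i => X (i + 1) ω) (X 0)
        P := by
      -- The reflection of the later lines is a function of the lines with indices in `S`.
      let S : Finset ℕ := Finset.Icc 1 (n + 1)
      have h0 := hind.indepFun_finset S {0} (by simp [S]) hX
      let Ψ : (S → Path) → Path := fun v => iterReflect n (fun i => g (i + 1)) fun i =>
        if hi : i + 1 ∈ S then v ⟨i + 1, hi⟩ else 0
      have hΨ : Measurable Ψ := by
        refine measurable_iterReflect n _ fun i => ?_
        split_ifs with hi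
        · exact measurable_pi_apply _
        · exact measurable_const
      have hev : Measurable fun v : ({0} : Finset ℕ) → Path => v ⟨0, by simp⟩ :=
        measurable_pi_apply _
      have h1 := h0.comp hΨ hev
      refine h1.congr (Eventually.of_forall fun ω => ?_) (Eventually.of_forall fun ω => rfl)
      refine iterReflect_congr n _ fun i hi => ?_
      rw [dif_pos (Finset.mem_Icc.2 ⟨Nat.le_add_left 1 i, Nat.succ_le_succ hi⟩)]
    have h2 := hμ.locallyAbsCont_reflect h (g 0)
    rw [← hXμ 0, ← hI.map_prod_eq_prod_map_map hH.aemeasurable (hX 0).aemeasurable,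
      Measure.map_map (by fun_prop) (hH.prodMk (hX 0)), hXμ 0] at h2
    exact h2

/-! ### Brownian motions as random elements of path space -/

/-- A Brownian motion is almost surely equal to a random element of path space. -/
lemma exists_measurable_path {Ω : Type*} [MeasurableSpace Ω] {P : Measure Ω} {W : ℝ≥0 → Ω → ℝ}
    (hW : IsBrownianReal W P) :
    ∃ X : Ω → Path, Measurable X ∧ IsWiener (P.map X) ∧ ∀ᵐ ω ∂P, ∀ t, X ω t = W t ω := by
  classical
  let Y : Ω → Path := fun ω => if h : Continuous fun t => W t ω then ⟨fun t => W t ω, h⟩ else 0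
  have hY : ∀ᵐ ω ∂P, ∀ t, Y ω t = W t ω := by
    filter_upwards [hW.cont] with ω hω t
    simp only [Y, dif_pos hω]
    rfl
  have hYm : AEMeasurable Y P := by
    refine NullMeasurable.aemeasurable ?_
    have hev : ∀ t, Measurable (fun ω : NullMeasurableSpace Ω P => Y ω t) := fun t => by
      have h1 : AEMeasurable (fun ω => Y ω t) P :=
        (hW.toIsPreBrownianReal.aemeasurable t).congr (hY.mono fun ω h => (h t).symm)
      exact fun s hs => h1.nullMeasurable hs
    exact fun s hs => measurable_path_of_eval hev hs
  have hX : ∀ᵐ ω ∂P, ∀ t, hYm.mk Y ω t = W t ω := by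
    filter_upwards [hY, hYm.ae_eq_mk] with ω h1 h2
    rwa [← h2]
  refine ⟨hYm.mk Y, hYm.measurable_mk, IsWiener.of_process hYm.measurable_mk.aemeasurable ?_, hX⟩
  exact hW.toIsPreBrownianReal.congr fun t => hX.mono fun ω h => (h t).symm

/-- An ensemble of independent Brownian motions is almost surely equal to a sequence of independent
random elements of path space, up to the diffusion parameter. -/
lemma IsBrownianEnsemble.exists_measurable_path {Ω : Type*} [MeasurableSpace Ω] {P : Measure Ω}
    {B : ℕ+ → ℝ≥0 → Ω → ℝ} (hB : IsBrownianEnsemble 2 B P) :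
    ∃ X : ℕ → Ω → Path, (∀ i, Measurable (X i)) ∧ (∀ i, IsWiener (P.map (X i))) ∧
      iIndepFun X P ∧ ∀ᵐ ω ∂P, ∀ i t, B (Nat.succPNat i) t ω = √2 * X i ω t := by
  choose W hW hBW using hB.brownian
  choose X hX hXW hXeq using fun i : ℕ => BrownianLPP.exists_measurable_path (hW (Nat.succPNat i))
  refine ⟨X, hX, hXW, ?_, ?_⟩
  · have h1 : iIndepFun (fun (i : ℕ) ω (t : ℝ≥0) => (√2)⁻¹ * B (Nat.succPNat i) t ω) P :=
      (hB.indep.precomp Nat.succPNat_injective).comp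
        (fun _ (v : ℝ≥0 → ℝ) t => (√2)⁻¹ * v t) fun i => by fun_prop
    have h2 : iIndepFun (fun (i : ℕ) ω (t : ℝ≥0) => X i ω t) P := by
      refine h1.congr fun i => ?_
      filter_upwards [hXeq i] with ω hω
      ext t
      rw [hBW, hω t]
      simp
    rw [iIndepFun_iff_iIndep] at h2 ⊢
    convert! h2 using 2 with i
    rw [cylinderMeasurableSpace, MeasurableSpace.comap_comp]
    rfl
  · filter_upwards [ae_all_iff.2 hXeq] with ω hω i t
    rw [hBW, hω i t]
    simp

/-! ### Restriction to a compact time interval -/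

/-- A random continuous function on a compact interval is measurable as soon as its values are. -/
lemma measurable_continuousMap_of_eval {α : Type*} [MeasurableSpace α] {a b : ℝ} (hab : a ≤ b)
    {F : α → C(Set.Icc a b, ℝ)} (hF : ∀ t, Measurable fun x => F x t) : Measurable F := by
  have : Nonempty (Set.Icc a b) := ⟨⟨a, le_rfl, hab⟩⟩
  let E : C(Set.Icc a b, ℝ) → ℕ → ℝ := fun w n => w (TopologicalSpace.denseSeq _ n)
  have hE : Continuous E := continuous_pi fun n => continuous_eval_const _
  have hinj : Function.Injective E := by
    intro v w h
    have h1 : (v : Set.Icc a b → ℝ) = w :=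
      (TopologicalSpace.denseRange_denseSeq _).equalizer v.continuous w.continuous h
    exact DFunLike.coe_injective h1
  -- An injective continuous map between Polish spaces is a measurable embedding.
  have hemb : MeasurableEmbedding E := hE.measurableEmbedding hinj
  exact hemb.measurable_comp_iff.1 (measurable_pi_iff.2 fun n => hF _)

/-- The restriction of a path to `[a, b]`, multiplied by `c`, in terms of the path from time `a`
on. -/
def scaledRestrict (c a b : ℝ) (w : Path) : C(Set.Icc a b, ℝ) where
  toFun t := c * w (t - a).toNNReal
  continuous_toFun := by fun_prop

lemma scaledRestrict_apply (c a b : ℝ) (w : Path) (t : Set.Icc a b) :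
    scaledRestrict c a b w t = c * w (t - a).toNNReal := rfl

lemma restrictPath_eq_scaledRestrict {c a b : ℝ} (ha : 0 ≤ a) {F : ℝ → ℝ} {w : Path}
    (h : ∀ t ∈ Set.Icc a b, F t = c * w t.toNNReal) :
    ContinuousOn F (Set.Icc a b) ∧ restrictPath a b F =
      scaledRestrict c a b (stopAt (b - a).toNNReal (shiftBy a.toNNReal w)) := by
  have hcont : ContinuousOn F (Set.Icc a b) := by
    have h1 : Continuous fun t : ℝ => c * w t.toNNReal := by fun_prop
    exact h1.continuousOn.congr h
  refine ⟨hcont, ?_⟩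
  ext t
  have e : a.toNNReal + min ((t : ℝ) - a).toNNReal (b - a).toNNReal = (t : ℝ).toNNReal := by
    rw [min_eq_left (Real.toNNReal_le_toNNReal (sub_le_sub_right t.2.2 a)),
      ← Real.toNNReal_add ha (sub_nonneg.2 t.2.1), add_sub_cancel]
  rw [restrictPath, dif_pos hcont, scaledRestrict_apply, stopAt_apply, shiftBy_apply, e]
  exact h t t.2

end BrownianLPP

open BrownianLPP in
theorem mainTheorem5 {Ω Ω' : Type*} [MeasurableSpace Ω] [MeasurableSpace Ω']
    (P : Measure Ω) [IsProbabilityMeasure P] (Q : Measure Ω') [IsProbabilityMeasure Q]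
    (B : ℕ+ → ℝ≥0 → Ω → ℝ) (hB : BrownianLPP.IsBrownianEnsemble 2 B P)
    (W : ℝ≥0 → Ω' → ℝ) (hW : BrownianLPP.IsBrownianMotion 2 W Q)
    (y₀ r : ℝ) (hr : 0 < r) (hry : r < y₀) (k : ℕ) (hk : 1 ≤ k) (g : Fin k → ℝ) :
    (∀ᵐ ω ∂P, ContinuousOn (BrownianLPP.brownianH B g ω) (Set.Icc r y₀)) ∧
    AEMeasurable (fun ω => BrownianLPP.restrictPath r y₀ (BrownianLPP.brownianH B g ω)) P ∧
    P.map (fun ω => BrownianLPP.restrictPath r y₀ (BrownianLPP.brownianH B g ω)) ≪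
      Q.map (fun ω => BrownianLPP.restrictPath r y₀ (fun t => W t.toNNReal ω)) := by
  obtain ⟨n, rfl⟩ := Nat.exists_eq_succ_of_ne_zero (Nat.one_le_iff_ne_zero.1 hk)
  obtain ⟨X, hX, hXw, hXi, hXB⟩ := hB.exists_measurable_path
  obtain ⟨V, hV, hVW⟩ := hW
  obtain ⟨Y, hY, hYw, hYV⟩ := exists_measurable_path hV
  -- The ensemble is `√2` times a standard one, and last passage values are homogeneous.
  let G : ℕ → ℝ := fun i => if h : i < n + 1 then g ⟨i, h⟩ else 0
  let H : Ω → Path := fun ω => iterReflect n (fun i => (√2)⁻¹ * G i) fun i => X i ω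
  have hHm : Measurable H := measurable_iterReflect n _ hX
  let Φ : Path → C(Set.Icc r y₀, ℝ) := scaledRestrict √2 r y₀
  have hΦ : Measurable Φ := by
    refine measurable_continuousMap_of_eval hry.le fun t => ?_
    simp only [Φ, scaledRestrict_apply]
    fun_prop
  let R : Path → Path := fun w => stopAt (y₀ - r).toNNReal (shiftBy r.toNNReal w)
  have hR : Measurable R := by fun_prop
  have h2 : √2 * (√2)⁻¹ = (1 : ℝ) := mul_inv_cancel₀ (by positivity)
  have hH : ∀ᵐ ω ∂P, ContinuousOn (brownianH B g ω) (Set.Icc r y₀) ∧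
      restrictPath r y₀ (brownianH B g ω) = Φ (R (H ω)) := by
    have h0 : ∀ᵐ ω ∂P, ∀ i, X i ω 0 = 0 :=
      ae_all_iff.2 fun i => ae_of_ae_map (hX i).aemeasurable (hXw i).ae_eval_zero
    filter_upwards [hXB, h0] with ω hω hω0
    refine restrictPath_eq_scaledRestrict hr.le fun t ht => ?_
    have ht0 : 0 < t := hr.trans_le ht.1
    have hlines : (fun (i : ℕ+) (s : ℝ) => B i s.toNNReal ω) =
        fun i s => (√2 • X i.natPred ω) s.toNNReal := by
      ext i s
      rw [← PNat.succPNat_natPred i, hω, Nat.natPred_succPNat]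
      rfl
    have hg : g = fun j : Fin (n + 1) => G j := by
      ext j
      have hj : (j : ℕ) < n + 1 := j.2
      simp only [G, dif_pos hj]
    have h := maxLastPassage_eq_iterReflect n G (f := fun i => √2 • X i ω)
      (fun i => by simp [hω0 i]) (y := t.toNNReal) (Real.toNNReal_pos.2 ht0)
    rw [Real.coe_toNNReal t ht0.le, ← hlines, ← hg] at h
    rw [brownianH, h]
    have hs := iterReflect_smul (Real.sqrt_nonneg 2) n (fun i => (√2)⁻¹ * G i) fun i => X i ω
    simp only [← mul_assoc, h2, one_mul] at hs
    rw [hs]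
    rfl
  have hQ : ∀ᵐ ω ∂Q, restrictPath r y₀ (fun t => W t.toNNReal ω) = Φ (R (Y ω)) := by
    filter_upwards [hYV] with ω hω
    refine (restrictPath_eq_scaledRestrict hr.le fun t _ => ?_).2
    rw [hVW, hω]
    simp
  have hYA : Measurable fun ω => Φ (R (Y ω)) := hΦ.comp (hR.comp hY)
  have hHA : Measurable fun ω => Φ (R (H ω)) := hΦ.comp (hR.comp hHm)
  have hHae : (fun ω => Φ (R (H ω))) =ᵐ[P] fun ω => restrictPath r y₀ (brownianH B g ω) :=
    hH.mono fun ω h => h.2.symm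
  refine ⟨hH.mono fun ω h => h.1, hHA.aemeasurable.congr hHae, ?_⟩
  rw [← Measure.map_congr hHae, Measure.map_congr hQ]
  refine Measure.AbsolutelyContinuous.mk fun A hA h0 => ?_
  rw [Measure.map_apply hYA hA] at h0
  rw [Measure.map_apply hHA hA]
  have hac := hYw.locallyAbsCont_iterReflect n (fun i => (√2)⁻¹ * G i) hX
    (fun i => (hXw i).unique hYw) hXi
  have hp : MeasurableSet {w : Path | Φ w ∉ A} := (hΦ hA).compl
  have h1 : ∀ᵐ w ∂(Q.map Y), Φ (R w) ∉ A := (ae_map_iff hY.aemeasurable (hR hp)).2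
    (measure_eq_zero_iff_ae_notMem.1 h0)
  have h3 := hac r.toNNReal (y₀ - r).toNNReal (Real.toNNReal_pos.2 hr).ne' (fun w => Φ w ∉ A) hp h1
  exact measure_eq_zero_iff_ae_notMem.2 (ae_of_ae_map hHm.aemeasurable h3)
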